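/- Let $(\overline M,\overline\varphi,\overline\xi,\overline\eta,\overline g)$ be an almost contact B-metric manifold of dimension $2n+1$, $n\ge 2$: $\overline g$ is a semi-Riemannian metric, $\overline\varphi^2=-\mathrm{id}+\overline\eta\otimes\overline\xi$, $\overline\eta(\overline\xi)=1$ and $\overline g(\overline\varphi X,\overline\varphi Y)=-\overline g(X,Y)+\overline\eta(X)\overline\eta(Y)$. Let $\overline{\widetilde g}(X,Y)=\overline g(X,\overline\varphi Y)+\overline\eta(X)\overline\eta(Y)$ be the associated metric. Assume that $\overline M$ is an $\mathcal F_0$-manifold, i.e. $\overline\nabla\,\overline\varphi=0$ for the Levi-Civita connection $\overline\nabla$ of $\overline g$, and that it has pointwise constant totally real sectional curvatures: there are functions $\overline\nu,\overline{\widetilde\nu}$ on $\overline M$ such that, for every $p\in\overline M$ and every $\overline g$-non-degenerate plane $\alpha=\mathrm{span}\{x,y\}\subset T_p\overline M$ with $\overline\varphi\alpha\perp\alpha$ and $\alpha\perp\overline\xi$ (with respect to $\overline g$), $$\frac{\overline g(\overline R(x,y)y,x)}{\overline g(x,x)\overline g(y,y)-\overline g(x,y)^2}=\overline\nu(p),\qquad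 \frac{\overline{\widetilde g}(\overline{\widetilde R}(x,y)y,x)}{\overline g(x,x)\overline g(y,y)-\overline g(x,y)^2}=\overline{\widetilde\nu}(p),$$ where $\overline R,\overline{\widetilde R}$ are the curvature tensors of the Levi-Civita connections of $\overline g,\overline{\widetilde g}$. Let $M$ be a connected half lightlike submanifold of $(\overline M,\overline g)$, with induced metric $g$: $M$ is an immersed submanifold of codimension $2$, $\mathrm{Rad}(TM)=\mathrm{span}\{\xi\}$ is the rank one radical of $g$, $TM=\mathrm{Rad}(TM)\perp S(TM)$ with a screen distribution $S(TM)$, $L$ is a section of $TM^\perp$ with $\overline g(L,L)=\pm1$ that spans the screen transversal bundle $S(TM^\perp)$, and $N$ is the section of $T\overline M|_M$ with $\overline g(N,\xi)=1$ and $\overline g(N,N)=\overline g(N,L)=\overline g(N,X)=0$ for $X\in S(TM)$. Let $\nabla$ be the induced connection, i.e. the $TM$-component of $\overline\nabla$ in $T\overline M|_M=TM\oplus\mathrm{span}\{N\}\oplus\mathrm{span}\{L\}$. Assume that $M$ is radical screen transversal, $\overline\varphi(\mathrm{Rad}(TM))=S(TM^\perp)$, and ascreen, $\overline\xi\in\mathrm{Rad}(TM)\oplus\mathrm{span}\{N\}$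 along $M$. Put $\mu=\overline\eta(\xi)$. Assume that $M$ is screen totally umbilical: there is a smooth function $\gamma$ on $M$ with $C(X,PY)=\gamma\, g(X,Y)$ for all tangent $X,Y$, where $P$ is the projection of $TM$ on $S(TM)$ along $\mathrm{Rad}(TM)$ and $C(X,PY)=\overline g(\nabla_X PY,N)$ is the $\xi$-component of $\nabla_XPY$ in $TM=S(TM)\oplus\mathrm{Rad}(TM)$. Let $\widetilde g$ be the metric induced on $M$ by $\overline{\widetilde g}$. Assume that $\overline\nu$ vanishes at no point of $M$. Then the following are equivalent: (i) $(M,g)$ is Ricci semi-symmetric: $Ric(R(X,Y)X_1,X_2)+Ric(X_1,R(X,Y)X_2)=0$ for all tangent $X,Y,X_1,X_2$, where $R$ is the curvature tensor of $\nabla$ and $Ric(Y,Z)=\mathrm{trace}\{X\mapsto R(X,Y)Z\}$; (ii) $(M,\widetilde g)$ is Ricci semi-symmetric: the same condition for the curvature and Ricci tensors of the Levi-Civita connection of $\widetilde g$; (iii) $(M,g)$ is $\overline\eta$-Einstein: $Ric=k\,g+c\,\overline\eta\otimes\overline\eta$ on $TM$ with constants $k,c$; (iv) $(M,\widetilde g)$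 is Einstein: $\widetilde{Ric}=k\,\widetilde g$ with a constant $k$; (v) $\overline\nu=4\mu^2\gamma^2$ on $M$. -/

import Mathlib

open Set Bundle
open scoped Manifold ContDiff Topology

set_option maxSynthPendingDepth 3

noncomputable section

namespace BMetricGeometry

/-! ### Bilinear forms and tensor fields -/

/-- The pull-back `(v, w) ↦ b (A v) (A w)` of a bilinear form along a linear map. -/
def pullForm {V W : Type*} [AddCommGroup V] [Module ℝ V] [TopologicalSpace V]
    [IsTopologicalAddGroup V] [ContinuousSMul ℝ V]
    [AddCommGroup W] [Module ℝ W] [TopologicalSpace W]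
    [IsTopologicalAddGroup W] [ContinuousSMul ℝ W]
    (b : V →L[ℝ] V →L[ℝ] ℝ) (A : W →L[ℝ] V) : W →L[ℝ] W →L[ℝ] ℝ :=
  (ContinuousLinearMap.precomp ℝ A).comp (b.comp A)

@[simp] theorem pullForm_apply {V W : Type*} [AddCommGroup V] [Module ℝ V] [TopologicalSpace V]
    [IsTopologicalAddGroup V] [ContinuousSMul ℝ V]
    [AddCommGroup W] [Module ℝ W] [TopologicalSpace W]
    [IsTopologicalAddGroup W] [ContinuousSMul ℝ W]
    (b : V →L[ℝ] V →L[ℝ] ℝ) (A : W →L[ℝ] V) (v w : W) :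
    pullForm b A v w = b (A v) (A w) := rfl

/-- Fields of bilinear forms on the tangent spaces of `N`, a manifold modelled on `F`. -/
abbrev FormField (F : Type*) [NormedAddCommGroup F] [NormedSpace ℝ F]
    (N : Type*) [TopologicalSpace N] [ChartedSpace F N] : Type _ :=
  ∀ x : N, TangentSpace 𝓘(ℝ, F) x →L[ℝ] TangentSpace 𝓘(ℝ, F) x →L[ℝ] ℝ

/-! ### Connections, curvature and Ricci tensor in coordinates

A linear connection on an open piece of a vector space `F` is given by its coefficients
`Γ y v w`: for vector fields `X`, `Y` one has `∇_X Y = DY(X) + Γ(X, Y)`. -/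

section Coordinates

variable {F : Type*} [NormedAddCommGroup F] [NormedSpace ℝ F]

/-- The Koszul expression `(v, w, u) ↦ (1/2) (∂_v g(w, u) + ∂_w g(v, u) - ∂_u g(v, w))`. -/
def koszul (g : F → F →L[ℝ] F →L[ℝ] ℝ) (y : F) : F →L[ℝ] F →L[ℝ] F →L[ℝ] ℝ :=
  let D : F →L[ℝ] F →L[ℝ] F →L[ℝ] ℝ := fderiv ℝ g y
  let D₁ : F →L[ℝ] F →L[ℝ] F →L[ℝ] ℝ := D.flip
  let D₂ : F →L[ℝ] F →L[ℝ] F →L[ℝ] ℝ := ContinuousLinearMap.comp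
    ((ContinuousLinearMap.flipₗᵢ ℝ F F ℝ).toContinuousLinearEquiv :
      (F →L[ℝ] F →L[ℝ] ℝ) →L[ℝ] (F →L[ℝ] F →L[ℝ] ℝ)) D₁
  (1 / 2 : ℝ) • (D + D₁ - D₂)

theorem koszul_apply (g : F → F →L[ℝ] F →L[ℝ] ℝ) (y v w u : F) :
    koszul g y v w u =
      (1 / 2) * (fderiv ℝ g y v w u + fderiv ℝ g y w v u - fderiv ℝ g y u v w) := rfl

/-- The coefficients of the Levi-Civita connection of the metric `g`: the vector
`leviCivita g y v w` is the one that represents `koszul g y v w` with respect to `g y`. -/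
def leviCivita (g : F → F →L[ℝ] F →L[ℝ] ℝ) (y : F) : F →L[ℝ] F →L[ℝ] F :=
  (ContinuousLinearMap.compL ℝ F (F →L[ℝ] ℝ) F (g y).inverse).comp (koszul g y)

theorem metric_leviCivita [FiniteDimensional ℝ F] (g : F → F →L[ℝ] F →L[ℝ] ℝ) (y : F)
    (hg : ∀ v, (∀ w, g y v w = 0) → v = 0) (v w u : F) :
    g y (leviCivita g y v w) u = koszul g y v w u := by
  have hinj : Function.Injective (g y) := by
    rw [injective_iff_map_eq_zero]
    exact fun v hv => hg v fun w => by rw [hv]; rfl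
  have hdim : Module.finrank ℝ F = Module.finrank ℝ (F →L[ℝ] ℝ) := by
    rw [← (LinearMap.toContinuousLinearMap (𝕜 := ℝ) (E := F) (F' := ℝ)).finrank_eq]
    exact Subspace.dual_finrank_eq.symm
  let e : F ≃L[ℝ] (F →L[ℝ] ℝ) :=
    (LinearEquiv.ofInjectiveOfFinrankEq (g y : F →ₗ[ℝ] (F →L[ℝ] ℝ)) hinj
      hdim).toContinuousLinearEquiv
  have he : (e : F →L[ℝ] (F →L[ℝ] ℝ)) = g y := by
    ext v w
    rfl
  have hl : leviCivita g y v w = (g y).inverse (koszul g y v w) := rfl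
  rw [hl, ← he, ContinuousLinearMap.inverse_equiv]
  simp

/-- The curvature `R(u, v)w = ∇_u ∇_v w - ∇_v ∇_u w - ∇_[u, v] w` of the connection with
coefficients `Γ`. -/
def curvature (Γ : F → F →L[ℝ] F →L[ℝ] F) (y u v w : F) : F :=
  fderiv ℝ Γ y u v w - fderiv ℝ Γ y v u w + Γ y u (Γ y v w) - Γ y v (Γ y u w)

theorem curvature_add (Γ : F → F →L[ℝ] F →L[ℝ] F) (y u u' v w : F) :
    curvature Γ y (u+u') v w = curvature Γ y u v w + curvature Γ y u' v w := by
  have h1 : fderiv ℝ Γ y (u + u') v w = fderiv ℝ Γ y u v w + fderiv ℝ Γ y u' v w := by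
    rw [map_add]; rfl
  have h2 : Γ y (u + u') (Γ y v w) = Γ y u (Γ y v w) + Γ y u' (Γ y v w) := by
    rw [map_add]; rfl
  have h3 : fderiv ℝ Γ y v (u + u') w = fderiv ℝ Γ y v u w + fderiv ℝ Γ y v u' w := by
    rw [map_add]; rfl
  have h4 : Γ y v (Γ y (u+u') w) = Γ y v (Γ y u w) + Γ y v (Γ y u' w) := by
    rw [map_add (Γ y), add_apply, map_add]
  rw [curvature, h1, h2, h3, h4, curvature, curvature]; abel

theorem curvature_smul (Γ : F → F →L[ℝ] F →L[ℝ] F) (y : F) (c : ℝ) (u v w : F) :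
    curvature Γ y (c • u) v w = c • curvature Γ y u v w := by
  have h1 : fderiv ℝ Γ y (c • u) v w = c • fderiv ℝ Γ y u v w := by
    rw [map_smul]; rfl
  have h2 : Γ y (c • u) (Γ y v w) = c • Γ y u (Γ y v w) := by
    rw [map_smul]; rfl
  have h3 : fderiv ℝ Γ y v (c • u) w = c • fderiv ℝ Γ y v u w := by
    rw [map_smul]; rfl
  have h4 : Γ y v (Γ y (c • u) w) = c • Γ y v (Γ y u w) := by
    rw [map_smul (Γ y), smul_apply, map_smul]
  rw [curvature, h1, h2, h3, h4, curvature, smul_sub, smul_add, smul_sub]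

/-- The Ricci tensor `Ric(v, w) = trace (u ↦ R(u, v)w)`. -/
def ricci (Γ : F → F →L[ℝ] F →L[ℝ] F) (y v w : F) : ℝ :=
  LinearMap.trace ℝ F
    { toFun := fun u => curvature Γ y u v w
      map_add' := fun a b => curvature_add Γ y a b v w
      map_smul' := fun c a => curvature_smul Γ y c a v w }

/-- `(R(u, v) · Ric)(w₁, w₂) = - Ric(R(u, v)w₁, w₂) - Ric(w₁, R(u, v)w₂)`. -/
def curvatureDotRicci (Γ : F → F →L[ℝ] F →L[ℝ] F) (y u v w₁ w₂ : F) : ℝ :=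
  -ricci Γ y (curvature Γ y u v w₁) w₂ - ricci Γ y w₁ (curvature Γ y u v w₂)

/-- The covariant derivative `(∇_v φ) w` of a field of endomorphisms. -/
def covDerivEndo (Γ : F → F →L[ℝ] F →L[ℝ] F) (φ : F → F →L[ℝ] F) (y v w : F) : F :=
  fderiv ℝ φ y v w + Γ y v (φ y w) - φ y (Γ y v w)

end Coordinates

/-! ### Tensor fields read in a chart -/

section Charts

variable {F : Type*} [NormedAddCommGroup F] [NormedSpace ℝ F]
  {N : Type*} [TopologicalSpace N] [ChartedSpace F N]

/-- A field of bilinear forms read in the chart `e`. -/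
def chartForm (e : OpenPartialHomeomorph N F) (g : FormField F N) (y : F) : F →L[ℝ] F →L[ℝ] ℝ :=
  pullForm (W := F) (g (e.symm y)) (mfderiv 𝓘(ℝ, F) 𝓘(ℝ, F) e.symm y)

/-- A field of endomorphisms read in the chart `e`. -/
def chartEndo (e : OpenPartialHomeomorph N F)
    (φ : ∀ x : N, TangentSpace 𝓘(ℝ, F) x →L[ℝ] TangentSpace 𝓘(ℝ, F) x) (y : F) : F →L[ℝ] F :=
  (mfderiv 𝓘(ℝ, F) 𝓘(ℝ, F) e (e.symm y)).comp
    ((φ (e.symm y)).comp (mfderiv 𝓘(ℝ, F) 𝓘(ℝ, F) e.symm y))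

/-- A tangent vector read in the chart `e`. -/
def chartVec (e : OpenPartialHomeomorph N F) (x : N) (v : TangentSpace 𝓘(ℝ, F) x) : F :=
  mfderiv 𝓘(ℝ, F) 𝓘(ℝ, F) e x v

/-- The tangent vector at `e.symm y` whose coordinates in the chart `e` are `v`. -/
def ofChart (e : OpenPartialHomeomorph N F) (y v : F) : TangentSpace 𝓘(ℝ, F) (e.symm y) :=
  mfderiv 𝓘(ℝ, F) 𝓘(ℝ, F) e.symm y v

end Charts

/-! ### Almost contact B-metric manifolds -/

/-- An almost contact B-metric structure `(φ, ξ, η, g)` on the smooth manifold `N`. -/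
structure AlmostContactBMetric (F : Type*) [NormedAddCommGroup F] [NormedSpace ℝ F]
    (N : Type*) [TopologicalSpace N] [ChartedSpace F N] [IsManifold 𝓘(ℝ, F) ∞ N] where
  /-- the structure endomorphism -/
  φ : ∀ x : N, TangentSpace 𝓘(ℝ, F) x →L[ℝ] TangentSpace 𝓘(ℝ, F) x
  /-- the structure vector field -/
  ξ : ∀ x : N, TangentSpace 𝓘(ℝ, F) x
  /-- the structure 1-form -/
  η : ∀ x : N, TangentSpace 𝓘(ℝ, F) x →L[ℝ] ℝ
  /-- the B-metric -/
  g : FormField F N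
  smooth_φ : ContMDiff 𝓘(ℝ, F) (𝓘(ℝ, F).prod 𝓘(ℝ, F →L[ℝ] F)) ∞ (fun x =>
    TotalSpace.mk' (F →L[ℝ] F)
      (E := fun x : N => TangentSpace 𝓘(ℝ, F) x →L[ℝ] TangentSpace 𝓘(ℝ, F) x) x (φ x))
  smooth_ξ : ContMDiff 𝓘(ℝ, F) 𝓘(ℝ, F).tangent ∞
    (fun x => (⟨x, ξ x⟩ : TangentBundle 𝓘(ℝ, F) N))
  smooth_η : ContMDiff 𝓘(ℝ, F) (𝓘(ℝ, F).prod 𝓘(ℝ, F →L[ℝ] ℝ)) ∞ (fun x =>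
    TotalSpace.mk' (F →L[ℝ] ℝ)
      (E := fun x : N => TangentSpace 𝓘(ℝ, F) x →L[ℝ] ℝ) x (η x))
  smooth_g : ContMDiff 𝓘(ℝ, F) (𝓘(ℝ, F).prod 𝓘(ℝ, F →L[ℝ] F →L[ℝ] ℝ)) ∞ (fun x =>
    TotalSpace.mk' (F →L[ℝ] F →L[ℝ] ℝ)
      (E := fun x : N => TangentSpace 𝓘(ℝ, F) x →L[ℝ] TangentSpace 𝓘(ℝ, F) x →L[ℝ] ℝ) x (g x))
  g_symm : ∀ x v w, g x v w = g x w v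
  g_nondegenerate : ∀ x v, (∀ w, g x v w = 0) → v = 0
  φ_sq : ∀ x v, φ x (φ x v) = -v + η x v • ξ x
  η_ξ : ∀ x, η x (ξ x) = 1
  g_φ_φ : ∀ x v w, g x (φ x v) (φ x w) = -g x v w + η x v * η x w

namespace AlmostContactBMetric

variable {F : Type*} [NormedAddCommGroup F] [NormedSpace ℝ F]
  {N : Type*} [TopologicalSpace N] [ChartedSpace F N] [IsManifold 𝓘(ℝ, F) ∞ N]
  (A : AlmostContactBMetric F N)

/-- The associated metric `(v, w) ↦ g(v, φ w) + η(v) η(w)`. -/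
def assoc : FormField F N := fun x =>
  (ContinuousLinearMap.precomp ℝ (A.φ x)).comp (A.g x) + (A.η x).smulRight (A.η x)

theorem assoc_apply (x : N) (v w : TangentSpace 𝓘(ℝ, F) x) :
    A.assoc x v w = A.g x v (A.φ x w) + A.η x v * A.η x w := rfl

/-- The manifold belongs to the class `F₀`: the tensor `F(X, Y, Z) = g((∇_X φ)Y, Z)`, with `∇` the
Levi-Civita connection of `g`, vanishes. -/
def IsF0 : Prop :=
  ∀ e ∈ IsManifold.maximalAtlas 𝓘(ℝ, F) ∞ N, ∀ y ∈ e.target, ∀ u v w : F,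
    chartForm e A.g y
      (covDerivEndo (leviCivita (chartForm e A.g)) (chartEndo e A.φ) y u v) w = 0

/-- `span {u, v}` (vectors at the point with coordinates `y` in the chart `e`, given by their
coordinates) is a non-degenerate section, totally real and orthogonal to the structure vector
field, all with respect to `g`. -/
def IsTotallyRealSection (e : OpenPartialHomeomorph N F) (y u v : F) : Prop :=
  chartForm e A.g y u u * chartForm e A.g y v v - chartForm e A.g y u v ^ 2 ≠ 0 ∧
  (∀ a ∈ Submodule.span ℝ {u, v}, ∀ b ∈ Submodule.span ℝ {u, v},
    chartForm e A.g y (chartEndo e A.φ y a) b = 0) ∧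
  ∀ a ∈ Submodule.span ℝ {u, v}, A.g (e.symm y) (ofChart e y a) (A.ξ (e.symm y)) = 0

/-- For a metric `h`, the quotient `h(R(u, v)v, u) / (g(u, u) g(v, v) - g(u, v)²)`, where `R` is
the curvature of the Levi-Civita connection of `h`. -/
def sectionalCurvature (h : FormField F N) (e : OpenPartialHomeomorph N F) (y u v : F) : ℝ :=
  chartForm e h y (curvature (leviCivita (chartForm e h)) y u v v) u /
    (chartForm e A.g y u u * chartForm e A.g y v v - chartForm e A.g y u v ^ 2)

/-- The manifold is of pointwise constant totally real sectional curvatures `ν` (of `g`) and `ν'`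
(of the associated metric), for non-degenerate totally real sections orthogonal to the structure
vector field. -/
def HasTotallyRealCurvatures (ν ν' : N → ℝ) : Prop :=
  ∀ e ∈ IsManifold.maximalAtlas 𝓘(ℝ, F) ∞ N, ∀ y ∈ e.target, ∀ u v : F,
    A.IsTotallyRealSection e y u v →
      A.sectionalCurvature A.g e y u v = ν (e.symm y) ∧
      A.sectionalCurvature A.assoc e y u v = ν' (e.symm y)

end AlmostContactBMetric

/-! ### Half lightlike submanifolds -/

section Submanifolds

variable {E : Type*} [NormedAddCommGroup E] [NormedSpace ℝ E]
  {F : Type*} [NormedAddCommGroup F] [NormedSpace ℝ F]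
  {M : Type*} [TopologicalSpace M] [ChartedSpace E M]
  {N : Type*} [TopologicalSpace N] [ChartedSpace F N]

/-- The field of bilinear forms induced on `M` by a map `ι : M → N`. -/
def inducedForm (ι : M → N) (g : FormField F N) : FormField E M := fun p =>
  pullForm (g (ι p)) (mfderiv 𝓘(ℝ, E) 𝓘(ℝ, F) ι p)

/-- The radical of a bilinear form: the vectors orthogonal to all vectors. -/
def radical {V : Type*} [AddCommGroup V] [Module ℝ V] [TopologicalSpace V]
    (b : V →L[ℝ] V →L[ℝ] ℝ) : Submodule ℝ V where
  carrier := {v | ∀ w, b v w = 0}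
  add_mem' := fun {a c} ha hc w => by
    change b (a + c) w = 0
    rw [map_add, add_apply, ha w, hc w, add_zero]
  zero_mem' := fun w => by
    change b 0 w = 0
    rw [map_zero, zero_apply]
  smul_mem' := fun c a ha w => by
    change b (c • a) w = 0
    rw [map_smul, smul_apply, ha w, smul_zero]

/-- A half lightlike submanifold of `(N, g)`: an immersed submanifold of codimension two whose
radical distribution `Rad(TM)` has rank one, with a screen distribution `S(TM)`, a screen
transversal bundle `S(TM^⊥) = span {L}`, a section `ξ` that spans `Rad(TM)`, and the corresponding
section `Nl` of the lightlike transversal bundle `ltr(TM) = span {Nl}`. The sections are taken on all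
of `M`. For the ascreen radical screen transversal submanifolds below this is no restriction: there
`η̄` is nowhere zero on the line bundle `Rad(TM)`, so `ξ` can be normalized by `η̄(ξ) = 1`, one can
take `L = φ ξ`, and `Nl` is determined by `ξ`, `L` and `S(TM)`. -/
structure HalfLightlike (E : Type*) [NormedAddCommGroup E] [NormedSpace ℝ E]
    {F : Type*} [NormedAddCommGroup F] [NormedSpace ℝ F]
    (M : Type*) [TopologicalSpace M] [ChartedSpace E M] [IsManifold 𝓘(ℝ, E) ∞ M]
    {N : Type*} [TopologicalSpace N] [ChartedSpace F N] [IsManifold 𝓘(ℝ, F) ∞ N]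
    (g : FormField F N) where
  /-- the inclusion -/
  ι : M → N
  smooth_ι : ContMDiff 𝓘(ℝ, E) 𝓘(ℝ, F) ∞ ι
  immersion : ∀ p, Function.Injective (mfderiv 𝓘(ℝ, E) 𝓘(ℝ, F) ι p)
  codim : Module.finrank ℝ F = Module.finrank ℝ E + 2
  /-- the section of the radical distribution -/
  ξ : ∀ p : M, TangentSpace 𝓘(ℝ, E) p
  smooth_ξ : ContMDiff 𝓘(ℝ, E) 𝓘(ℝ, E).tangent ∞
    (fun p => (⟨p, ξ p⟩ : TangentBundle 𝓘(ℝ, E) M))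
  ξ_ne : ∀ p, ξ p ≠ 0
  radical_eq : ∀ p, radical (inducedForm ι g p) = Submodule.span ℝ {ξ p}
  /-- the screen distribution -/
  S : ∀ p : M, Submodule ℝ (TangentSpace 𝓘(ℝ, E) p)
  isCompl_S : ∀ p, IsCompl (radical (inducedForm ι g p)) (S p)
  /-- the section of the screen transversal bundle -/
  L : ∀ p : M, TangentSpace 𝓘(ℝ, F) (ι p)
  smooth_L : ContMDiff 𝓘(ℝ, E) 𝓘(ℝ, F).tangent ∞
    (fun p => (⟨ι p, L p⟩ : TangentBundle 𝓘(ℝ, F) N))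
  L_normal : ∀ p v, g (ι p) (L p) (mfderiv 𝓘(ℝ, E) 𝓘(ℝ, F) ι p v) = 0
  L_unit : ∀ p, g (ι p) (L p) (L p) = 1 ∨ g (ι p) (L p) (L p) = -1
  /-- the section of the lightlike transversal bundle -/
  Nl : ∀ p : M, TangentSpace 𝓘(ℝ, F) (ι p)
  smooth_Nl : ContMDiff 𝓘(ℝ, E) 𝓘(ℝ, F).tangent ∞
    (fun p => (⟨ι p, Nl p⟩ : TangentBundle 𝓘(ℝ, F) N))
  Nl_ξ : ∀ p, g (ι p) (Nl p) (mfderiv 𝓘(ℝ, E) 𝓘(ℝ, F) ι p (ξ p)) = 1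
  Nl_Nl : ∀ p, g (ι p) (Nl p) (Nl p) = 0
  Nl_L : ∀ p, g (ι p) (Nl p) (L p) = 0
  Nl_S : ∀ p, ∀ v ∈ S p, g (ι p) (Nl p) (mfderiv 𝓘(ℝ, E) 𝓘(ℝ, F) ι p v) = 0

namespace HalfLightlike

variable [IsManifold 𝓘(ℝ, E) ∞ M] [IsManifold 𝓘(ℝ, F) ∞ N] {g : FormField F N}
  (H : HalfLightlike E M g)

/-- The inclusion read in a chart `e` of `M` and a chart `d` of `N`. -/
def chartMap (e : OpenPartialHomeomorph M E) (d : OpenPartialHomeomorph N F) (y : E) : F :=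
  d (H.ι (e.symm y))

/-- The points of the chart domain of `e` (in coordinates) that are mapped into the domain of
`d`. -/
def chartDomain (e : OpenPartialHomeomorph M E) (d : OpenPartialHomeomorph N F) : Set E :=
  {y | y ∈ e.target ∧ H.ι (e.symm y) ∈ d.source}

/-- The ambient covariant derivative `∇̄_v w` along `M` of the coordinate vector field `w` of `M` in
the direction `v`, in coordinates. -/
def ambientDeriv (e : OpenPartialHomeomorph M E) (d : OpenPartialHomeomorph N F) (y : E) :
    E →L[ℝ] E →L[ℝ] F :=
  fderiv ℝ (fderiv ℝ (H.chartMap e d)) y +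
    (leviCivita (chartForm d g) (H.chartMap e d y)).bilinearComp
      (fderiv ℝ (H.chartMap e d) y) (fderiv ℝ (H.chartMap e d) y)

/-- The map `(v, a, b) ↦ v + a Nl + b L` that realizes the decomposition
`TN = TM ⊕ ltr(TM) ⊕ S(TM^⊥)` along `M`, in coordinates. -/
def gaussFrame (e : OpenPartialHomeomorph M E) (d : OpenPartialHomeomorph N F) (y : E) :
    (E × ℝ × ℝ) →L[ℝ] F :=
  (fderiv ℝ (H.chartMap e d) y).coprod
    ((ContinuousLinearMap.toSpanSingleton ℝ
      (chartVec d (H.ι (e.symm y)) (H.Nl (e.symm y)))).coprod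
    (ContinuousLinearMap.toSpanSingleton ℝ
      (chartVec d (H.ι (e.symm y)) (H.L (e.symm y)))))

/-- The coefficients of the induced connection `∇` on `M`: the tangential component in the Gauss
formula `∇̄_v w = ∇_v w + B(v, w) Nl + D(v, w) L`. -/
def inducedConnection (e : OpenPartialHomeomorph M E) (d : OpenPartialHomeomorph N F) (y : E) :
    E →L[ℝ] E →L[ℝ] E :=
  (ContinuousLinearMap.compL ℝ E F E
    ((ContinuousLinearMap.fst ℝ E (ℝ × ℝ)).comp (H.gaussFrame e d y).inverse)).comp
    (H.ambientDeriv e d y)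

/-- The 1-form `η(v) = g(v, Nl)` on `M`, in coordinates. -/
def etaM (e : OpenPartialHomeomorph M E) (y v : E) : ℝ :=
  g (H.ι (e.symm y)) (H.Nl (e.symm y))
    (mfderiv 𝓘(ℝ, E) 𝓘(ℝ, F) H.ι (e.symm y) (ofChart e y v))

/-- The projection `P v = v - η(v) ξ` of `TM` on `S(TM)` along `Rad(TM)`, in coordinates. -/
def screenProj (e : OpenPartialHomeomorph M E) (y v : E) : E :=
  v - H.etaM e y v • chartVec e (e.symm y) (H.ξ (e.symm y))

/-- The local second fundamental form `C` of the screen distribution: `C(v, P w)` is the coefficient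
of `ξ` in the decomposition `∇_v (P w) = ∇*_v (P w) + C(v, P w) ξ` along `TM = S(TM) ⊕ Rad(TM)`,
that is `C(v, P w) = η(∇_v (P w))`. -/
def screenForm (e : OpenPartialHomeomorph M E) (d : OpenPartialHomeomorph N F) (y v w : E) : ℝ :=
  H.etaM e y (fderiv ℝ (fun z => H.screenProj e z w) y v +
    H.inducedConnection e d y v (H.screenProj e y w))

/-- The screen distribution is totally umbilical, with the smooth function `γ`:
`C(v, P w) = γ g(v, w)` for all tangent vectors `v`, `w`. -/
def IsScreenTotallyUmbilical (γ : M → ℝ) : Prop :=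
  ContMDiff 𝓘(ℝ, E) 𝓘(ℝ, ℝ) ∞ γ ∧
  ∀ e ∈ IsManifold.maximalAtlas 𝓘(ℝ, E) ∞ M, ∀ d ∈ IsManifold.maximalAtlas 𝓘(ℝ, F) ∞ N,
    ∀ y ∈ H.chartDomain e d, ∀ v w : E,
      H.screenForm e d y v w = γ (e.symm y) * chartForm e (inducedForm H.ι g) y v w

/-- `(M, g)` is Ricci semi-symmetric, with respect to the induced connection. -/
def IsRicciSemiSymmetric : Prop :=
  ∀ e ∈ IsManifold.maximalAtlas 𝓘(ℝ, E) ∞ M, ∀ d ∈ IsManifold.maximalAtlas 𝓘(ℝ, F) ∞ N,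
    ∀ y ∈ H.chartDomain e d, ∀ u v w₁ w₂ : E,
      curvatureDotRicci (H.inducedConnection e d) y u v w₁ w₂ = 0

end HalfLightlike

/-- The semi-Riemannian manifold `(M, h)` is Ricci semi-symmetric, with respect to the
Levi-Civita connection of `h`. -/
def IsRicciSemiSymmetric [IsManifold 𝓘(ℝ, E) ∞ M] (h : FormField E M) : Prop :=
  ∀ e ∈ IsManifold.maximalAtlas 𝓘(ℝ, E) ∞ M, ∀ y ∈ e.target, ∀ u v w₁ w₂ : E,
    curvatureDotRicci (leviCivita (chartForm e h)) y u v w₁ w₂ = 0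

/-- The semi-Riemannian manifold `(M, h)` is Einstein: `Ric = k h` with a constant `k`. -/
def IsEinstein [IsManifold 𝓘(ℝ, E) ∞ M] (h : FormField E M) : Prop :=
  ∃ k : ℝ, ∀ e ∈ IsManifold.maximalAtlas 𝓘(ℝ, E) ∞ M, ∀ y ∈ e.target, ∀ v w : E,
    ricci (leviCivita (chartForm e h)) y v w = k * chartForm e h y v w

end Submanifolds

/-! ### Ascreen radical screen transversal half lightlike submanifolds -/

namespace HalfLightlike

variable {E : Type*} [NormedAddCommGroup E] [NormedSpace ℝ E]
  {F : Type*} [NormedAddCommGroup F] [NormedSpace ℝ F]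
  {M : Type*} [TopologicalSpace M] [ChartedSpace E M] [IsManifold 𝓘(ℝ, E) ∞ M]
  {N : Type*} [TopologicalSpace N] [ChartedSpace F N] [IsManifold 𝓘(ℝ, F) ∞ N]
  {A : AlmostContactBMetric F N} (H : HalfLightlike E M A.g)

/-- Radical screen transversal: `φ(Rad(TM)) = S(TM^⊥)`. -/
def IsRSTHL : Prop :=
  ∀ p, Submodule.map (A.φ (H.ι p) : TangentSpace 𝓘(ℝ, F) (H.ι p) →ₗ[ℝ] _)
    (Submodule.map (mfderiv 𝓘(ℝ, E) 𝓘(ℝ, F) H.ι p : TangentSpace 𝓘(ℝ, E) p →ₗ[ℝ] _)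
      (radical (inducedForm H.ι A.g p))) = Submodule.span ℝ {H.L p}

/-- Ascreen: the structure vector field belongs to `Rad(TM) ⊕ ltr(TM)` along `M`. -/
def IsAscreen : Prop :=
  ∀ p, A.ξ (H.ι p) ∈
    Submodule.map (mfderiv 𝓘(ℝ, E) 𝓘(ℝ, F) H.ι p : TangentSpace 𝓘(ℝ, E) p →ₗ[ℝ] _)
      (radical (inducedForm H.ι A.g p)) ⊔ Submodule.span ℝ {H.Nl p}

/-- The function `μ`, the value of the structure 1-form on `ξ`. -/
def μ (p : M) : ℝ := A.η (H.ι p) (mfderiv 𝓘(ℝ, E) 𝓘(ℝ, F) H.ι p (H.ξ p))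

/-- The structure 1-form of `N` restricted to `M`, in the chart `e` of `M`. -/
def etaBar (e : OpenPartialHomeomorph M E) (y v : E) : ℝ :=
  A.η (H.ι (e.symm y)) (mfderiv 𝓘(ℝ, E) 𝓘(ℝ, F) H.ι (e.symm y) (ofChart e y v))

/-- `(M, g)` is `η̄`-Einstein: the Ricci tensor of the induced connection is
`Ric = k g + c η̄ ⊗ η̄` with constants `k` and `c`. -/
def IsEtaEinstein : Prop :=
  ∃ k c : ℝ,
    ∀ e ∈ IsManifold.maximalAtlas 𝓘(ℝ, E) ∞ M, ∀ d ∈ IsManifold.maximalAtlas 𝓘(ℝ, F) ∞ N,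
    ∀ y ∈ H.chartDomain e d, ∀ v w : E,
      ricci (H.inducedConnection e d) y v w =
        k * chartForm e (inducedForm H.ι A.g) y v w + c * (H.etaBar e y v * H.etaBar e y w)

end HalfLightlike

end BMetricGeometry

end

/-! The hypotheses are rigid enough to compute both curvature tensors of `M` explicitly; the five
conditions are then read off from the formulas.

Ambient curvature. As the structure endomorphism is parallel, so is the structure field, and the
associated metric has the same Levi-Civita connection (`leviCivita_assoc`). Hence the curvature has
Kähler-type symmetries, and the second sectional curvature has numerator `g(R(x,y)y, φx)`. A tensor
with these symmetries is determined by its values on a real form of `ker η̄`. A real form on which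
`g` is Euclidean exists (`exists_realForm`), and there every plane is admissible, so the curvature
is a model tensor in `ν`, `ν'` (`IsKaehlerLike.eq_modelCurvature`).

Geometry along `M`. Normalise the radical section to `x₀ = ξ/μ`, let `θ` be the restriction of `η̄`
and `n = x₀ - ξ̄`. Then `g(n,n) = -1`, `n` is orthogonal to `ξ̄` and to the screen `ker θ`, `Nl =
(ξ̄ - n)/(2μ)`, and `L` is a multiple of `φn`. The endomorphism `φ` induces a complex structure `J`
on the screen. With `c = 2μγ`, umbilicity becomes `∇̄_v n = c (v - θ(v) x₀)` (`covAlong_n`).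
Computing `R̄(u,v)n` from this and comparing with the model gives `ν' = 0` along `M` and `dc = (ν -
c²) θ` (`fderiv_umbilic`).

Curvature of `M`. The Gauss equation gives the curvature of the induced connection and of the
Levi-Civita connection of `g̃` (`curvature_induced`, `curvature_assoc`). With `m = 2n - 2` the rank
of the screen, the Ricci tensors are `Ric = ((m - 3/2) ν + (3 - m) c²/2) g - m ν θ⊗θ` and `Ric~ = -m
ν g̃ + (ν - c²) ((m - 2) g + (m - 1) g(J·,·))`.

Conclusion. If `ν = c²`, then `dc = 0`, so `c` and `ν` are constant on the connected `M`. Both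
curvatures take the form `h(v,w)u - h(u,w)v` with `Ric = m h`, where `h` is `ν (g/2 - θ⊗θ)` or `-ν
g̃`; this gives all four other conditions. Conversely, either semi-symmetry condition evaluated on
`x₀` and the screen forces `ν (ν - c²) = 0`, using that `m` is even (so `m ≠ 3`) in the first case
and that `(m - 2)² + (m - 1)² > 0` in the second. The Einstein condition for `g̃` is refuted in the
same way when `ν ≠ c²`. The `η̄`-Einstein condition makes `ν` and `c²` constant, and then `dc = (ν -
c²) θ` gives `ν = c²`. -/

namespace BMetricGeometry

/-! ### Covariant derivatives along a map and their commutator. -/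

section CovariantDerivative

variable {E F : Type*} [NormedAddCommGroup E] [NormedSpace ℝ E]
  [NormedAddCommGroup F] [NormedSpace ℝ F]

/-- The covariant derivative in the direction `v` of a vector field `W` along a map `f`, for the
connection with coefficients `Γ`. -/
noncomputable def covAlong (Γ : F → F →L[ℝ] F →L[ℝ] F) (f W : E → F) (z v : E) : F :=
  fderiv ℝ W z v + Γ (f z) (fderiv ℝ f z v) (W z)

variable {Γ : F → F →L[ℝ] F →L[ℝ] F} {f W W' : E → F} {y : E}

theorem _root_.ContDiffAt.differentiableAt_infty {f : E → F} {y : E} (h : ContDiffAt ℝ ∞ f y) :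
    DifferentiableAt ℝ f y := h.differentiableAt (by simp)

theorem _root_.ContDiffAt.fderiv_infty {f : E → F} {y : E} (h : ContDiffAt ℝ ∞ f y) :
    ContDiffAt ℝ ∞ (fderiv ℝ f) y := h.fderiv_right (by simp)

theorem fderiv_fderiv_comm (h : ContDiffAt ℝ ∞ f y) (u v : E) :
    fderiv ℝ (fderiv ℝ f) y u v = fderiv ℝ (fderiv ℝ f) y v u :=
  (h.isSymmSndFDerivAt (by
    rw [minSmoothness_of_isRCLikeNormedField]; exact WithTop.coe_le_coe.2 le_top)).eq u v

theorem contDiffAt_covAlong (hΓ : ContDiffAt ℝ ∞ Γ (f y)) (hf : ContDiffAt ℝ ∞ f y)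
    (hW : ContDiffAt ℝ ∞ W y) (v : E) : ContDiffAt ℝ ∞ (fun z => covAlong Γ f W z v) y := by
  unfold covAlong
  exact (hW.fderiv_infty.clm_apply contDiffAt_const).add
    (((hΓ.comp y hf).clm_apply (hf.fderiv_infty.clm_apply contDiffAt_const)).clm_apply hW)

theorem covAlong_congr (h : W =ᶠ[𝓝 y] W') (v : E) : covAlong Γ f W y v = covAlong Γ f W' y v := by
  rw [covAlong, covAlong, h.fderiv_eq, h.eq_of_nhds]

theorem covAlong_add (hW : DifferentiableAt ℝ W y) (hW' : DifferentiableAt ℝ W' y) (v : E) :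
    covAlong Γ f (fun z => W z + W' z) y v = covAlong Γ f W y v + covAlong Γ f W' y v := by
  simp only [covAlong, fderiv_fun_add hW hW', add_apply, map_add]
  abel

theorem covAlong_sub (hW : DifferentiableAt ℝ W y) (hW' : DifferentiableAt ℝ W' y) (v : E) :
    covAlong Γ f (fun z => W z - W' z) y v = covAlong Γ f W y v - covAlong Γ f W' y v := by
  simp only [covAlong, fderiv_fun_sub hW hW', sub_apply, map_sub]
  abel

theorem covAlong_smul {a : E → ℝ} (ha : DifferentiableAt ℝ a y) (hW : DifferentiableAt ℝ W y)
    (v : E) : covAlong Γ f (fun z => a z • W z) y v =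
      fderiv ℝ a y v • W y + a y • covAlong Γ f W y v := by
  simp only [covAlong, fderiv_fun_smul ha hW, add_apply, smul_apply,
    ContinuousLinearMap.smulRight_apply, map_smul, smul_add]
  abel

/-- The covariant derivative of a vector field of the form `df(X)`. -/
theorem covAlong_fderiv_apply (hf : ContDiffAt ℝ ∞ f y) {X : E → E}
    (hX : DifferentiableAt ℝ X y) (v : E) :
    covAlong Γ f (fun z => fderiv ℝ f z (X z)) y v =
      fderiv ℝ f y (fderiv ℝ X y v) + covAlong Γ f (fun z => fderiv ℝ f z (X y)) y v := by
  have h2 := hf.fderiv_infty.differentiableAt_infty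
  have e1 : fderiv ℝ (fun z => fderiv ℝ f z (X z)) y v =
      fderiv ℝ (fderiv ℝ f) y v (X y) + fderiv ℝ f y (fderiv ℝ X y v) := by
    rw [(h2.hasFDerivAt.clm_apply hX.hasFDerivAt).fderiv]
    simp [add_comm]
  have e2 : fderiv ℝ (fun z => fderiv ℝ f z (X y)) y v = fderiv ℝ (fderiv ℝ f) y v (X y) := by
    rw [(h2.hasFDerivAt.clm_apply (hasFDerivAt_const (X y) y)).fderiv]
    simp
  rw [covAlong, covAlong, e1, e2]
  abel

theorem covAlong_fderiv_const (hf : ContDiffAt ℝ ∞ f y) (v w : E) :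
    covAlong Γ f (fun z => fderiv ℝ f z w) y v =
      fderiv ℝ (fderiv ℝ f) y v w + Γ (f y) (fderiv ℝ f y v) (fderiv ℝ f y w) := by
  have h2 := hf.fderiv_infty.differentiableAt_infty
  have e2 : fderiv ℝ (fun z => fderiv ℝ f z w) y v = fderiv ℝ (fderiv ℝ f) y v w := by
    rw [(h2.hasFDerivAt.clm_apply (hasFDerivAt_const w y)).fderiv]
    simp
  rw [covAlong, e2]

theorem covAlong_fderiv_comm (hf : ContDiffAt ℝ ∞ f y)
    (hΓ : ∀ v w, Γ (f y) v w = Γ (f y) w v) (v w : E) :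
    covAlong Γ f (fun z => fderiv ℝ f z w) y v = covAlong Γ f (fun z => fderiv ℝ f z v) y w := by
  rw [covAlong_fderiv_const hf, covAlong_fderiv_const hf, fderiv_fderiv_comm hf, hΓ]

theorem fderiv_covAlong (hΓ : ContDiffAt ℝ ∞ Γ (f y)) (hf : ContDiffAt ℝ ∞ f y)
    (hW : ContDiffAt ℝ ∞ W y) (u v : E) :
    fderiv ℝ (fun z => covAlong Γ f W z v) y u =
      fderiv ℝ (fderiv ℝ W) y u v + (fderiv ℝ Γ (f y) (fderiv ℝ f y u) (fderiv ℝ f y v) (W y)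
        + Γ (f y) (fderiv ℝ (fderiv ℝ f) y u v) (W y)
        + Γ (f y) (fderiv ℝ f y v) (fderiv ℝ W y u)) := by
  have h1 : HasFDerivAt (fun z => fderiv ℝ W z v) _ y :=
    hW.fderiv_infty.differentiableAt_infty.hasFDerivAt.clm_apply (hasFDerivAt_const v y)
  have h2 : HasFDerivAt (fun z => fderiv ℝ f z v) _ y :=
    hf.fderiv_infty.differentiableAt_infty.hasFDerivAt.clm_apply (hasFDerivAt_const v y)
  have h3 : HasFDerivAt (fun z => Γ (f z)) _ y :=
    hΓ.differentiableAt_infty.hasFDerivAt.comp y hf.differentiableAt_infty.hasFDerivAt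
  have h4 := h1.add ((h3.clm_apply h2).clm_apply hW.differentiableAt_infty.hasFDerivAt)
  have h5 : (fun z => covAlong Γ f W z v) =
    (fun z => fderiv ℝ W z v) + fun z => Γ (f z) (fderiv ℝ f z v) (W z) := rfl
  rw [h5, h4.fderiv]
  simp
  abel

/-- The commutator of covariant derivatives along a map is the curvature. -/
theorem covAlong_commutator (hΓ : ContDiffAt ℝ ∞ Γ (f y)) (hf : ContDiffAt ℝ ∞ f y)
    (hW : ContDiffAt ℝ ∞ W y) (u v : E) :
    covAlong Γ f (fun z => covAlong Γ f W z v) y u - covAlong Γ f (fun z => covAlong Γ f W z u) y v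
      = curvature Γ (f y) (fderiv ℝ f y u) (fderiv ℝ f y v) (W y) := by
  rw [covAlong, fderiv_covAlong hΓ hf hW, covAlong.eq_def Γ f (fun z => covAlong Γ f W z u),
    fderiv_covAlong hΓ hf hW,
    fderiv_fderiv_comm hW u v, fderiv_fderiv_comm hf u v, covAlong, covAlong, curvature]
  simp only [map_add]
  abel

/-- A metric connection satisfies the product rule along a map. -/
theorem fderiv_metric_apply {G : F → F →L[ℝ] F →L[ℝ] ℝ} (hG : DifferentiableAt ℝ G (f y))
    (hf : DifferentiableAt ℝ f y)
    (hm : ∀ u v w, fderiv ℝ G (f y) u v w = G (f y) (Γ (f y) u v) w + G (f y) v (Γ (f y) u w))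
    (hW : DifferentiableAt ℝ W y) (hW' : DifferentiableAt ℝ W' y) (v : E) :
    fderiv ℝ (fun z => G (f z) (W z) (W' z)) y v =
      G (f y) (covAlong Γ f W y v) (W' y) + G (f y) (W y) (covAlong Γ f W' y v) := by
  have h3 : HasFDerivAt (fun z => G (f z)) _ y := hG.hasFDerivAt.comp y hf.hasFDerivAt
  rw [((h3.clm_apply hW.hasFDerivAt).clm_apply hW'.hasFDerivAt).fderiv]
  simp [covAlong, hm]
  ring

/-- A parallel endomorphism commutes with covariant derivatives along a map. -/
theorem covAlong_endo_apply {Φ : F → F →L[ℝ] F} (hΦ : DifferentiableAt ℝ Φ (f y))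
    (hf : DifferentiableAt ℝ f y) (hm : ∀ u w, covDerivEndo Γ Φ (f y) u w = 0)
    (hW : DifferentiableAt ℝ W y) (v : E) :
    covAlong Γ f (fun z => Φ (f z) (W z)) y v = Φ (f y) (covAlong Γ f W y v) := by
  have h3 : HasFDerivAt (fun z => Φ (f z)) _ y := hΦ.hasFDerivAt.comp y hf.hasFDerivAt
  have h4 := hm (fderiv ℝ f y v) (W y)
  rw [covDerivEndo] at h4
  rw [covAlong, (h3.clm_apply hW.hasFDerivAt).fderiv]
  simp only [covAlong, map_add, ContinuousLinearMap.comp_apply, add_apply,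
    ContinuousLinearMap.flip_apply]
  rw [← sub_eq_zero, ← h4]
  abel

theorem curvature_swap (y' u v w : F) : curvature Γ y' u v w = -curvature Γ y' v u w := by
  simp only [curvature]; abel

/-- The first Bianchi identity needs only vanishing torsion. Symmetry is required on an open set so
that it passes to the derivative of the coefficients. -/
theorem curvature_bianchi {V : Set F} (hV : IsOpen V) (hΓ : ∀ z ∈ V, ∀ v w, Γ z v w = Γ z w v)
    {x : F} (hx : x ∈ V) (hd : DifferentiableAt ℝ Γ x) (u v w : F) :
    curvature Γ x u v w + curvature Γ x v w u + curvature Γ x w u v = 0 := by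
  have key : ∀ a b c, fderiv ℝ Γ x a b c = fderiv ℝ Γ x a c b := by
    intro a b c
    have e : ∀ b c, fderiv ℝ (fun z => Γ z b c) x a = fderiv ℝ Γ x a b c := by
      intro b c
      rw [((hd.hasFDerivAt.clm_apply (hasFDerivAt_const b x)).clm_apply
        (hasFDerivAt_const c x)).fderiv]
      simp
    rw [← e, ← e]
    have : (fun z => Γ z b c) =ᶠ[𝓝 x] fun z => Γ z c b := by
      filter_upwards [hV.mem_nhds hx] with z hz using hΓ z hz b c
    rw [this.fderiv_eq]
  have s := hΓ x hx
  simp only [curvature]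
  rw [key u v w, key v w u, key w u v, s v w, s w u, s u v]
  abel

end CovariantDerivative

/-! ### Characterisation and smoothness of the Levi-Civita coefficients. -/

section LeviCivita

variable {F : Type*} [NormedAddCommGroup F] [NormedSpace ℝ F]
  {G : F → F →L[ℝ] F →L[ℝ] ℝ} {V : Set F}

theorem fderiv_form_symm (hV : IsOpen V) (hs : ∀ z ∈ V, ∀ v w, G z v w = G z w v)
    {x : F} (hx : x ∈ V) (hd : DifferentiableAt ℝ G x) (u v w : F) :
    fderiv ℝ G x u v w = fderiv ℝ G x u w v := by
  have e : ∀ b c, fderiv ℝ (fun z => G z b c) x u = fderiv ℝ G x u b c := by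
    intro b c
    rw [((hd.hasFDerivAt.clm_apply (hasFDerivAt_const b x)).clm_apply
      (hasFDerivAt_const c x)).fderiv]
    simp
  rw [← e, ← e]
  have : (fun z => G z v w) =ᶠ[𝓝 x] fun z => G z w v := by
    filter_upwards [hV.mem_nhds hx] with z hz using hs z hz v w
  rw [this.fderiv_eq]

theorem eq_of_form_eq {b : F →L[ℝ] F →L[ℝ] ℝ} (hb : ∀ v, (∀ w, b v w = 0) → v = 0) {v v' : F}
    (h : ∀ w, b v w = b v' w) : v = v' := by
  rw [← sub_eq_zero]
  exact hb _ fun w => by rw [map_sub, sub_apply, h, sub_self]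

variable [FiniteDimensional ℝ F]

theorem leviCivita_symm (hV : IsOpen V) (hs : ∀ z ∈ V, ∀ v w, G z v w = G z w v)
    (hn : ∀ z ∈ V, ∀ v, (∀ w, G z v w = 0) → v = 0)
    {x : F} (hx : x ∈ V) (hd : DifferentiableAt ℝ G x) (v w : F) :
    leviCivita G x v w = leviCivita G x w v := by
  refine eq_of_form_eq (hn x hx) fun u => ?_
  rw [metric_leviCivita _ _ (hn x hx), metric_leviCivita _ _ (hn x hx), koszul_apply, koszul_apply,
    fderiv_form_symm hV hs hx hd u v w]
  ring

theorem leviCivita_metric (hV : IsOpen V) (hs : ∀ z ∈ V, ∀ v w, G z v w = G z w v)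
    (hn : ∀ z ∈ V, ∀ v, (∀ w, G z v w = 0) → v = 0)
    {x : F} (hx : x ∈ V) (hd : DifferentiableAt ℝ G x) (u v w : F) :
    fderiv ℝ G x u v w = G x (leviCivita G x u v) w + G x v (leviCivita G x u w) := by
  rw [hs x hx v, metric_leviCivita _ _ (hn x hx), metric_leviCivita _ _ (hn x hx), koszul_apply,
    koszul_apply, fderiv_form_symm hV hs hx hd u w v, fderiv_form_symm hV hs hx hd w u v,
    fderiv_form_symm hV hs hx hd v u w]
  ring

/-- A symmetric metric connection is the Levi-Civita connection. -/
theorem leviCivita_eq {x : F} (hs : ∀ v w, G x v w = G x w v)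
    (hn : ∀ v, (∀ w, G x v w = 0) → v = 0) {Γ : F →L[ℝ] F →L[ℝ] F} (hΓ : ∀ v w, Γ v w = Γ w v)
    (hm : ∀ u v w, fderiv ℝ G x u v w = G x (Γ u v) w + G x v (Γ u w)) :
    leviCivita G x = Γ := by
  ext v w
  refine eq_of_form_eq hn fun u => ?_
  rw [metric_leviCivita _ _ hn, koszul_apply, hm, hm, hm, hs w (Γ v u), hs v (Γ w u),
    hs (Γ u v) w, hs v (Γ u w), hΓ w v, hΓ u v, hΓ u w, hs w (Γ v u)]
  ring

theorem contDiffAt_leviCivita {x : F} (hn : ∀ v, (∀ w, G x v w = 0) → v = 0)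
    (hd : ContDiffAt ℝ ∞ G x) : ContDiffAt ℝ ∞ (leviCivita G) x := by
  have hinj : Function.Injective (G x) := by
    rw [injective_iff_map_eq_zero]
    exact fun v hv => hn v fun w => by rw [hv]; rfl
  have hdim' : Module.finrank ℝ F = Module.finrank ℝ (F →L[ℝ] ℝ) := by
    rw [← (LinearMap.toContinuousLinearMap (𝕜 := ℝ) (E := F) (F' := ℝ)).finrank_eq]
    exact Subspace.dual_finrank_eq.symm
  let e : F ≃L[ℝ] (F →L[ℝ] ℝ) :=
    (LinearEquiv.ofInjectiveOfFinrankEq (G x : F →ₗ[ℝ] (F →L[ℝ] ℝ)) hinj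
      hdim').toContinuousLinearEquiv
  have he : (e : F →L[ℝ] (F →L[ℝ] ℝ)) = G x := by
    ext v w
    rfl
  have hinv : ContDiffAt ℝ ∞ (fun y => (G y).inverse) x := by
    have := contDiffAt_map_inverse (𝕜 := ℝ) (n := ∞) e
    rw [he] at this
    exact this.comp x hd
  have hD := hd.fderiv_infty
  have hk : ContDiffAt ℝ ∞ (koszul G) x := by
    rw [← contDiffWithinAt_univ]
    have h1 : ContDiffAt ℝ ∞ (fun y => (ContinuousLinearMap.flipₗᵢ ℝ F F
      (F →L[ℝ] ℝ)) (fderiv ℝ G y)) x :=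
      ((ContinuousLinearMap.flipₗᵢ ℝ F F
        (F →L[ℝ] ℝ)).toContinuousLinearEquiv.contDiff.contDiffAt).comp x hD
    have h2 : ContDiffAt ℝ ∞ (fun y => ContinuousLinearMap.comp
        ((ContinuousLinearMap.flipₗᵢ ℝ F F ℝ).toContinuousLinearEquiv :
          (F →L[ℝ] F →L[ℝ] ℝ) →L[ℝ] (F →L[ℝ] F →L[ℝ] ℝ))
        ((ContinuousLinearMap.flipₗᵢ ℝ F F (F →L[ℝ] ℝ)) (fderiv ℝ G y))) x :=
      contDiffAt_const.clm_comp h1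
    exact (((hD.add h1).sub h2).const_smul (1 / 2 : ℝ)).contDiffWithinAt
  have hc : ContDiffAt ℝ ∞ (fun y => ContinuousLinearMap.compL ℝ F (F →L[ℝ] ℝ) F (G y).inverse) x :=
    (ContinuousLinearMap.compL ℝ F (F →L[ℝ] ℝ) F).contDiff.contDiffAt.comp x hinv
  exact hc.clm_comp hk

end LeviCivita

/-! ### The trace of the screen complex structure. -/

section Trace

/-- A real endomorphism with `J³ = -J` has trace zero. -/
theorem trace_eq_zero_of_cube {V : Type*} [AddCommGroup V] [Module ℝ V] [FiniteDimensional ℝ V]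
    (J : V →ₗ[ℝ] V) (hJ : ∀ v, J (J (J v)) = -J v) : LinearMap.trace ℝ V J = 0 := by
  classical
  let b := Module.finBasis ℝ V
  let A := LinearMap.toMatrix b b J
  let B : Matrix _ _ ℂ := A.map (algebraMap ℝ ℂ)
  have hA : A * A * A = -A := by
    change LinearMap.toMatrix b b J * LinearMap.toMatrix b b J * LinearMap.toMatrix b b J =
      -LinearMap.toMatrix b b J
    rw [← LinearMap.toMatrix_mul, ← LinearMap.toMatrix_mul, ← map_neg]
    congr 1
    ext v
    simpa using hJ v
  have hB : B * B * B = -B := by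
    have := congrArg (fun X : Matrix _ _ ℝ => X.map (algebraMap ℝ ℂ)) hA
    simp only [Matrix.map_mul] at this
    rw [this]
    ext i j
    simp [B]
  have htr : B.trace = ((LinearMap.trace ℝ V J : ℝ) : ℂ) := by
    rw [LinearMap.trace_eq_matrix_trace ℝ b]
    simp [B, A, Matrix.trace]
  -- The complexified eigenvalues solve `μ³ = -μ`, so they are `0` or `±i`. The trace is their sum,
  -- hence purely imaginary, and it is also real.
  have hroot : ∀ μ ∈ B.charpoly.roots, μ.re = 0 := by
    intro μ hμ
    have h1 : Module.End.HasEigenvalue (Matrix.toLin' B) μ := by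
      rw [← Matrix.charpoly_toLin'] at hμ
      exact (Module.End.hasEigenvalue_iff_isRoot_charpoly _ _).2 (Polynomial.isRoot_of_mem_roots hμ)
    obtain ⟨v, hv⟩ := h1.exists_hasEigenvector
    have e : ∀ w, (Matrix.toLin' B) (Matrix.toLin' B (Matrix.toLin' B w)) = -Matrix.toLin' B w := by
      intro w
      have := congrArg (fun X => Matrix.toLin' X w) hB
      simpa [Matrix.toLin'_mul] using this
    have h2 := e v
    rw [hv.apply_eq_smul, map_smul, hv.apply_eq_smul, map_smul, map_smul, hv.apply_eq_smul] at h2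
    have h3 : (μ * (μ * μ) + μ) • v = 0 := by
      rw [add_smul, mul_smul, mul_smul, h2, neg_add_cancel]
    have h4 : μ * (μ * μ + 1) = 0 := by
      have := (smul_eq_zero.1 h3).resolve_right hv.2
      linear_combination this
    rcases mul_eq_zero.1 h4 with h | h
    · simp [h]
    · have hre := congrArg Complex.re h
      have him := congrArg Complex.im h
      simp at hre him
      by_contra hne
      have : μ.im = 0 := by
        have : μ.re * μ.im = 0 := by linarith
        exact (mul_eq_zero.1 this).resolve_left hne
      rw [this] at hre
      nlinarith [mul_self_nonneg μ.re]
  have h5 : B.trace.re = 0 := by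
    rw [Matrix.trace_eq_sum_roots_charpoly]
    have : ∀ s : Multiset ℂ, (∀ μ ∈ s, μ.re = 0) → s.sum.re = 0 := by
      intro s
      induction s using Multiset.induction with
      | empty => simp
      | cons a s ih =>
        intro h
        rw [Multiset.sum_cons, Complex.add_re, h a (Multiset.mem_cons_self a s),
          ih fun μ hμ => h μ (Multiset.mem_cons_of_mem hμ), add_zero]
    exact this _ hroot
  rw [htr, Complex.ofReal_re] at h5
  exact h5

end Trace

/-! ### Real forms adapted to an anti-invariant metric. -/

section RealForm

variable {V : Type*} [AddCommGroup V] [Module ℝ V]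

/-- A complex structure with an anti-invariant nondegenerate symmetric form has a real form on
which the form is Euclidean. -/
theorem exists_realForm [FiniteDimensional ℝ V] (g : LinearMap.BilinForm ℝ V)
    (hs : ∀ v w, g v w = g w v) (hn : ∀ v, (∀ w, g v w = 0) → v = 0)
    (J : V →ₗ[ℝ] V) (hJ : ∀ v, J (J v) = -v) (hg : ∀ v w, g (J v) w = g v (J w)) :
    ∃ (k : ℕ) (ρ : (Fin k → ℝ) →ₗ[ℝ] V), (∀ r, g (ρ r) (ρ r) = ∑ i, r i * r i) ∧
      (∀ r, g (ρ r) (J (ρ r)) = 0) ∧ ∀ v, ∃ r s, v = ρ r + J (ρ s) := by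
  let lift : ℂ →ₐ[ℝ] Module.End ℝ V := Complex.liftAux J (by ext v; simpa using hJ v)
  let _ : Module ℂ V := Module.compHom V lift.toRingHom
  have hsm : ∀ (z : ℂ) (v : V), z • v = z.re • v + z.im • J v := by
    intro z v
    change lift z v = _
    simp [lift, Complex.liftAux_apply, Module.algebraMap_end_apply]
  have : IsScalarTower ℝ ℂ V := ⟨fun a z v => by
    rw [hsm, hsm]
    simp [mul_smul]⟩
  have : FiniteDimensional ℂ V := FiniteDimensional.right ℝ ℂ V
  -- With `i` acting as `J`, the form `g(v,w) - i g(v,Jw)` is complex bilinear, because `J` is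
  -- `g`-selfadjoint, and it is symmetric and nondegenerate.
  let B : LinearMap.BilinForm ℂ V := LinearMap.mk₂ ℂ
    (fun v w => (⟨g v w, -g v (J w)⟩ : ℂ))
    (fun a b c => by apply Complex.ext <;> simp; ring)
    (fun z a b => by
      apply Complex.ext <;> simp [hsm, hg, hJ] <;> ring)
    (fun a b c => by apply Complex.ext <;> simp; ring)
    (fun z a b => by
      apply Complex.ext <;> simp [hsm, hJ] <;> ring)
  have hB : ∀ v w, B v w = ⟨g v w, -g v (J w)⟩ := fun v w => rfl
  have hBs : ∀ v w, B v w = B w v := fun v w => by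
    rw [hB, hB, hs v w, hs v (J w), hg]
  let Q : QuadraticForm ℂ V := LinearMap.BilinMap.toQuadraticMap B
  have hQ : QuadraticMap.associated (R := ℂ) Q = B := QuadraticMap.associated_left_inverse ℂ hBs
  -- Over `ℂ` the form is a sum of squares. The real span of an orthonormal basis is the required
  -- real form: there `B` takes real values, so its imaginary part `-g(v,Jv)` vanishes.
  obtain ⟨e⟩ := QuadraticForm.equivalent_weightedSumSquares_of_isAlgClosed Q (by
    rw [hQ]
    intro v hv
    refine hn v fun w => ?_
    have := congrArg Complex.re (hv w)
    simpa [hB] using this)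
  have hQe : ∀ x, B (e.symm x) (e.symm x) = ∑ i, x i * x i := by
    intro x
    have h1 := e.symm.map_app x
    have h2 : Q (e.symm x) = B (e.symm x) (e.symm x) := rfl
    rw [← h2, h1]
    simp
  let em := e.symm.toLinearEquiv
  let ρ : (Fin (Module.finrank ℂ V) → ℝ) →ₗ[ℝ] V :=
    { toFun := fun r => em fun i => (r i : ℂ)
      map_add' := fun r s => by
        rw [← map_add]; congr 1; ext i; simp
      map_smul' := fun a r => by
        have : (fun i => (((a • r) i : ℝ) : ℂ)) = (a : ℂ) • fun i => (r i : ℂ) := by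
          ext i; simp
        rw [this, map_smul, hsm]
        simp }
  have hρ : ∀ r, B (ρ r) (ρ r) = ∑ i, (r i : ℂ) * r i := fun r => hQe _
  refine ⟨_, ρ, fun r => ?_, fun r => ?_, fun v => ?_⟩
  · have := congrArg Complex.re (hρ r)
    rw [hB] at this
    simpa using this
  · have := congrArg Complex.im (hρ r)
    rw [hB] at this
    simpa using this
  · refine ⟨fun i => (em.symm v i).re, fun i => (em.symm v i).im, ?_⟩
    have h1 : ∀ w, J w = Complex.I • w := fun w => by simp [hsm]
    rw [h1]
    change v = em _ + Complex.I • em _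
    rw [← map_smul, ← map_add, ← LinearEquiv.symm_apply_eq]
    ext i
    simp [mul_comm Complex.I, Complex.re_add_im]

end RealForm

/-! ### Algebraic curvature tensors of Kähler type. -/

section KaehlerLike

variable {V : Type*} [AddCommGroup V] [Module ℝ V]

/-- The algebraic identities of the curvature tensor of an almost contact B-metric manifold with
parallel structure tensors. -/
structure IsKaehlerLike (φ : V → V) (ξ : V) (T : V → V → V → V → ℝ) : Prop where
  add_left : ∀ x x' y z w, T (x + x') y z w = T x y z w + T x' y z w
  add_mid : ∀ x y z z' w, T x y (z + z') w = T x y z w + T x y z' w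
  swap_left : ∀ x y z w, T x y z w = -T y x z w
  swap_right : ∀ x y z w, T x y z w = -T x y w z
  bianchi : ∀ x y z w, T x y z w + T y z x w + T z x y w = 0
  map_φ : ∀ x y z w, T x y (φ z) w = T x y z (φ w)
  -- The scalar belongs to the axiom because the tensor is assumed additive only, not homogeneous.
  map_ξ : ∀ x y w (a : ℝ), T x y (a • ξ) w = 0

namespace IsKaehlerLike

variable {φ : V → V} {ξ : V} {T T' : V → V → V → V → ℝ}

theorem sub (hT : IsKaehlerLike φ ξ T) (hT' : IsKaehlerLike φ ξ T') :
    IsKaehlerLike φ ξ fun x y z w => T x y z w - T' x y z w where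
  add_left x x' y z w := by rw [hT.add_left, hT'.add_left]; ring
  add_mid x x' y z w := by rw [hT.add_mid, hT'.add_mid]; ring
  swap_left x y z w := by rw [hT.swap_left, hT'.swap_left]; ring
  swap_right x y z w := by rw [hT.swap_right, hT'.swap_right]; ring
  bianchi x y z w := by linear_combination hT.bianchi x y z w - hT'.bianchi x y z w
  map_φ x y z w := by rw [hT.map_φ, hT'.map_φ]
  map_ξ x y w a := by rw [hT.map_ξ, hT'.map_ξ, sub_zero]

/-- The usual octahedron argument: combine the four Bianchi identities obtained by cycling the
arguments. -/
theorem pair (hT : IsKaehlerLike φ ξ T) (x y z w : V) : T x y z w = T z w x y := by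
  linarith [hT.bianchi x y z w, hT.bianchi y z w x, hT.bianchi z w x y, hT.bianchi w x y z,
    hT.swap_left x y z w, hT.swap_right x y z w, hT.swap_left z w x y, hT.swap_right z w x y,
    hT.swap_left y z x w, hT.swap_right y z x w, hT.swap_left z x y w, hT.swap_right z x y w,
    hT.swap_left z w y x, hT.swap_left w y z x, hT.swap_right w y z x, hT.swap_left w x z y,
    hT.swap_right w x z y, hT.swap_right w x y z, hT.swap_right x y w z, hT.swap_right y w x z,
    hT.swap_left y w x z, hT.swap_left y z w x, hT.swap_right y w z x, hT.swap_right x z w y,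
    hT.swap_left x z w y, hT.swap_right z x w y]

theorem φ_left (hT : IsKaehlerLike φ ξ T) (x y z w : V) : T (φ x) y z w = T x (φ y) z w := by
  rw [hT.pair (φ x), hT.pair x, hT.map_φ]

/-- Put `φ` in each of the four slots of the Bianchi identity. The resulting linear system in the
six values (`φ` in the first or in the second pair, for each cyclic order) forces the two values to
agree. So `φ` can be moved between any two slots. -/
theorem φ_mid (hT : IsKaehlerLike φ ξ T) (x y z w : V) : T (φ x) y z w = T x y (φ z) w := by
  linarith [hT.bianchi (φ x) y z w, hT.bianchi x (φ y) z w, hT.bianchi x y (φ z) w,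
    hT.bianchi x y z (φ w), hT.map_φ x y z w, hT.map_φ y z x w, hT.map_φ z x y w,
    hT.φ_left x y z w, hT.φ_left y z x w, hT.φ_left z x y w]

/-- Two Kähler-like tensors coincide if they agree on a real form. -/
theorem eq_zero (hT : IsKaehlerLike φ ξ T) (W : Submodule ℝ V)
    (hW : ∀ v, ∃ r ∈ W, ∃ s ∈ W, ∃ a : ℝ, v = r + φ s + a • ξ)
    (h1 : ∀ x ∈ W, ∀ y ∈ W, T x y y x = 0) (h2 : ∀ x ∈ W, ∀ y ∈ W, T x y y (φ x) = 0)
    (x y z w : V) : T x y z w = 0 := by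
  -- Sectional values determine a curvature tensor on `W`. The statement is for general `S` because
  -- it is applied both to `T` and to `T` with `φ` in the last slot, which has the same symmetries.
  have polar : ∀ S : V → V → V → V → ℝ, (∀ x x' y z w, S (x + x') y z w = S x y z w + S x' y z w) →
      (∀ x y z z' w, S x y (z + z') w = S x y z w + S x y z' w) →
      (∀ x y z w, S x y z w = -S y x z w) → (∀ x y z w, S x y z w = -S x y w z) →
      (∀ x y z w, S x y z w + S y z x w + S z x y w = 0) →
      (∀ x y z w, S x y z w = S z w x y) → (∀ x ∈ W, ∀ y ∈ W, S x y y x = 0) →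
      ∀ x ∈ W, ∀ y ∈ W, ∀ z ∈ W, ∀ w ∈ W, S x y z w = 0 := by
    intro S a1 a3 s12 s34 bi pr h
    have e1 : ∀ x ∈ W, ∀ y ∈ W, ∀ z ∈ W, S x y y z = 0 := by
      intro x hx y hy z hz
      have := h (x + z) (W.add_mem hx hz) y hy
      rw [a1, s34, a3, s34 z, a3 z] at this
      linarith [h x hx y hy, h z hz y hy, s34 x y x y, s34 z y z y, s34 x y z y, s34 z y x y,
        pr z y y x, s12 y x z y]
    have e2 : ∀ x ∈ W, ∀ y ∈ W, ∀ z ∈ W, ∀ w ∈ W, S x y z w = -S x z y w := by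
      intro x hx y hy z hz w hw
      have := e1 x hx (y + z) (W.add_mem hy hz) w hw
      rw [a3, s12, a1, s12 x, a1] at this
      linarith [e1 x hx y hy w hw, e1 x hx z hz w hw, s12 x y y w, s12 x z z w, s12 x y z w,
        s12 x z y w]
    intro x hx y hy z hz w hw
    linarith [bi x y z w, e2 x hx y hy z hz w hw, e2 y hy x hx z hz w hw, s12 x y z w, s12 z x y w]
  have p1 := polar T hT.add_left hT.add_mid hT.swap_left hT.swap_right hT.bianchi hT.pair h1
  have p2 := polar (fun x y z w => T x y z (φ w)) (fun _ _ _ _ _ => hT.add_left _ _ _ _ _)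
    (fun _ _ _ _ _ => hT.add_mid _ _ _ _ _) (fun _ _ _ _ => hT.swap_left _ _ _ _)
    (fun x y z w => by rw [← hT.map_φ, hT.swap_right]) (fun _ _ _ _ => hT.bianchi _ _ _ _)
    (fun x y z w => by rw [← hT.map_φ, ← hT.φ_mid, hT.pair, hT.map_φ]) h2
  have hT2 : ∀ x y y' z w, T x (y + y') z w = T x y z w + T x y' z w := fun x y y' z w => by
    rw [hT.swap_left, hT.add_left, hT.swap_left y, hT.swap_left y']; ring
  have hT4 : ∀ x y z w w', T x y z (w + w') = T x y z w + T x y z w' := fun x y z w w' => by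
    rw [hT.swap_right, hT.add_mid, hT.swap_right x y w, hT.swap_right x y w']; ring
  -- Vanishing spreads from `W` to the whole space one slot at a time: `φ` is moved to the last
  -- slot, where arbitrary vectors are already covered.
  have q4 : ∀ x ∈ W, ∀ y ∈ W, ∀ z ∈ W, ∀ w, T x y z w = 0 := by
    intro x hx y hy z hz w
    obtain ⟨r, hr, s, hs, a, rfl⟩ := hW w
    rw [hT4, hT4, p1 x hx y hy z hz r hr, p2 x hx y hy z hz s hs, hT.swap_right x y z (a • ξ),
      hT.map_ξ]
    simp
  have q3 : ∀ x ∈ W, ∀ y ∈ W, ∀ z w, T x y z w = 0 := by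
    intro x hx y hy z w
    obtain ⟨r, hr, s, hs, a, rfl⟩ := hW z
    rw [hT.add_mid, hT.add_mid, q4 x hx y hy r hr w, hT.map_φ, q4 x hx y hy s hs, hT.map_ξ]
    simp
  have q2 : ∀ x ∈ W, ∀ y z w, T x y z w = 0 := by
    intro x hx y z w
    obtain ⟨r, hr, s, hs, a, rfl⟩ := hW y
    rw [hT2, hT2, q3 x hx r hr z w, ← hT.φ_left, hT.φ_mid, q3 x hx s hs,
      hT.swap_left, hT.pair, hT.map_ξ]
    simp
  obtain ⟨r, hr, s, hs, a, rfl⟩ := hW x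
  rw [hT.add_left, hT.add_left, q2 r hr y z w, hT.φ_mid, q2 s hs, hT.pair, hT.map_ξ]
  simp

end IsKaehlerLike

end KaehlerLike

/-! ### Constant totally real sectional curvatures determine the tensor. -/

section ConstantCurvature

variable {V : Type*} [AddCommGroup V] [Module ℝ V]

/-- The curvature tensor determined by constant totally real sectional curvatures `ν`, `ν'`. -/
def modelCurvature (g : LinearMap.BilinForm ℝ V) (φ : V →ₗ[ℝ] V) (ξ : V) (ν ν' : ℝ)
    (x y z w : V) : ℝ :=
  let h : V → V → ℝ := fun a b => g a b - g ξ a * g ξ b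
  let s : V → V → ℝ := fun a b => g (φ a) b
  ν * (h y z * h x w - s y z * s x w - h x z * h y w + s x z * s y w) -
    ν' * (h y z * s x w + s y z * h x w - h x z * s y w - s x z * h y w)

/-- The pointwise algebra of an almost contact B-metric structure. -/
structure IsBMetricAlgebra (g : LinearMap.BilinForm ℝ V) (φ : V →ₗ[ℝ] V) (ξ : V) : Prop where
  symm : ∀ v w, g v w = g w v
  nondeg : ∀ v, (∀ w, g v w = 0) → v = 0
  φ_φ : ∀ v, φ (φ v) = -v + g ξ v • ξ
  ξ_ξ : g ξ ξ = 1
  φ_symm : ∀ v w, g (φ v) w = g v (φ w)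
  φ_ξ : φ ξ = 0

variable {g : LinearMap.BilinForm ℝ V} {φ : V →ₗ[ℝ] V} {ξ : V}

theorem IsBMetricAlgebra.ξ_φ (h : IsBMetricAlgebra g φ ξ) (v : V) : g ξ (φ v) = 0 := by
  rw [← h.φ_symm, h.φ_ξ, map_zero, LinearMap.zero_apply]

theorem isKaehlerLike_modelCurvature (h : IsBMetricAlgebra g φ ξ) (ν ν' : ℝ) :
    IsKaehlerLike φ ξ (modelCurvature g φ ξ ν ν') where
  add_left x x' y z w := by
    simp only [modelCurvature, map_add, LinearMap.add_apply]; ring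
  add_mid x y z z' w := by
    simp only [modelCurvature, map_add]; ring
  swap_left x y z w := by simp only [modelCurvature]; ring
  swap_right x y z w := by simp only [modelCurvature]; ring
  bianchi x y z w := by
    simp only [modelCurvature]
    rw [h.symm y x, h.symm z y, h.symm z x, h.φ_symm y x, h.symm y (φ x), h.φ_symm z y,
      h.symm z (φ y), h.φ_symm z x, h.symm z (φ x)]
    ring
  map_φ x y z w := by
    have e : ∀ a b, g (φ a) (φ b) = -g a b + g ξ a * g ξ b := fun a b => by
      rw [← h.φ_symm, h.φ_φ]; simp
    simp only [modelCurvature, h.ξ_φ, e, ← h.φ_symm, mul_zero, sub_zero]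
    ring
  map_ξ x y w a := by
    simp only [modelCurvature, map_smul, smul_eq_mul, h.φ_symm, h.φ_ξ, map_zero, h.ξ_ξ,
      h.symm _ ξ]
    ring

/-- Constant totally real sectional curvatures determine a Kähler-like tensor. -/
theorem IsKaehlerLike.eq_modelCurvature [FiniteDimensional ℝ V] (h : IsBMetricAlgebra g φ ξ)
    {T : V → V → V → V → ℝ} (hT : IsKaehlerLike φ ξ T)
    (hsmul : ∀ (a : ℝ) x y z w, T (a • x) y z w = a * T x y z w) {ν ν' : ℝ}
    (hν : ∀ x y, g x x * g y y - g x y ^ 2 ≠ 0 → g (φ x) x = 0 → g (φ x) y = 0 → g (φ y) y = 0 →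
      g ξ x = 0 → g ξ y = 0 → T x y y x = ν * (g x x * g y y - g x y ^ 2) ∧
        T x y y (φ x) = ν' * (g x x * g y y - g x y ^ 2)) (x y z w : V) :
    T x y z w = modelCurvature g φ ξ ν ν' x y z w := by
  -- On the contact hyperplane `φ` is a genuine complex structure and `g` stays nondegenerate, so a
  -- real form exists there.
  let K : Submodule ℝ V := LinearMap.ker (g ξ)
  have hK : ∀ v : K, g ξ v = 0 := fun v => v.2
  have hKmap : ∀ v ∈ K, φ v ∈ K := fun v _ => h.ξ_φ v
  obtain ⟨k, ρ, h1, h2, h3⟩ := exists_realForm (V := K) (g.domRestrict₁₂ K K)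
    (fun v w => h.symm v w)
    (fun v hv => by
      apply Subtype.ext
      refine h.nondeg v fun w => ?_
      have hw : w - g ξ w • ξ ∈ K := by
        change g ξ (w - g ξ w • ξ) = 0
        simp [h.ξ_ξ]
      have := hv ⟨_, hw⟩
      change g v (w - g ξ w • ξ) = 0 at this
      rw [map_sub, map_smul, h.symm v ξ, hK v] at this
      simpa using this)
    (φ.restrict hKmap)
    (fun v => by
      apply Subtype.ext
      change φ (φ v) = -(v : V)
      rw [h.φ_φ, hK v]; simp)
    (fun v w => h.φ_symm v w)
  let W : Submodule ℝ V := (LinearMap.range ρ).map K.subtype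
  have hWg : ∀ x ∈ W, ∃ r, x = ρ r := by
    rintro x ⟨_, ⟨r, rfl⟩, rfl⟩
    exact ⟨r, rfl⟩
  have hWξ : ∀ x ∈ W, g ξ x = 0 := by
    rintro x ⟨v, -, rfl⟩
    exact hK v
  have hpos : ∀ x ∈ W, g x x = 0 → x = 0 := by
    intro x hx h0
    obtain ⟨r, rfl⟩ := hWg x hx
    have := h1 r
    change g (ρ r) (ρ r) = _ at this
    rw [h0, eq_comm, Finset.sum_eq_zero_iff_of_nonneg fun i _ => mul_self_nonneg _] at this
    have hr : r = 0 := by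
      ext i
      exact mul_self_eq_zero.1 (this i (Finset.mem_univ i))
    rw [hr, map_zero]; rfl
  have hself : ∀ x ∈ W, g (φ x) x = 0 := by
    intro x hx
    obtain ⟨r, rfl⟩ := hWg x hx
    rw [h.φ_symm]
    exact h2 r
  have hiso : ∀ x ∈ W, ∀ y ∈ W, g (φ x) y = 0 := by
    intro x hx y hy
    have := hself (x + y) (W.add_mem hx hy)
    simp only [map_add, LinearMap.add_apply, hself x hx, hself y hy] at this
    rw [h.φ_symm y x, h.symm y] at this
    linarith
  have hφφ : ∀ x ∈ W, φ (φ x) = -x := fun x hx => by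
    rw [h.φ_φ, hWξ x hx]; simp
  have hM := isKaehlerLike_modelCurvature h ν ν'
  have hD := hT.sub hM
  have hTzero : ∀ y z w, T 0 y z w = 0 := fun y z w => by
    have := hsmul 0 0 y z w
    simpa using this
  have key : ∀ x ∈ W, ∀ y ∈ W, T x y y x = ν * (g x x * g y y - g x y ^ 2) ∧
        T x y y (φ x) = ν' * (g x x * g y y - g x y ^ 2) := by
    intro x hx y hy
    -- On the real form `g` is positive definite, so a degenerate pair is linearly dependent and
    -- both sides vanish. Any other pair spans an admissible plane.
    by_cases hne : g x x * g y y - g x y ^ 2 = 0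
    · rw [hne, mul_zero, mul_zero]
      -- The square norm of this vector is `g x x` times the Gram determinant.
      have hv := hpos (g x x • y - g x y • x) (W.sub_mem (W.smul_mem _ hy) (W.smul_mem _ hx)) (by
        simp only [map_sub, map_smul, LinearMap.sub_apply, LinearMap.smul_apply, smul_eq_mul,
          h.symm y x]
        linear_combination g x x * hne)
      have hyx : g x x • y = g x y • x := sub_eq_zero.1 hv
      have hself0 : ∀ z w, T x x z w = 0 := fun z w => by linarith [hT.swap_left x x z w]
      have e : ∀ z w, g x x * T x y z w = 0 := by
        intro z w
        rw [hT.swap_left, mul_neg, ← hsmul, hyx, hsmul, hself0, mul_zero, neg_zero]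
      by_cases hx0 : g x x = 0
      · rw [hpos x hx hx0, hTzero, hTzero]; simp
      · exact ⟨(mul_eq_zero.1 (e _ _)).resolve_left hx0, (mul_eq_zero.1 (e _ _)).resolve_left hx0⟩
    · exact hν x y hne (hself x hx) (hiso x hx y hy) (hself y hy) (hWξ x hx) (hWξ y hy)
  refine sub_eq_zero.1 (hD.eq_zero W ?_ ?_ ?_ x y z w)
  · intro v
    have hv : v - g ξ v • ξ ∈ K := by
      change g ξ (v - g ξ v • ξ) = 0
      simp [h.ξ_ξ]
    obtain ⟨r, s, hrs⟩ := h3 ⟨_, hv⟩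
    refine ⟨ρ r, ⟨_, ⟨r, rfl⟩, rfl⟩, ρ s, ⟨_, ⟨s, rfl⟩, rfl⟩, g ξ v, ?_⟩
    have := congrArg (Subtype.val) hrs
    exact sub_eq_iff_eq_add.1 this
  · intro x hx y hy
    rw [(key x hx y hy).1]
    simp only [modelCurvature, hiso x hx y hy, hiso y hy x hx, hself x hx, hself y hy, hWξ x hx,
      hWξ y hy, h.symm y x]
    ring
  · intro x hx y hy
    rw [(key x hx y hy).2]
    -- The anti-isometry turns the minus sign before `ν'` in the model into the plus sign required
    -- here.
    have e : ∀ a b, g (φ a) (φ b) = -g a b + g ξ a * g ξ b := fun a b => by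
      rw [← h.φ_symm, h.φ_φ]; simp
    simp only [modelCurvature, e, hiso x hx y hy, hiso y hy x hx, hself x hx, hself y hy, hWξ x hx,
      hWξ y hy, h.symm y x, h.ξ_φ, ← h.φ_symm]
    ring

end ConstantCurvature

/-! ### Pointwise algebra: Ricci tensors and semi-symmetry. -/

section ScreenAlgebra

variable {E : Type*} [NormedAddCommGroup E] [NormedSpace ℝ E]

/-- The pointwise algebra of a hyperplane-like degenerate metric `g` with radical `span {x₀}`, a
complementary form `θ` and the complex structure `J` of its screen `ker θ`. -/
structure IsScreenAlgebra (g : E →L[ℝ] E →L[ℝ] ℝ) (θ : E →L[ℝ] ℝ) (x₀ : E) (J : E →ₗ[ℝ] E) :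
    Prop where
  symm : ∀ v w, g v w = g w v
  g_x₀ : ∀ w, g x₀ w = 0
  θ_x₀ : θ x₀ = 1
  J_x₀ : J x₀ = 0
  θ_J : ∀ v, θ (J v) = 0
  J_J : ∀ v, J (J v) = -(v - θ v • x₀)
  J_symm : ∀ v w, g (J v) w = g v (J w)
  nondeg : ∀ v, (∀ w, g v w = 0) → v = θ v • x₀

/-- Curvature tensors built from the screen algebra. -/
noncomputable def screenCurvature (g : E →L[ℝ] E →L[ℝ] ℝ) (θ : E →L[ℝ] ℝ) (x₀ : E) (J : E →ₗ[ℝ] E)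
    (a₁ a₂ a₃ b c₁ c₂ : ℝ) (u v w : E) : E :=
  (a₁ * g v w + a₂ * g (J v) w + a₃ * (θ v * θ w)) • (u - θ u • x₀) + (b * g (J v) w) • J u
    + ((c₁ * g v w + c₂ * g (J v) w) * θ u) • x₀
    - ((a₁ * g u w + a₂ * g (J u) w + a₃ * (θ u * θ w)) • (v - θ v • x₀) + (b * g (J u) w) • J v
    + ((c₁ * g u w + c₂ * g (J u) w) * θ v) • x₀)

namespace IsScreenAlgebra

variable {g : E →L[ℝ] E →L[ℝ] ℝ} {θ : E →L[ℝ] ℝ} {x₀ : E} {J : E →ₗ[ℝ] E}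

theorem g_x₀' (h : IsScreenAlgebra g θ x₀ J) (v : E) : g v x₀ = 0 := by rw [h.symm, h.g_x₀]

theorem g_J_J (h : IsScreenAlgebra g θ x₀ J) (v w : E) : g (J v) (J w) = -g v w := by
  rw [← h.J_symm, h.J_J]
  simp [h.g_x₀]

theorem trace_J [FiniteDimensional ℝ E] (h : IsScreenAlgebra g θ x₀ J) :
    LinearMap.trace ℝ E J = 0 :=
  trace_eq_zero_of_cube J fun v => by rw [h.J_J]; simp [h.θ_J]

/-- The screen projection has trace `dim - 1`, `J` has trace zero, and a rank one map `f ⊗ p` has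
trace `f p`. -/
theorem trace_formula [FiniteDimensional ℝ E] (h : IsScreenAlgebra g θ x₀ J) (L : E →ₗ[ℝ] E)
    (a b : ℝ) (f₁ f₂ f₃ : E →ₗ[ℝ] ℝ) (p₁ p₂ p₃ : E)
    (hL : ∀ u, L u = a • (u - θ u • x₀) + b • J u + f₁ u • p₁ + f₂ u • p₂ + f₃ u • p₃) :
    LinearMap.trace ℝ E L = a * (Module.finrank ℝ E - 1) + f₁ p₁ + f₂ p₂ + f₃ p₃ := by
  have e : L = a • (LinearMap.id - (θ : E →ₗ[ℝ] ℝ).smulRight x₀) + b • J + f₁.smulRight p₁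
      + f₂.smulRight p₂ + f₃.smulRight p₃ := by
    ext u
    simpa using hL u
  have t : ∀ (f : E →ₗ[ℝ] ℝ) p, LinearMap.trace ℝ E (f.smulRight p) = f p := fun f p => by
    simp [LinearMap.trace_smulRight]
  rw [e]
  simp only [map_add, map_sub, map_smul, t, h.trace_J, LinearMap.trace_id,
    ContinuousLinearMap.coe_coe, h.θ_x₀, smul_eq_mul, mul_zero, add_zero]

/-- Here `m` is the rank of the screen. In `u ↦ R(u,v)w` only the multiples of the screen projection
and of `J` have large rank; all other terms are rank one, grouped by the functionals `θ`, `g w` and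
`g w ∘ J`. -/
theorem ricci_eq [FiniteDimensional ℝ E] (h : IsScreenAlgebra g θ x₀ J)
    {Γ : E → E →L[ℝ] E →L[ℝ] E} {y : E} {a₁ a₂ a₃ b c₁ c₂ : ℝ}
    (hR : ∀ u v w, curvature Γ y u v w = screenCurvature g θ x₀ J a₁ a₂ a₃ b c₁ c₂ u v w)
    {m : ℝ} (hm : (Module.finrank ℝ E : ℝ) = m + 1) (v w : E) :
    ricci Γ y v w = ((m - 1) * a₁ + c₁ + b) * g v w + ((m - 1) * a₂ + c₂) * g (J v) w
      + m * a₃ * (θ v * θ w) := by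
  rw [ricci, h.trace_formula _ (a₁ * g v w + a₂ * g (J v) w + a₃ * (θ v * θ w)) (b * g (J v) w)
    θ (g w : E →ₗ[ℝ] ℝ) ((g w : E →ₗ[ℝ] ℝ).comp J)
    ((c₁ * g v w + c₂ * g (J v) w) • x₀ - (a₃ * θ w) • (v - θ v • x₀))
    (-(a₁ • (v - θ v • x₀)) - (c₁ * θ v) • x₀)
    (-(a₂ • (v - θ v • x₀)) - b • J v - (c₂ * θ v) • x₀)]
  · rw [hm]
    simp only [ContinuousLinearMap.coe_coe, LinearMap.comp_apply, map_sub, map_neg, map_smul,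
      h.J_x₀, h.J_J, h.θ_x₀, h.g_x₀', smul_eq_mul, h.symm w v, h.symm w (J v), map_zero]
    ring
  · intro u
    simp only [LinearMap.coe_mk, AddHom.coe_mk, hR, screenCurvature, ContinuousLinearMap.coe_coe,
      LinearMap.comp_apply, h.symm w u, h.symm w (J u)]
    module

/-- The screen is nonzero by dimension and `g` is nondegenerate modulo the radical. The pair serves
to compare coefficients of tensors. -/
theorem exists_pair [FiniteDimensional ℝ E] (h : IsScreenAlgebra g θ x₀ J)
    (hdim : 2 ≤ Module.finrank ℝ E) : ∃ v w, θ v = 0 ∧ θ w = 0 ∧ g v w ≠ 0 := by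
  obtain ⟨v, hv⟩ : ∃ v, v ∉ Submodule.span ℝ {x₀} := by
    by_contra! hall
    have h1 : Submodule.span ℝ {x₀} = ⊤ := eq_top_iff.2 fun v _ => hall v
    have h2 := finrank_span_le_card (R := ℝ) ({x₀} : Set E)
    rw [h1, finrank_top] at h2
    simp at h2
    omega
  obtain ⟨w, hw⟩ : ∃ w, g v w ≠ 0 := by
    by_contra! hall
    exact hv (Submodule.mem_span_singleton.2 ⟨θ v, (h.nondeg v hall).symm⟩)
  refine ⟨v - θ v • x₀, w - θ w • x₀, ?_, ?_, ?_⟩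
  · simp [h.θ_x₀]
  · simp [h.θ_x₀]
  · simpa [h.g_x₀, h.g_x₀'] using hw

/-- When `ν = c²` the curvature is `h(v,w)u - h(u,w)v` with `h = ν (g/2 - θ⊗θ)` and the Ricci tensor
is `m h`, so it is annihilated by the curvature. -/
theorem curvatureDotRicci_eq_zero_iff [FiniteDimensional ℝ E] (h : IsScreenAlgebra g θ x₀ J)
    (hdim : 2 ≤ Module.finrank ℝ E) {Γ : E → E →L[ℝ] E →L[ℝ] E} {y : E} {ν c : ℝ}
    (hR : ∀ u v w, curvature Γ y u v w =
      screenCurvature g θ x₀ J (ν - c ^ 2 / 2) 0 (-ν) (-(ν - c ^ 2)) (ν / 2) 0 u v w)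
    {m : ℝ} (hm : (Module.finrank ℝ E : ℝ) = m + 1) (hm3 : m ≠ 3) (hν : ν ≠ 0) :
    (∀ u v w₁ w₂, curvatureDotRicci Γ y u v w₁ w₂ = 0) ↔ ν = c ^ 2 := by
  constructor
  · intro h0
    obtain ⟨v, w, hv, hw, hvw⟩ := h.exists_pair hdim
    -- For screen vectors `R(x₀,v)x₀ = ν v` and `R(x₀,v)w = (ν/2) g(v,w) x₀`. The condition reduces
    -- to `ν (m - 3)(ν - c²) g(v,w) = 0`.
    have := h0 x₀ v x₀ w
    rw [curvatureDotRicci, h.ricci_eq hR hm, h.ricci_eq hR hm, hR, hR] at this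
    simp only [screenCurvature, h.g_x₀, h.g_x₀', h.θ_x₀, hv, hw, h.J_x₀, map_zero,
      zero_apply, map_add, map_sub, map_smul, add_apply,
      smul_apply, sub_apply, smul_eq_mul] at this
    have e : ν * g v w * ((m - 3) * (ν - c ^ 2)) = 0 := by linear_combination (-2 : ℝ) * this
    have h3 := (mul_eq_zero.1 e).resolve_left (mul_ne_zero hν hvw)
    exact sub_eq_zero.1 ((mul_eq_zero.1 h3).resolve_left (sub_ne_zero.2 hm3))
  · rintro hc u v w₁ w₂
    rw [curvatureDotRicci, h.ricci_eq hR hm, h.ricci_eq hR hm, hR, hR, ← hc]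
    simp only [screenCurvature, h.g_x₀, h.g_x₀', h.θ_x₀, h.J_x₀, h.θ_J,
      map_add, map_sub, map_smul, add_apply, smul_apply, sub_apply,
      smul_eq_mul, h.symm w₁ u, h.symm w₁ v]
    ring

/-- The hypotheses say that the complex number `d ((m - 2) - i (m - 1))` annihilates `p + i q`. -/
theorem eq_zero_of_pair {m d p q : ℝ} (hm : 1 < m) (hp : p ≠ 0)
    (h1 : (m - 2) * d * p + (m - 1) * d * q = 0) (h2 : (m - 2) * d * q - (m - 1) * d * p = 0) :
    d = 0 := by
  have : d * p * ((m - 2) ^ 2 + (m - 1) ^ 2) = 0 := by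
    linear_combination (m - 2) * h1 - (m - 1) * h2
  rcases mul_eq_zero.1 this with h | h
  · exact (mul_eq_zero.1 h).resolve_right hp
  · have := sq_nonneg (m - 2)
    have : 0 < (m - 1) ^ 2 := by have : 0 < m - 1 := by linarith
                                 positivity
    linarith

/-- When `ν = c²` the curvature is that of a space of constant curvature `-ν` for `g(J·,·) + θ⊗θ`.
-/
theorem assoc_curvatureDotRicci_eq_zero_iff [FiniteDimensional ℝ E] (h : IsScreenAlgebra g θ x₀ J)
    (hdim : 2 ≤ Module.finrank ℝ E) {Γ : E → E →L[ℝ] E →L[ℝ] E} {y : E} {ν c : ℝ}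
    (hR : ∀ u v w, curvature Γ y u v w =
      screenCurvature g θ x₀ J (ν - c ^ 2) (-c ^ 2) (-ν) (-(ν - c ^ 2)) 0 (-ν) u v w)
    {m : ℝ} (hm : (Module.finrank ℝ E : ℝ) = m + 1) (hm1 : 1 < m) (hν : ν ≠ 0) :
    (∀ u v w₁ w₂, curvatureDotRicci Γ y u v w₁ w₂ = 0) ↔ ν = c ^ 2 := by
  constructor
  · intro h0
    obtain ⟨v, w, hv, hw, hvw⟩ := h.exists_pair hdim
    have key : ∀ w, θ w = 0 → (m - 2) * (ν - c ^ 2) * g v w + (m - 1) * (ν - c ^ 2) * g (J v) w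
        = 0 := by
      intro w hw
      have := h0 x₀ v x₀ w
      rw [curvatureDotRicci, h.ricci_eq hR hm, h.ricci_eq hR hm, hR, hR] at this
      simp only [screenCurvature, h.g_x₀, h.g_x₀', h.θ_x₀, hv, hw, h.J_x₀, map_zero, zero_apply,
        map_add, map_sub, map_smul, add_apply, smul_apply, sub_apply, smul_eq_mul] at this
      have e : ν * ((m - 2) * (ν - c ^ 2) * g v w + (m - 1) * (ν - c ^ 2) * g (J v) w) = 0 := by
        linear_combination -this
      exact (mul_eq_zero.1 e).resolve_left hν
    -- Replacing `w` by `J w` rotates the pair `(g(v,w), g(Jv,w))` and supplies the second equation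
    -- for `eq_zero_of_pair`.
    have h2 := key (J w) (h.θ_J w)
    rw [h.g_J_J, ← h.J_symm] at h2
    exact sub_eq_zero.1 (eq_zero_of_pair hm1 hvw (key w hw) (by linear_combination h2))
  · rintro hc u v w₁ w₂
    rw [curvatureDotRicci, h.ricci_eq hR hm, h.ricci_eq hR hm, hR, hR, ← hc]
    simp only [screenCurvature, h.g_x₀, h.g_x₀', h.θ_x₀, h.J_x₀, h.θ_J, h.J_J, h.g_J_J,
      map_add, map_sub, map_smul, add_apply, smul_apply, sub_apply, smul_eq_mul, map_neg,
      neg_apply, ← h.J_symm, h.symm w₁ u, h.symm w₁ v, h.symm (J w₁)]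
    ring

/-- The entry at `(x₀, x₀)` forces `k = -m ν`. The screen entries then give the same two equations
as semi-symmetry, without the factor `ν`. -/
theorem eq_sq_of_einstein [FiniteDimensional ℝ E] (h : IsScreenAlgebra g θ x₀ J)
    (hdim : 2 ≤ Module.finrank ℝ E) {Γ : E → E →L[ℝ] E →L[ℝ] E} {y : E} {ν c : ℝ}
    (hR : ∀ u v w, curvature Γ y u v w =
      screenCurvature g θ x₀ J (ν - c ^ 2) (-c ^ 2) (-ν) (-(ν - c ^ 2)) 0 (-ν) u v w)
    {m : ℝ} (hm : (Module.finrank ℝ E : ℝ) = m + 1) (hm1 : 1 < m) {k : ℝ}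
    (hk : ∀ v w, ricci Γ y v w = k * (g (J v) w + θ v * θ w)) : ν = c ^ 2 := by
  have h0 := hk x₀ x₀
  rw [h.ricci_eq hR hm] at h0
  simp only [h.g_x₀, h.J_x₀, h.θ_x₀, map_zero, zero_apply] at h0
  obtain ⟨v, w, hv, hw, hvw⟩ := h.exists_pair hdim
  have key : ∀ w, (m - 2) * (ν - c ^ 2) * g v w + (m - 1) * (ν - c ^ 2) * g (J v) w = 0 := by
    intro w
    have := hk v w
    rw [h.ricci_eq hR hm, hv] at this
    linear_combination this - g (J v) w * h0
  have h2 := key (J w)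
  rw [h.g_J_J, ← h.J_symm] at h2
  exact sub_eq_zero.1 (eq_zero_of_pair hm1 hvw (key w) (by linear_combination h2))

theorem assoc_ricci_eq [FiniteDimensional ℝ E] (h : IsScreenAlgebra g θ x₀ J)
    {Γ : E → E →L[ℝ] E →L[ℝ] E} {y : E} {ν c : ℝ}
    (hR : ∀ u v w, curvature Γ y u v w =
      screenCurvature g θ x₀ J (ν - c ^ 2) (-c ^ 2) (-ν) (-(ν - c ^ 2)) 0 (-ν) u v w)
    {m : ℝ} (hm : (Module.finrank ℝ E : ℝ) = m + 1) (hc : ν = c ^ 2) (v w : E) :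
    ricci Γ y v w = -(m * ν) * (g (J v) w + θ v * θ w) := by
  rw [h.ricci_eq hR hm, ← hc]
  ring

end IsScreenAlgebra

end ScreenAlgebra

/-! ### The ambient manifold in coordinates. -/

section LocalBMetric

variable {F : Type*} [NormedAddCommGroup F] [NormedSpace ℝ F]

/-- A continuous bilinear form as an algebraic one. -/
noncomputable def toBilin (b : F →L[ℝ] F →L[ℝ] ℝ) : LinearMap.BilinForm ℝ F :=
  LinearMap.mk₂ ℝ (fun v w => b v w) (by simp) (by simp) (by simp) (by simp)

@[simp] theorem toBilin_apply (b : F →L[ℝ] F →L[ℝ] ℝ) (v w : F) : toBilin b v w = b v w := rfl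

/-- An almost contact B-metric structure on an open piece of a vector space, with parallel
structure endomorphism. -/
structure IsLocalBMetric (V : Set F) (G : F → F →L[ℝ] F →L[ℝ] ℝ) (Φ : F → F →L[ℝ] F)
    (Ξ : F → F) : Prop where
  isOpen : IsOpen V
  smooth_G : ∀ x ∈ V, ContDiffAt ℝ ∞ G x
  smooth_Φ : ∀ x ∈ V, ContDiffAt ℝ ∞ Φ x
  smooth_Ξ : ∀ x ∈ V, ContDiffAt ℝ ∞ Ξ x
  algebra : ∀ x ∈ V, IsBMetricAlgebra (toBilin (G x)) (Φ x : F →ₗ[ℝ] F) (Ξ x)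
  parallel : ∀ x ∈ V, ∀ u w, covDerivEndo (leviCivita G) Φ x u w = 0

variable {V : Set F} {G Gt : F → F →L[ℝ] F →L[ℝ] ℝ} {Φ : F → F →L[ℝ] F} {Ξ : F → F}

namespace IsLocalBMetric

section Algebra

variable (h : IsLocalBMetric V G Φ Ξ) {x : F} (hx : x ∈ V)

include h hx

theorem symm (v w : F) : G x v w = G x w v := (h.algebra x hx).symm v w

theorem nondeg (v : F) (hv : ∀ w, G x v w = 0) : v = 0 := (h.algebra x hx).nondeg v hv

theorem Φ_Φ (v : F) : Φ x (Φ x v) = -v + G x (Ξ x) v • Ξ x := (h.algebra x hx).φ_φ v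

theorem Ξ_Ξ : G x (Ξ x) (Ξ x) = 1 := (h.algebra x hx).ξ_ξ

theorem Φ_symm (v w : F) : G x (Φ x v) w = G x v (Φ x w) := (h.algebra x hx).φ_symm v w

theorem Φ_Ξ : Φ x (Ξ x) = 0 := (h.algebra x hx).φ_ξ

theorem Ξ_Φ (v : F) : G x (Ξ x) (Φ x v) = 0 := (h.algebra x hx).ξ_φ v

theorem G_Φ_Φ (v w : F) : G x (Φ x v) (Φ x w) = -G x v w + G x (Ξ x) v * G x (Ξ x) w := by
  rw [← h.Φ_symm hx, h.Φ_Φ hx]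
  simp

end Algebra

variable [FiniteDimensional ℝ F]

theorem Γ_symm (h : IsLocalBMetric V G Φ Ξ) {x : F} (hx : x ∈ V) (v w : F) :
    leviCivita G x v w = leviCivita G x w v :=
  leviCivita_symm h.isOpen (fun _ hz => h.symm hz) (fun _ hz => h.nondeg hz) hx
    (h.smooth_G x hx).differentiableAt_infty v w

theorem Γ_metric (h : IsLocalBMetric V G Φ Ξ) {x : F} (hx : x ∈ V) (u v w : F) :
    fderiv ℝ G x u v w = G x (leviCivita G x u v) w + G x v (leviCivita G x u w) :=
  leviCivita_metric h.isOpen (fun _ hz => h.symm hz) (fun _ hz => h.nondeg hz) hx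
    (h.smooth_G x hx).differentiableAt_infty u v w

theorem smooth_Γ (h : IsLocalBMetric V G Φ Ξ) {x : F} (hx : x ∈ V) :
    ContDiffAt ℝ ∞ (leviCivita G) x :=
  contDiffAt_leviCivita (h.nondeg hx) (h.smooth_G x hx)

section Along

variable {E : Type*} [NormedAddCommGroup E] [NormedSpace ℝ E] {f W W' : E → F} {y : E}

theorem fderiv_G (h : IsLocalBMetric V G Φ Ξ) (hy : f y ∈ V) (hf : DifferentiableAt ℝ f y)
    (hW : DifferentiableAt ℝ W y) (hW' : DifferentiableAt ℝ W' y) (v : E) :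
    fderiv ℝ (fun z => G (f z) (W z) (W' z)) y v =
      G (f y) (covAlong (leviCivita G) f W y v) (W' y) +
        G (f y) (W y) (covAlong (leviCivita G) f W' y v) :=
  fderiv_metric_apply (h.smooth_G _ hy).differentiableAt_infty hf (h.Γ_metric hy) hW hW' v

omit [FiniteDimensional ℝ F] in
theorem covAlong_Φ (h : IsLocalBMetric V G Φ Ξ) (hy : f y ∈ V) (hf : DifferentiableAt ℝ f y)
    (hW : DifferentiableAt ℝ W y) (v : E) :
    covAlong (leviCivita G) f (fun z => Φ (f z) (W z)) y v =
      Φ (f y) (covAlong (leviCivita G) f W y v) :=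
  covAlong_endo_apply (h.smooth_Φ _ hy).differentiableAt_infty hf (h.parallel _ hy) hW v

/-- Differentiating `ΦΞ = 0` puts `∇Ξ` in the kernel of `Φ`, the line of `Ξ`. Differentiating
`G(Ξ,Ξ) = 1` makes it orthogonal to `Ξ`. -/
theorem covAlong_Ξ_id (h : IsLocalBMetric V G Φ Ξ) {x : F} (hx : x ∈ V) (v : F) :
    covAlong (leviCivita G) id Ξ x v = 0 := by
  have hd := (h.smooth_Ξ x hx).differentiableAt_infty
  have e1 : Φ x (covAlong (leviCivita G) id Ξ x v) = 0 := by
    refine (h.covAlong_Φ (f := id) hx differentiableAt_id hd v).symm.trans ?_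
    have : (fun z => Φ (id z) (Ξ z)) =ᶠ[𝓝 x] fun _ => 0 := by
      filter_upwards [h.isOpen.mem_nhds hx] with z hz using h.Φ_Ξ hz
    rw [covAlong_congr this]
    simp [covAlong]
  have e2 : G x (covAlong (leviCivita G) id Ξ x v) (Ξ x) = 0 := by
    have h1 := h.fderiv_G (f := id) (y := x) hx differentiableAt_id hd hd v
    have : (fun z => G (id z) (Ξ z) (Ξ z)) =ᶠ[𝓝 x] fun _ => 1 := by
      filter_upwards [h.isOpen.mem_nhds hx] with z hz using h.Ξ_Ξ hz
    rw [this.fderiv_eq] at h1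
    simp only [id, h.symm hx (Ξ x)] at h1
    simp at h1
    linarith
  have e3 := h.Φ_Φ hx (covAlong (leviCivita G) id Ξ x v)
  rw [e1, map_zero, h.symm hx, e2, zero_smul, add_zero] at e3
  exact neg_eq_zero.1 e3.symm

theorem covAlong_Ξ (h : IsLocalBMetric V G Φ Ξ) (hy : f y ∈ V) (hf : DifferentiableAt ℝ f y)
    (v : E) : covAlong (leviCivita G) f (fun z => Ξ (f z)) y v = 0 := by
  have h1 := h.covAlong_Ξ_id hy (fderiv ℝ f y v)
  rw [covAlong] at h1 ⊢
  rw [fderiv_fun_comp y (h.smooth_Ξ _ hy).differentiableAt_infty hf]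
  simpa using h1

end Along

theorem curvature_Φ (h : IsLocalBMetric V G Φ Ξ) {x : F} (hx : x ∈ V) (u v w : F) :
    curvature (leviCivita G) x u v (Φ x w) = Φ x (curvature (leviCivita G) x u v w) := by
  have hid : ContDiffAt ℝ ∞ (id : F → F) x := contDiffAt_id
  have hW : ContDiffAt ℝ ∞ (fun z => Φ z w) x := (h.smooth_Φ x hx).clm_apply contDiffAt_const
  have hΓ : ContDiffAt ℝ ∞ (leviCivita G) (id x) := h.smooth_Γ hx
  have h1 := covAlong_commutator hΓ hid hW u v
  have h2 := covAlong_commutator hΓ hid (contDiffAt_const (c := w)) u v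
  have e : ∀ a b, covAlong (leviCivita G) id (fun z => covAlong (leviCivita G) id (fun z => Φ z w)
      z a) x b = Φ x (covAlong (leviCivita G) id (fun z => covAlong (leviCivita G) id
        (fun _ => w) z a) x b) := by
    intro a b
    have hev : (fun z => covAlong (leviCivita G) id (fun z => Φ z w) z a) =ᶠ[𝓝 x]
        fun z => Φ (id z) (covAlong (leviCivita G) id (fun _ => w) z a) := by
      filter_upwards [h.isOpen.mem_nhds hx] with z hz
      exact h.covAlong_Φ (f := id) hz differentiableAt_id (differentiableAt_const w) a
    rw [covAlong_congr hev, h.covAlong_Φ (f := id) hx differentiableAt_id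
      (contDiffAt_covAlong hΓ hid contDiffAt_const a).differentiableAt_infty]
    rfl
  rw [e, e, ← map_sub, h2] at h1
  simpa using h1.symm

theorem curvature_Ξ (h : IsLocalBMetric V G Φ Ξ) {x : F} (hx : x ∈ V) (u v : F) :
    curvature (leviCivita G) x u v (Ξ x) = 0 := by
  have h1 := covAlong_commutator (f := id) (h.smooth_Γ hx) contDiffAt_id (h.smooth_Ξ x hx) u v
  have e : ∀ a b, covAlong (leviCivita G) id (fun z => covAlong (leviCivita G) id Ξ z a) x b
      = 0 := by
    intro a b
    have hev : (fun z => covAlong (leviCivita G) id Ξ z a) =ᶠ[𝓝 x] fun _ => 0 := by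
      filter_upwards [h.isOpen.mem_nhds hx] with z hz using h.covAlong_Ξ_id hz a
    rw [covAlong_congr hev]
    simp [covAlong]
  rw [e, e] at h1
  simpa using h1.symm

/-- Metric compatibility applied twice to `G(w,z)` with constant `w`, `z`: the mixed first-order
terms cancel by symmetry of the second derivative, leaving the two curvature terms. -/
theorem curvature_skew (h : IsLocalBMetric V G Φ Ξ) {x : F} (hx : x ∈ V) (u v w z : F) :
    G x (curvature (leviCivita G) x u v w) z = -G x (curvature (leviCivita G) x u v z) w := by
  have hid : ContDiffAt ℝ ∞ (id : F → F) x := contDiffAt_id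
  have hΓ : ContDiffAt ℝ ∞ (leviCivita G) (id x) := h.smooth_Γ hx
  have h1 := covAlong_commutator hΓ hid (contDiffAt_const (c := w)) u v
  have h2 := covAlong_commutator hΓ hid (contDiffAt_const (c := z)) u v
  let D : F → F → F → F := fun a b p => covAlong (leviCivita G) id (fun _ => b) p a
  have hD : ∀ a b, DifferentiableAt ℝ (D a b) x := fun a b =>
    (contDiffAt_covAlong hΓ hid contDiffAt_const a).differentiableAt_infty
  have hφ : ContDiffAt ℝ ∞ (fun p => G p w z) x :=
    ((h.smooth_G x hx).clm_apply contDiffAt_const).clm_apply contDiffAt_const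
  have e : ∀ a b, fderiv ℝ (fderiv ℝ (fun p => G p w z)) x a b =
      G x (covAlong (leviCivita G) id (D b w) x a) z + G x (D b w x) (D a z x) +
      (G x (D a w x) (D b z x) + G x w (covAlong (leviCivita G) id (D b z) x a)) := by
    intro a b
    have e1 : fderiv ℝ (fderiv ℝ (fun p => G p w z)) x a b =
        fderiv ℝ (fun q => fderiv ℝ (fun p => G p w z) q b) x a := by
      rw [(hφ.fderiv_infty.differentiableAt_infty.hasFDerivAt.clm_apply
        (hasFDerivAt_const b x)).fderiv]
      simp
    have hev : (fun q => fderiv ℝ (fun p => G p w z) q b) =ᶠ[𝓝 x]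
        fun q => G (id q) (D b w q) z + G (id q) w (D b z q) := by
      filter_upwards [h.isOpen.mem_nhds hx] with q hq
      exact h.fderiv_G (f := id) hq differentiableAt_id (differentiableAt_const w)
        (differentiableAt_const z) b
    have d1 : DifferentiableAt ℝ (fun q => G (id q) (D b w q) z) x :=
      ((h.smooth_G x hx).differentiableAt_infty.clm_apply (hD b w)).clm_apply
        (differentiableAt_const z)
    have d2 : DifferentiableAt ℝ (fun q => G (id q) w (D b z q)) x :=
      ((h.smooth_G x hx).differentiableAt_infty.clm_apply
        (differentiableAt_const w)).clm_apply (hD b z)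
    rw [e1, hev.fderiv_eq, fderiv_fun_add d1 d2, add_apply,
      h.fderiv_G (f := id) hx differentiableAt_id (hD b w) (differentiableAt_const z),
      h.fderiv_G (f := id) hx differentiableAt_id (differentiableAt_const w) (hD b z)]
    rfl
  have h3 := fderiv_fderiv_comm hφ u v
  rw [e, e] at h3
  have h4 := congrArg (fun X => G x X z) h1
  have h5 := congrArg (fun X => G x w X) h2
  simp only [map_sub, sub_apply, fderiv_id, ContinuousLinearMap.id_apply, id] at h4 h5
  change G x (covAlong (leviCivita G) id (D v w) x u) z -
    G x (covAlong (leviCivita G) id (D u w) x v) z = _ at h4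
  change G x w (covAlong (leviCivita G) id (D v z) x u) -
    G x w (covAlong (leviCivita G) id (D u z) x v) = _ at h5
  rw [← h4, h.symm hx _ w, ← h5]
  linarith

/-- The curvature tensor of an almost contact B-metric manifold with parallel structure tensors. -/
theorem isKaehlerLike (h : IsLocalBMetric V G Φ Ξ) {x : F} (hx : x ∈ V) :
    IsKaehlerLike (Φ x) (Ξ x) fun u v w z => G x (curvature (leviCivita G) x u v w) z where
  add_left u u' v w z := by simp [curvature_add]
  add_mid u v w w' z := by
    rw [← add_apply, ← map_add]
    congr 2
    simp only [curvature, map_add]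
    abel
  swap_left u v w z := by rw [curvature_swap, map_neg]; rfl
  swap_right u v w z := h.curvature_skew hx u v w z
  bianchi u v w z := by
    rw [← add_apply, ← map_add, ← add_apply, ← map_add,
      curvature_bianchi h.isOpen (fun _ hz => h.Γ_symm hz) hx
        (h.smooth_Γ hx).differentiableAt_infty]
    simp
  map_φ u v w z := by rw [h.curvature_Φ hx, h.Φ_symm hx]
  map_ξ u v w a := by
    have : curvature (leviCivita G) x u v (a • Ξ x) = a • curvature (leviCivita G) x u v (Ξ x) := by
      simp only [curvature, map_smul]
      module
    rw [this, h.curvature_Ξ hx]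
    simp

/-- Constant totally real sectional curvatures at a point determine the curvature tensor. -/
theorem curvature_eq (h : IsLocalBMetric V G Φ Ξ) {x : F} (hx : x ∈ V) {ν ν' : ℝ}
    (hν : ∀ u v, G x u u * G x v v - G x u v ^ 2 ≠ 0 → G x (Φ x u) u = 0 → G x (Φ x u) v = 0 →
      G x (Φ x v) v = 0 → G x (Ξ x) u = 0 → G x (Ξ x) v = 0 →
      G x (curvature (leviCivita G) x u v v) u = ν * (G x u u * G x v v - G x u v ^ 2) ∧
        G x (curvature (leviCivita G) x u v v) (Φ x u) = ν' * (G x u u * G x v v - G x u v ^ 2))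
    (u v w z : F) :
    G x (curvature (leviCivita G) x u v w) z =
      modelCurvature (toBilin (G x)) (Φ x : F →ₗ[ℝ] F) (Ξ x) ν ν' u v w z :=
  (h.isKaehlerLike hx).eq_modelCurvature (h.algebra x hx)
    (fun a u v w z => by rw [curvature_smul, map_smul]; rfl) hν u v w z

/-- The associated metric is built from parallel tensors and is nondegenerate, so the torsion-free
connection of `G` is also its Levi-Civita connection. -/
theorem leviCivita_assoc (h : IsLocalBMetric V G Φ Ξ) {x : F} (hx : x ∈ V)
    (hGt : ∀ x ∈ V, ∀ v w, Gt x v w = G x v (Φ x w) + G x (Ξ x) v * G x (Ξ x) w)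
    (hd : DifferentiableAt ℝ Gt x) : leviCivita Gt x = leviCivita G x := by
  refine leviCivita_eq (fun v w => ?_) (fun v hv => ?_) (h.Γ_symm hx) fun u v w => ?_
  · rw [hGt x hx, hGt x hx, ← h.Φ_symm hx, h.symm hx, mul_comm]
  · have h0 : G x (Ξ x) v = 0 := by
      have := hv (Ξ x)
      rwa [hGt x hx, h.Φ_Ξ hx, map_zero, zero_add, h.Ξ_Ξ hx, mul_one] at this
    have h1 : Φ x v = 0 := h.nondeg hx _ fun w => by
      have := hv w
      rwa [hGt x hx, h0, zero_mul, add_zero, ← h.Φ_symm hx] at this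
    have h2 := h.Φ_Φ hx v
    rw [h1, map_zero, h0, zero_smul, add_zero] at h2
    exact neg_eq_zero.1 h2.symm
  · have e1 : fderiv ℝ Gt x u v w = fderiv ℝ (fun p => Gt p v w) x u := by
      rw [((hd.hasFDerivAt.clm_apply (hasFDerivAt_const v x)).clm_apply
        (hasFDerivAt_const w x)).fderiv]
      simp
    have hev : (fun p => Gt p v w) =ᶠ[𝓝 x] fun p => G (id p) v (Φ (id p) w) +
        G (id p) (Ξ (id p)) v * G (id p) (Ξ (id p)) w := by
      filter_upwards [h.isOpen.mem_nhds hx] with p hp using hGt p hp v w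
    have dG := (h.smooth_G x hx).differentiableAt_infty
    have dΦ := (h.smooth_Φ x hx).differentiableAt_infty
    have dΞ := (h.smooth_Ξ x hx).differentiableAt_infty
    have dc : ∀ a : F, DifferentiableAt ℝ (fun _ : F => a) x := fun a => differentiableAt_const a
    have d1 : DifferentiableAt ℝ (fun p => G (id p) v (Φ (id p) w)) x :=
      (dG.clm_apply (dc v)).clm_apply (dΦ.clm_apply (dc w))
    have d2 : ∀ a, DifferentiableAt ℝ (fun p => G (id p) (Ξ (id p)) a) x := fun a =>
      (dG.clm_apply dΞ).clm_apply (dc a)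
    have hc : ∀ a, covAlong (leviCivita G) id (fun _ => a) x u = leviCivita G x u a := fun a => by
      simp [covAlong]
    rw [e1, hev.fderiv_eq, fderiv_fun_add d1 ((d2 v).fun_mul (d2 w)), add_apply,
      fderiv_fun_mul (d2 v) (d2 w), add_apply, smul_apply, smul_apply,
      h.fderiv_G (f := id) (W' := fun p => Φ (id p) w) hx differentiableAt_id (dc v)
        (dΦ.clm_apply (dc w)),
      h.fderiv_G (f := id) (W := fun p => Ξ (id p)) hx differentiableAt_id dΞ (dc v),
      h.fderiv_G (f := id) (W := fun p => Ξ (id p)) hx differentiableAt_id dΞ (dc w),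
      h.covAlong_Φ (f := id) hx differentiableAt_id (dc w),
      h.covAlong_Ξ (f := id) hx differentiableAt_id, hc, hc, hGt x hx, hGt x hx]
    simp
    ring

end IsLocalBMetric

end LocalBMetric

/-- A map to bilinear maps on a finite-dimensional space is smooth if all its values are. -/
theorem contDiffAt_form {D F K : Type*} [NormedAddCommGroup D] [NormedSpace ℝ D]
    [NormedAddCommGroup F] [NormedSpace ℝ F] [FiniteDimensional ℝ F] [NormedAddCommGroup K]
    [NormedSpace ℝ K] {V : Set D} (hV : IsOpen V) {b : D → F →L[ℝ] F →L[ℝ] K}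
    (h : ∀ v w, ∀ x ∈ V, ContDiffAt ℝ ∞ (fun x => b x v w) x) {x : D} (hx : x ∈ V) :
    ContDiffAt ℝ ∞ b x := by
  have h1 : ContDiffOn ℝ ∞ b V := by
    rw [contDiffOn_clm_apply]
    intro v
    rw [contDiffOn_clm_apply]
    exact fun w x hx => (h v w x hx).contDiffWithinAt
  exact h1.contDiffAt (hV.mem_nhds hx)

/-! ### The transversal frame and the screen complex structure. -/

section LocalScreen

variable {E F : Type*} [NormedAddCommGroup E] [NormedSpace ℝ E]
  [NormedAddCommGroup F] [NormedSpace ℝ F]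

/-- A parametrised ascreen radical screen transversal half lightlike submanifold, with radical
section `df(x₀)` normalised by `η(df(x₀)) = 1`. -/
structure IsLocalScreen (V : Set F) (G : F → F →L[ℝ] F →L[ℝ] ℝ) (Φ : F → F →L[ℝ] F)
    (Ξ : F → F) (U : Set E) (f : E → F) (x₀ : E → E) : Prop where
  ambient : IsLocalBMetric V G Φ Ξ
  isOpen : IsOpen U
  mapsTo : ∀ z ∈ U, f z ∈ V
  smooth_f : ∀ z ∈ U, ContDiffAt ℝ ∞ f z
  smooth_x₀ : ∀ z ∈ U, ContDiffAt ℝ ∞ x₀ z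
  injective : ∀ z ∈ U, Function.Injective (fderiv ℝ f z)
  codim : Module.finrank ℝ F = Module.finrank ℝ E + 2
  radical : ∀ z ∈ U, ∀ w, G (f z) (fderiv ℝ f z (x₀ z)) (fderiv ℝ f z w) = 0
  normal : ∀ z ∈ U, ∀ w, G (f z) (Φ (f z) (fderiv ℝ f z (x₀ z))) (fderiv ℝ f z w) = 0
  normalized : ∀ z ∈ U, G (f z) (Ξ (f z)) (fderiv ℝ f z (x₀ z)) = 1

namespace IsLocalScreen

/-- The metric induced on the parameter domain. -/
noncomputable def gM (G : F → F →L[ℝ] F →L[ℝ] ℝ) (f : E → F) (z : E) : E →L[ℝ] E →L[ℝ] ℝ :=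
  pullForm (G (f z)) (fderiv ℝ f z)

/-- The structure 1-form induced on the parameter domain. -/
noncomputable def θ (G : F → F →L[ℝ] F →L[ℝ] ℝ) (Ξ : F → F) (f : E → F) (z : E) : E →L[ℝ] ℝ :=
  (G (f z) (Ξ (f z))).comp (fderiv ℝ f z)

/-- The component of the radical section orthogonal to the structure vector field. -/
noncomputable def n (Ξ : F → F) (f : E → F) (x₀ : E → E) (z : E) : F :=
  fderiv ℝ f z (x₀ z) - Ξ (f z)

variable {V : Set F} {G : F → F →L[ℝ] F →L[ℝ] ℝ} {Φ : F → F →L[ℝ] F} {Ξ : F → F} {U : Set E}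
  {f : E → F} {x₀ : E → E}

theorem gM_apply (z v w : E) : gM G f z v w = G (f z) (fderiv ℝ f z v) (fderiv ℝ f z w) := rfl

theorem θ_apply (z v : E) : θ G Ξ f z v = G (f z) (Ξ (f z)) (fderiv ℝ f z v) := rfl

theorem n_eq (z : E) : n Ξ f x₀ z = fderiv ℝ f z (x₀ z) - Ξ (f z) := rfl

theorem fderiv_x₀ (z : E) : fderiv ℝ f z (x₀ z) = n Ξ f x₀ z + Ξ (f z) := by simp [n_eq]

section Pointwise

variable (h : IsLocalScreen V G Φ Ξ U f x₀) {z : E} (hz : z ∈ U)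

include h hz

theorem symm (v w : F) : G (f z) v w = G (f z) w v := h.ambient.symm (h.mapsTo z hz) v w

theorem Ξ_Ξ : G (f z) (Ξ (f z)) (Ξ (f z)) = 1 := h.ambient.Ξ_Ξ (h.mapsTo z hz)

theorem Ξ_n : G (f z) (Ξ (f z)) (n Ξ f x₀ z) = 0 := by
  rw [n_eq, map_sub, h.normalized z hz, h.Ξ_Ξ hz, sub_self]

theorem n_f (w : E) : G (f z) (n Ξ f x₀ z) (fderiv ℝ f z w) = -θ G Ξ f z w := by
  rw [n_eq, map_sub, sub_apply, h.radical z hz, zero_sub, θ_apply]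

theorem n_n : G (f z) (n Ξ f x₀ z) (n Ξ f x₀ z) = -1 := by
  nth_rw 2 [n_eq]
  rw [map_sub, h.n_f hz, h.symm hz _ (Ξ _), h.Ξ_n hz, θ_apply, h.normalized z hz, sub_zero]

theorem Φn_eq : Φ (f z) (n Ξ f x₀ z) = Φ (f z) (fderiv ℝ f z (x₀ z)) := by
  rw [n_eq, map_sub, h.ambient.Φ_Ξ (h.mapsTo z hz), sub_zero]

theorem Φn_f (w : E) : G (f z) (Φ (f z) (n Ξ f x₀ z)) (fderiv ℝ f z w) = 0 := by
  rw [h.Φn_eq hz, h.normal z hz]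

theorem Ξ_Φ (v : F) : G (f z) (Ξ (f z)) (Φ (f z) v) = 0 := h.ambient.Ξ_Φ (h.mapsTo z hz) v

theorem Φ_symm (v w : F) : G (f z) (Φ (f z) v) w = G (f z) v (Φ (f z) w) :=
  h.ambient.Φ_symm (h.mapsTo z hz) v w

theorem n_Φn : G (f z) (n Ξ f x₀ z) (Φ (f z) (n Ξ f x₀ z)) = 0 := by
  rw [← h.Φ_symm hz]
  nth_rw 2 [n_eq]
  rw [map_sub, h.Φn_f hz, h.symm hz, h.Ξ_Φ hz, sub_zero]

theorem Φn_Φn : G (f z) (Φ (f z) (n Ξ f x₀ z)) (Φ (f z) (n Ξ f x₀ z)) = 1 := by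
  rw [h.ambient.G_Φ_Φ (h.mapsTo z hz), h.n_n hz, h.Ξ_n hz]
  ring

theorem θ_x₀ : θ G Ξ f z (x₀ z) = 1 := h.normalized z hz

/-- Independence of the transversal frame. -/
theorem frame_eq_zero {v : E} {a b : ℝ}
    (h0 : fderiv ℝ f z v + a • Ξ (f z) + b • Φ (f z) (n Ξ f x₀ z) = 0) : v = 0 ∧ a = 0 ∧ b = 0 := by
  -- Pairing with `Φn` isolates `b`; pairing with the radical vector then isolates `a`.
  have hb : b = 0 := by
    have := congrArg (G (f z) (Φ (f z) (n Ξ f x₀ z))) h0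
    simpa [h.Φn_f hz, h.Φn_Φn hz, h.symm hz _ (Ξ (f z)), h.Ξ_Φ hz] using this
  subst hb
  have ha : a = 0 := by
    have := congrArg (fun X => G (f z) X (fderiv ℝ f z (x₀ z))) h0
    simp only [zero_smul, add_zero, map_add, map_smul, add_apply, smul_apply, map_zero, zero_apply,
      h.normalized z hz, h.symm hz _ (fderiv ℝ f z (x₀ z)), h.radical z hz] at this
    simpa using this
  subst ha
  refine ⟨h.injective z hz ?_, rfl, rfl⟩
  simpa using h0

theorem exists_frame [FiniteDimensional ℝ E] [FiniteDimensional ℝ F] (X : F) :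
    ∃ (v : E) (a b : ℝ), X = fderiv ℝ f z v + a • Ξ (f z) + b • Φ (f z) (n Ξ f x₀ z) := by
  let A : E × ℝ × ℝ →ₗ[ℝ] F := (fderiv ℝ f z : E →ₗ[ℝ] F).coprod
    ((LinearMap.toSpanSingleton ℝ F (Ξ (f z))).coprod
      (LinearMap.toSpanSingleton ℝ F (Φ (f z) (n Ξ f x₀ z))))
  have hA : ∀ v a b, A (v, a, b) =
      fderiv ℝ f z v + a • Ξ (f z) + b • Φ (f z) (n Ξ f x₀ z) := by
    intro v a b
    simp [A, LinearMap.coprod_apply, add_assoc]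
  have hinj : Function.Injective A := by
    rw [injective_iff_map_eq_zero]
    rintro ⟨v, a, b⟩ h0
    rw [hA] at h0
    obtain ⟨rfl, rfl, rfl⟩ := h.frame_eq_zero hz h0
    rfl
  have hdim : Module.finrank ℝ (E × ℝ × ℝ) = Module.finrank ℝ F := by
    rw [h.codim]; simp
  obtain ⟨⟨v, a, b⟩, hv⟩ := (LinearMap.injective_iff_surjective_of_finrank_eq_finrank hdim).1 hinj X
  exact ⟨v, a, b, by rw [← hv, hA]⟩

theorem eq_zero_of_orth [FiniteDimensional ℝ E] [FiniteDimensional ℝ F] {X : F}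
    (h1 : ∀ w, G (f z) X (fderiv ℝ f z w) = 0) (h2 : G (f z) X (Ξ (f z)) = 0)
    (h3 : G (f z) X (Φ (f z) (n Ξ f x₀ z)) = 0) : X = 0 := by
  refine h.ambient.nondeg (h.mapsTo z hz) X fun Y => ?_
  obtain ⟨v, a, b, rfl⟩ := h.exists_frame hz Y
  simp [h1, h2, h3]

/-- The image under `Φ` of a screen vector is orthogonal to `Φn` and to the radical, so its two
transversal coefficients vanish and it is tangent. -/
theorem exists_J [FiniteDimensional ℝ E] [FiniteDimensional ℝ F] : ∃ J : E →ₗ[ℝ] E,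
    ∀ v, fderiv ℝ f z (J v) = Φ (f z) (fderiv ℝ f z v - θ G Ξ f z v • fderiv ℝ f z (x₀ z)) := by
  obtain ⟨Q, hQ⟩ := LinearMap.exists_leftInverse_of_injective (fderiv ℝ f z : E →ₗ[ℝ] F)
    (LinearMap.ker_eq_bot.2 (h.injective z hz))
  let B : E →ₗ[ℝ] F := (Φ (f z) : F →ₗ[ℝ] F).comp ((fderiv ℝ f z : E →ₗ[ℝ] F) -
    (θ G Ξ f z : E →ₗ[ℝ] ℝ).smulRight (fderiv ℝ f z (x₀ z)))
  have hB : ∀ v, B v = Φ (f z) (fderiv ℝ f z v - θ G Ξ f z v • fderiv ℝ f z (x₀ z)) :=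
    fun v => rfl
  refine ⟨Q.comp B, fun v => ?_⟩
  rw [← hB]
  have key : B v ∈ LinearMap.range (fderiv ℝ f z : E →ₗ[ℝ] F) := by
    obtain ⟨v', a, b, e⟩ := h.exists_frame hz (B v)
    have e1 : G (f z) (B v) (Φ (f z) (n Ξ f x₀ z)) = 0 := by
      rw [hB, h.ambient.G_Φ_Φ (h.mapsTo z hz), h.Ξ_n hz, h.symm hz, map_sub, map_smul, h.n_f hz,
        h.n_f hz, h.θ_x₀ hz]
      simp
    have e2 : G (f z) (B v) (fderiv ℝ f z (x₀ z)) = 0 := by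
      rw [hB, h.Φ_symm hz, h.symm hz, map_sub, map_smul, h.normal z hz, h.normal z hz]
      simp
    have hb : b = 0 := by
      rw [e, h.symm hz] at e1
      simpa [h.Φn_Φn hz, h.Φn_f hz, h.symm hz _ (Ξ (f z)), h.Ξ_Φ hz] using e1
    have ha : a = 0 := by
      rw [e, hb, h.symm hz] at e2
      simpa [h.symm hz _ (Ξ (f z)), h.normalized z hz, h.radical z hz] using e2
    rw [e, ha, hb]
    exact ⟨v', by simp⟩
  obtain ⟨v', hv'⟩ := key
  have := LinearMap.congr_fun hQ v'
  simp only [LinearMap.comp_apply, LinearMap.id_apply] at this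
  rw [LinearMap.comp_apply, ← hv', this]
  rfl

theorem ω_eq {J : E →ₗ[ℝ] E}
    (hJ : ∀ v, fderiv ℝ f z (J v) =
      Φ (f z) (fderiv ℝ f z v - θ G Ξ f z v • fderiv ℝ f z (x₀ z))) (v w : E) :
    G (f z) (Φ (f z) (fderiv ℝ f z v)) (fderiv ℝ f z w) = gM G f z (J v) w := by
  rw [gM_apply, hJ, map_sub, map_sub, map_smul, map_smul, sub_apply, smul_apply, h.normal z hz]
  simp

theorem isScreenAlgebra [FiniteDimensional ℝ E] [FiniteDimensional ℝ F] {J : E →ₗ[ℝ] E}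
    (hJ : ∀ v, fderiv ℝ f z (J v) =
      Φ (f z) (fderiv ℝ f z v - θ G Ξ f z v • fderiv ℝ f z (x₀ z))) :
    IsScreenAlgebra (gM G f z) (θ G Ξ f z) (x₀ z) J := by
  have hθJ : ∀ v, θ G Ξ f z (J v) = 0 := fun v => by rw [θ_apply, hJ, h.Ξ_Φ hz]
  refine ⟨fun v w => h.symm hz _ _, h.radical z hz, h.θ_x₀ hz, ?_, hθJ, fun v => ?_, fun v w => ?_,
    fun v hv => ?_⟩
  · apply h.injective z hz
    rw [hJ, h.θ_x₀ hz]
    simp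
  · apply h.injective z hz
    rw [hJ, hθJ, zero_smul, sub_zero, hJ, h.ambient.Φ_Φ (h.mapsTo z hz)]
    simp [← θ_apply, h.θ_x₀ hz]
  · rw [gM_apply z v, h.symm hz, ← gM_apply, ← h.ω_eq hz hJ, ← h.ω_eq hz hJ, h.Φ_symm hz,
      h.symm hz]
  · rw [← sub_eq_zero]
    apply h.injective z hz
    rw [map_zero, map_sub, map_smul]
    refine h.eq_zero_of_orth hz (fun w => ?_) ?_ ?_
    · rw [map_sub, map_smul, sub_apply, smul_apply, h.radical z hz, ← gM_apply, hv]
      simp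
    · rw [h.symm hz, map_sub, map_smul, h.normalized z hz, θ_apply]
      simp
    · rw [h.symm hz, map_sub, map_smul, h.Φn_f hz, h.Φn_f hz]
      simp

theorem Φ_f_eq {J : E →ₗ[ℝ] E}
    (hJ : ∀ v, fderiv ℝ f z (J v) =
      Φ (f z) (fderiv ℝ f z v - θ G Ξ f z v • fderiv ℝ f z (x₀ z))) (v : E) :
    Φ (f z) (fderiv ℝ f z v) = fderiv ℝ f z (J v) + θ G Ξ f z v • Φ (f z) (n Ξ f x₀ z) := by
  rw [hJ, map_sub, map_smul, h.Φn_eq hz]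
  abel

end Pointwise

end IsLocalScreen

end LocalScreen

/-! ### Gauss formulas for a totally umbilical screen. -/

section LocalGauss

variable {E F : Type*} [NormedAddCommGroup E] [NormedSpace ℝ E]
  [NormedAddCommGroup F] [NormedSpace ℝ F]

/-- The curvature of a connection induced on a submanifold, for transversal fields with tangent
covariant derivatives. -/
theorem curvature_gauss {Γ : F → F →L[ℝ] F →L[ℝ] F} {ΓM : E → E →L[ℝ] E →L[ℝ] E} {f : E → F}
    {n₁ n₂ : E → F} {β₁ β₂ : E → E → E → ℝ} {U : Set E} (hU : IsOpen U) {z : E} (hz : z ∈ U)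
    (hf : ContDiffAt ℝ ∞ f z) (hΓ : ContDiffAt ℝ ∞ Γ (f z)) (hΓM : DifferentiableAt ℝ ΓM z)
    (h₁ : DifferentiableAt ℝ n₁ z) (h₂ : DifferentiableAt ℝ n₂ z)
    (hβ₁ : ∀ v w, DifferentiableAt ℝ (fun z => β₁ z v w) z)
    (hβ₂ : ∀ v w, DifferentiableAt ℝ (fun z => β₂ z v w) z)
    (hgauss : ∀ z ∈ U, ∀ v w, covAlong Γ f (fun z => fderiv ℝ f z w) z v =
      fderiv ℝ f z (ΓM z v w) + β₁ z v w • n₁ z + β₂ z v w • n₂ z)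
    {A₁ A₂ : E → E} (hA₁ : ∀ u, covAlong Γ f n₁ z u = fderiv ℝ f z (A₁ u))
    (hA₂ : ∀ u, covAlong Γ f n₂ z u = fderiv ℝ f z (A₂ u)) (u v w : E) :
    ∃ p q : ℝ, curvature Γ (f z) (fderiv ℝ f z u) (fderiv ℝ f z v) (fderiv ℝ f z w) =
      fderiv ℝ f z (curvature ΓM z u v w + β₁ z v w • A₁ u + β₂ z v w • A₂ u
        - β₁ z u w • A₁ v - β₂ z u w • A₂ v) + p • n₁ z + q • n₂ z := by
  have key : ∀ u v, ∃ p q : ℝ,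
      covAlong Γ f (fun z => covAlong Γ f (fun z => fderiv ℝ f z w) z v) z u =
        fderiv ℝ f z (fderiv ℝ ΓM z u v w + ΓM z u (ΓM z v w) + β₁ z v w • A₁ u
          + β₂ z v w • A₂ u) + p • n₁ z + q • n₂ z := by
    intro u v
    have hX : HasFDerivAt (fun z => ΓM z v w) _ z :=
      (hΓM.hasFDerivAt.clm_apply (hasFDerivAt_const v z)).clm_apply (hasFDerivAt_const w z)
    have hXd : fderiv ℝ (fun z => ΓM z v w) z u = fderiv ℝ ΓM z u v w := by
      rw [hX.fderiv]; simp
    have hev : (fun z => covAlong Γ f (fun z => fderiv ℝ f z w) z v) =ᶠ[𝓝 z] fun z =>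
        fderiv ℝ f z (ΓM z v w) + β₁ z v w • n₁ z + β₂ z v w • n₂ z := by
      filter_upwards [hU.mem_nhds hz] with z' hz' using hgauss z' hz' v w
    have d0 : DifferentiableAt ℝ (fun z => fderiv ℝ f z (ΓM z v w)) z :=
      hf.fderiv_infty.differentiableAt_infty.clm_apply hX.differentiableAt
    have d1 := (hβ₁ v w).fun_smul h₁
    have d2 := (hβ₂ v w).fun_smul h₂
    rw [covAlong_congr hev, covAlong_add (d0.fun_add d1) d2, covAlong_add d0 d1,
      covAlong_smul (hβ₁ v w) h₁, covAlong_smul (hβ₂ v w) h₂, hA₁, hA₂,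
      covAlong_fderiv_apply hf hX.differentiableAt, hgauss z hz, hXd]
    refine ⟨β₁ z u (ΓM z v w) + fderiv ℝ (fun z => β₁ z v w) z u,
      β₂ z u (ΓM z v w) + fderiv ℝ (fun z => β₂ z v w) z u, ?_⟩
    simp only [map_add, map_smul]
    module
  obtain ⟨p, q, e1⟩ := key u v
  obtain ⟨p', q', e2⟩ := key v u
  have hW : ContDiffAt ℝ ∞ (fun z => fderiv ℝ f z w) z :=
    hf.fderiv_infty.clm_apply contDiffAt_const
  rw [← covAlong_commutator hΓ hf hW u v, e1, e2]
  refine ⟨p - p', q - q', ?_⟩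
  simp only [curvature, map_add, map_sub, map_smul]
  module

namespace IsLocalScreen

variable {V : Set F} {G : F → F →L[ℝ] F →L[ℝ] ℝ} {Φ : F → F →L[ℝ] F} {Ξ : F → F} {U : Set E}
  {f : E → F} {x₀ : E → E}

section Smooth

variable (h : IsLocalScreen V G Φ Ξ U f x₀) {z : E} (hz : z ∈ U)

include h hz

theorem smooth_Gf : ContDiffAt ℝ ∞ (fun z => G (f z)) z :=
  (h.ambient.smooth_G _ (h.mapsTo z hz)).comp z (h.smooth_f z hz)

theorem smooth_Φf : ContDiffAt ℝ ∞ (fun z => Φ (f z)) z :=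
  (h.ambient.smooth_Φ _ (h.mapsTo z hz)).comp z (h.smooth_f z hz)

theorem smooth_Ξf : ContDiffAt ℝ ∞ (fun z => Ξ (f z)) z :=
  (h.ambient.smooth_Ξ _ (h.mapsTo z hz)).comp z (h.smooth_f z hz)

theorem smooth_Df (w : E) : ContDiffAt ℝ ∞ (fun z => fderiv ℝ f z w) z :=
  (h.smooth_f z hz).fderiv_infty.clm_apply contDiffAt_const

theorem smooth_n : ContDiffAt ℝ ∞ (n Ξ f x₀) z :=
  ((h.smooth_f z hz).fderiv_infty.clm_apply (h.smooth_x₀ z hz)).sub (h.smooth_Ξf hz)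

theorem smooth_Φn : ContDiffAt ℝ ∞ (fun z => Φ (f z) (n Ξ f x₀ z)) z :=
  (h.smooth_Φf hz).clm_apply (h.smooth_n hz)

theorem smooth_θ (w : E) : ContDiffAt ℝ ∞ (fun z => θ G Ξ f z w) z :=
  ((h.smooth_Gf hz).clm_apply (h.smooth_Ξf hz)).clm_apply (h.smooth_Df hz w)

theorem smooth_gM (v w : E) : ContDiffAt ℝ ∞ (fun z => gM G f z v w) z :=
  ((h.smooth_Gf hz).clm_apply (h.smooth_Df hz v)).clm_apply (h.smooth_Df hz w)

theorem smooth_ω (v w : E) :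
    ContDiffAt ℝ ∞ (fun z => G (f z) (Φ (f z) (fderiv ℝ f z v)) (fderiv ℝ f z w)) z :=
  ((h.smooth_Gf hz).clm_apply ((h.smooth_Φf hz).clm_apply (h.smooth_Df hz v))).clm_apply
    (h.smooth_Df hz w)

variable [FiniteDimensional ℝ F]

/-- The product rule for a constant product. -/
theorem product_rule {W W' : E → F} (hW : DifferentiableAt ℝ W z) (hW' : DifferentiableAt ℝ W' z)
    {k : ℝ} (hk : ∀ z ∈ U, G (f z) (W z) (W' z) = k) (v : E) :
    G (f z) (covAlong (leviCivita G) f W z v) (W' z) +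
      G (f z) (W z) (covAlong (leviCivita G) f W' z v) = 0 := by
  rw [← h.ambient.fderiv_G (h.mapsTo z hz) (h.smooth_f z hz).differentiableAt_infty hW hW' v]
  have hev : (fun z => G (f z) (W z) (W' z)) =ᶠ[𝓝 z] fun _ => k := by
    filter_upwards [h.isOpen.mem_nhds hz] with z' hz' using hk z' hz'
  rw [hev.fderiv_eq]
  simp

theorem covAlong_Ξf (v : E) : covAlong (leviCivita G) f (fun z => Ξ (f z)) z v = 0 :=
  h.ambient.covAlong_Ξ (h.mapsTo z hz) (h.smooth_f z hz).differentiableAt_infty v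

theorem covAlong_Φn (v : E) : covAlong (leviCivita G) f (fun z => Φ (f z) (n Ξ f x₀ z)) z v =
    Φ (f z) (covAlong (leviCivita G) f (n Ξ f x₀) z v) :=
  h.ambient.covAlong_Φ (h.mapsTo z hz) (h.smooth_f z hz).differentiableAt_infty
    (h.smooth_n hz).differentiableAt_infty v

theorem covAlong_fderiv_x₀ (v : E) :
    covAlong (leviCivita G) f (fun z => fderiv ℝ f z (x₀ z)) z v =
      covAlong (leviCivita G) f (n Ξ f x₀) z v := by
  have e : (fun z => fderiv ℝ f z (x₀ z)) = fun z => n Ξ f x₀ z + Ξ (f z) := by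
    funext z; exact fderiv_x₀ z
  rw [e, covAlong_add (h.smooth_n hz).differentiableAt_infty
    (h.smooth_Ξf hz).differentiableAt_infty, h.covAlong_Ξf hz, add_zero]

end Smooth

end IsLocalScreen

/-- The induced connection `ΓM` of a screen totally umbilical submanifold, with umbilicity
function `c / 2`. -/
structure IsUmbilicConnection (G : F → F →L[ℝ] F →L[ℝ] ℝ) (Φ : F → F →L[ℝ] F)
    (Ξ : F → F) (U : Set E) (f : E → F) (x₀ : E → E) (ΓM : E → E →L[ℝ] E →L[ℝ] E) (c : E → ℝ) :
    Prop where
  smooth_ΓM : ∀ z ∈ U, ContDiffAt ℝ ∞ ΓM z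
  smooth_c : ∀ z ∈ U, ContDiffAt ℝ ∞ c z
  gauss : ∀ z ∈ U, ∀ v w, ∃ a b : ℝ, covAlong (leviCivita G) f (fun z => fderiv ℝ f z w) z v =
    fderiv ℝ f z (ΓM z v w) + a • (Ξ (f z) - IsLocalScreen.n Ξ f x₀ z)
      + b • Φ (f z) (IsLocalScreen.n Ξ f x₀ z)
  umbilic : ∀ z ∈ U, ∀ v w, G (f z) (Ξ (f z) - IsLocalScreen.n Ξ f x₀ z) (fderiv ℝ f z
    (fderiv ℝ (fun z' => w - IsLocalScreen.θ G Ξ f z' w • x₀ z') z v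
      + ΓM z v (w - IsLocalScreen.θ G Ξ f z w • x₀ z))) = c z * IsLocalScreen.gM G f z v w

namespace IsLocalScreen

variable [FiniteDimensional ℝ E] [FiniteDimensional ℝ F]
  {V : Set F} {G : F → F →L[ℝ] F →L[ℝ] ℝ} {Φ : F → F →L[ℝ] F} {Ξ : F → F} {U : Set E}
  {f : E → F} {x₀ : E → E} {ΓM : E → E →L[ℝ] E →L[ℝ] E} {c : E → ℝ}

section Umbilic

variable (h : IsLocalScreen V G Φ Ξ U f x₀) (hc : IsUmbilicConnection G Φ Ξ U f x₀ ΓM c) {z : E}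
  (hz : z ∈ U)

include h hc hz

/-- The derivative of `n` is orthogonal to `Ξ`, `n` and `Φn`: `Ξ` is parallel, `n` has constant
square, and `Φ` is parallel and selfadjoint. What remains is its pairing with the screen, which
umbilicity prescribes. -/
theorem covAlong_n (v : E) : covAlong (leviCivita G) f (n Ξ f x₀) z v =
    c z • fderiv ℝ f z (v - θ G Ξ f z v • x₀ z) := by
  have dn := (h.smooth_n hz).differentiableAt_infty
  have dΞ := (h.smooth_Ξf hz).differentiableAt_infty
  have dΦn := (h.smooth_Φn hz).differentiableAt_infty
  have cΞ := h.covAlong_Ξf hz v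
  have k1 : G (f z) (covAlong (leviCivita G) f (n Ξ f x₀) z v) (Ξ (f z)) = 0 := by
    have := h.product_rule hz dn dΞ (k := 0) (fun z hz => by rw [h.symm hz, h.Ξ_n hz]) v
    rwa [cΞ, map_zero, add_zero] at this
  have k2 : G (f z) (covAlong (leviCivita G) f (n Ξ f x₀) z v) (n Ξ f x₀ z) = 0 := by
    have := h.product_rule hz dn dn (k := -1) (fun z hz => h.n_n hz) v
    rw [h.symm hz (n Ξ f x₀ z)] at this
    linarith
  have k3 : G (f z) (covAlong (leviCivita G) f (n Ξ f x₀) z v) (Φ (f z) (n Ξ f x₀ z)) = 0 := by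
    have := h.product_rule hz dn dΦn (k := 0) (fun z hz => h.n_Φn hz) v
    rw [h.covAlong_Φn hz, ← h.Φ_symm hz (n Ξ f x₀ z), h.symm hz (Φ (f z) (n Ξ f x₀ z))] at this
    linarith
  have k4 : ∀ w, G (f z) (covAlong (leviCivita G) f (n Ξ f x₀) z v)
      (fderiv ℝ f z (w - θ G Ξ f z w • x₀ z)) = c z * gM G f z v w := by
    intro w
    have hX : DifferentiableAt ℝ (fun z' => w - θ G Ξ f z' w • x₀ z') z :=
      (differentiableAt_const w).fun_sub ((h.smooth_θ hz w).differentiableAt_infty.fun_smul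
        (h.smooth_x₀ z hz).differentiableAt_infty)
    have dZ : DifferentiableAt ℝ (fun z' => fderiv ℝ f z' (w - θ G Ξ f z' w • x₀ z')) z :=
      (h.smooth_f z hz).fderiv_infty.differentiableAt_infty.clm_apply hX
    have r1 := h.product_rule hz dn dZ (k := 0) (fun z hz => by
      rw [h.n_f hz, map_sub, map_smul, h.θ_x₀ hz]; simp) v
    have r2 := h.product_rule hz dΞ dZ (k := 0) (fun z hz => by
      rw [← θ_apply, map_sub, map_smul, h.θ_x₀ hz]; simp) v
    rw [cΞ, map_zero, zero_apply, zero_add] at r2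
    obtain ⟨a, b, hab⟩ := hc.gauss z hz v (w - θ G Ξ f z w • x₀ z)
    have r3 : covAlong (leviCivita G) f (fun z' => fderiv ℝ f z' (w - θ G Ξ f z' w • x₀ z')) z v =
        fderiv ℝ f z (fderiv ℝ (fun z' => w - θ G Ξ f z' w • x₀ z') z v
          + ΓM z v (w - θ G Ξ f z w • x₀ z)) + a • (Ξ (f z) - n Ξ f x₀ z)
          + b • Φ (f z) (n Ξ f x₀ z) := by
      rw [covAlong_fderiv_apply (h.smooth_f z hz) hX, hab, map_add]
      abel
    generalize covAlong (leviCivita G) f (fun z' => fderiv ℝ f z' (w - θ G Ξ f z' w • x₀ z')) z v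
      = Y at r1 r2 r3
    -- The null vector `Ξ - n` is orthogonal to itself and to `Φn`, so the transversal terms drop
    -- out and only the umbilicity term survives.
    have r4 := congrArg (G (f z) (Ξ (f z) - n Ξ f x₀ z)) r3
    rw [map_add, map_add, hc.umbilic z hz] at r4
    simp only [map_sub, map_smul, sub_apply, h.Ξ_Ξ hz, h.Ξ_n hz, h.symm hz _ (Ξ (f z)), h.n_n hz,
      h.Ξ_Φ hz, h.n_Φn hz, smul_eq_mul] at r4
    linarith
  have k5 : ∀ w, G (f z) (fderiv ℝ f z (v - θ G Ξ f z v • x₀ z)) (fderiv ℝ f z w) =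
      gM G f z v w := by
    intro w
    rw [map_sub, map_smul, map_sub, map_smul, sub_apply, smul_apply, h.radical z hz]
    simp [gM_apply]
  rw [← sub_eq_zero]
  refine h.eq_zero_of_orth hz (fun w => ?_) ?_ ?_
  · have e : fderiv ℝ f z w = fderiv ℝ f z (w - θ G Ξ f z w • x₀ z) +
        θ G Ξ f z w • (n Ξ f x₀ z + Ξ (f z)) := by
      rw [← fderiv_x₀, map_sub, map_smul]; abel
    rw [map_sub, map_smul, sub_apply, smul_apply, k5]
    rw [e, map_add, map_smul, map_add, k1, k2, k4]
    simp
  · rw [map_sub, map_smul, sub_apply, smul_apply, k1, h.symm hz, ← θ_apply, map_sub, map_smul,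
      h.θ_x₀ hz]
    simp
  · rw [map_sub, map_smul, sub_apply, smul_apply, k3, h.symm hz, h.Φn_f hz]
    simp

/-- The Gauss formula. -/
theorem gauss_formula (v w : E) : covAlong (leviCivita G) f (fun z => fderiv ℝ f z w) z v =
    fderiv ℝ f z (ΓM z v w) + (-(c z / 2) * gM G f z v w) • (Ξ (f z) - n Ξ f x₀ z)
      + (-(c z) * G (f z) (Φ (f z) (fderiv ℝ f z v)) (fderiv ℝ f z w)) •
        Φ (f z) (n Ξ f x₀ z) := by
  obtain ⟨a, b, hab⟩ := hc.gauss z hz v w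
  have dw := (h.smooth_Df hz w).differentiableAt_infty
  have d0 : DifferentiableAt ℝ (fun z => fderiv ℝ f z (x₀ z)) z :=
    (h.smooth_f z hz).fderiv_infty.differentiableAt_infty.clm_apply
      (h.smooth_x₀ z hz).differentiableAt_infty
  have hn := h.covAlong_n hc hz v
  have dΦn := (h.smooth_Φn hz).differentiableAt_infty
  -- Pair with the radical vector `n + Ξ`; its product with `Ξ - n` is `2`, whence the half.
  have ha : a = -(c z / 2) * gM G f z v w := by
    have r := h.product_rule hz dw d0 (k := 0)
      (fun z hz => by rw [h.symm hz, h.radical z hz]) v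
    rw [h.covAlong_fderiv_x₀ hz, hn, hab, fderiv_x₀ (Ξ := Ξ)] at r
    have e1 : G (f z) (fderiv ℝ f z (ΓM z v w)) (n Ξ f x₀ z + Ξ (f z)) = 0 := by
      rw [← fderiv_x₀, h.symm hz, h.radical z hz]
    have e2 : G (f z) (fderiv ℝ f z w) (fderiv ℝ f z (v - θ G Ξ f z v • x₀ z)) =
        gM G f z v w := by
      rw [map_sub, map_smul, map_sub, map_smul, h.symm hz, h.symm hz _ (fderiv ℝ f z (x₀ z)),
        h.radical z hz]
      simp [gM_apply]
    simp only [map_add, add_apply, map_smul, smul_apply, map_sub, sub_apply] at e1 e2 r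
    simp only [h.Ξ_Ξ hz, h.Ξ_n hz, h.n_n hz, h.symm hz _ (Ξ (f z)), h.Ξ_Φ hz,
      h.symm hz _ (n Ξ f x₀ z), h.n_Φn hz, smul_eq_mul] at r e1 e2
    simp only [h.symm hz (fderiv ℝ f z w)] at r e2
    linear_combination r / 2 - e1 / 2 - c z / 2 * e2
  -- Pair with `Φn`, whose derivative is `Φ` of the derivative of `n`.
  have hb : b = -(c z) * G (f z) (Φ (f z) (fderiv ℝ f z v)) (fderiv ℝ f z w) := by
    have r := h.product_rule hz dw dΦn (k := 0)
      (fun z hz => by rw [h.symm hz, h.Φn_f hz]) v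
    rw [h.covAlong_Φn hz, hn, hab] at r
    have e2 : G (f z) (fderiv ℝ f z w) (Φ (f z) (fderiv ℝ f z (v - θ G Ξ f z v • x₀ z))) =
        G (f z) (Φ (f z) (fderiv ℝ f z v)) (fderiv ℝ f z w) := by
      rw [h.symm hz]
      simp only [map_sub, map_smul, sub_apply, smul_apply, h.normal z hz]
      simp
    rw [map_smul, map_smul, e2] at r
    simp only [map_add, add_apply, map_smul, smul_apply, map_sub, sub_apply, h.Φn_Φn hz,
      h.Ξ_Φ hz, h.n_Φn hz, h.symm hz (fderiv ℝ f z (ΓM z v w)), h.Φn_f hz, smul_eq_mul] at r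
    linarith
  rw [hab, ha, hb]

/-- The curvature of the ambient connection on the transversal field `n`. -/
theorem curvature_n (u v : E) :
    curvature (leviCivita G) (f z) (fderiv ℝ f z u) (fderiv ℝ f z v) (n Ξ f x₀ z) =
      fderiv ℝ f z ((fderiv ℝ c z u + c z ^ 2 * θ G Ξ f z u) • (v - θ G Ξ f z v • x₀ z)
        - (fderiv ℝ c z v + c z ^ 2 * θ G Ξ f z v) • (u - θ G Ξ f z u • x₀ z)) := by
  have hΓ := h.ambient.smooth_Γ (h.mapsTo z hz)
  have hf := h.smooth_f z hz
  have dc := (hc.smooth_c z hz).differentiableAt_infty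
  have d0 : DifferentiableAt ℝ (fun z => fderiv ℝ f z (x₀ z)) z :=
    hf.fderiv_infty.differentiableAt_infty.clm_apply (h.smooth_x₀ z hz).differentiableAt_infty
  have key : ∀ u v, covAlong (leviCivita G) f
      (fun z => covAlong (leviCivita G) f (n Ξ f x₀) z v) z u =
      fderiv ℝ c z u • fderiv ℝ f z (v - θ G Ξ f z v • x₀ z) +
      c z • (covAlong (leviCivita G) f (fun z => fderiv ℝ f z v) z u -
        (G (f z) (Ξ (f z)) (covAlong (leviCivita G) f (fun z => fderiv ℝ f z v) z u) •
          fderiv ℝ f z (x₀ z) + θ G Ξ f z v • c z • fderiv ℝ f z (u - θ G Ξ f z u • x₀ z))) := by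
    intro u v
    have dv := (h.smooth_Df hz v).differentiableAt_infty
    have dθ := (h.smooth_θ hz v).differentiableAt_infty
    have hev : (fun z => covAlong (leviCivita G) f (n Ξ f x₀) z v) =ᶠ[𝓝 z] fun z =>
        c z • (fderiv ℝ f z v - θ G Ξ f z v • fderiv ℝ f z (x₀ z)) := by
      filter_upwards [h.isOpen.mem_nhds hz] with z' hz'
      rw [h.covAlong_n hc hz', map_sub, map_smul]
    have hθ : fderiv ℝ (fun z => θ G Ξ f z v) z u =
        G (f z) (Ξ (f z)) (covAlong (leviCivita G) f (fun z => fderiv ℝ f z v) z u) := by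
      have := h.ambient.fderiv_G (W := fun z => Ξ (f z)) (h.mapsTo z hz) hf.differentiableAt_infty
        (h.smooth_Ξf hz).differentiableAt_infty dv u
      rw [h.covAlong_Ξf hz, map_zero, zero_apply, zero_add] at this
      exact this
    rw [covAlong_congr hev, covAlong_smul dc (dv.fun_sub (dθ.fun_smul d0)),
      covAlong_sub dv (dθ.fun_smul d0), covAlong_smul dθ d0, h.covAlong_fderiv_x₀ hz,
      h.covAlong_n hc hz, hθ]
    simp only [map_sub, map_smul]
  -- The second-order terms are symmetric in `u` and `v` because torsion vanishes, so they cancel in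
  -- the commutator.
  rw [← covAlong_commutator hΓ hf (h.smooth_n hz) u v, key, key,
    covAlong_fderiv_comm hf (h.ambient.Γ_symm (h.mapsTo z hz)) u v]
  simp only [map_sub, map_smul]
  module

end Umbilic

end IsLocalScreen

end LocalGauss

/-! ### Codazzi equation and the two curvature tensors of the submanifold. -/

section LocalCurvature

variable {E F : Type*} [NormedAddCommGroup E] [NormedSpace ℝ E]
  [NormedAddCommGroup F] [NormedSpace ℝ F] [FiniteDimensional ℝ E] [FiniteDimensional ℝ F]

namespace IsLocalScreen

variable {V : Set F} {G : F → F →L[ℝ] F →L[ℝ] ℝ} {Φ : F → F →L[ℝ] F} {Ξ : F → F} {U : Set E}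
  {f : E → F} {x₀ : E → E} {ΓM : E → E →L[ℝ] E →L[ℝ] E} {c : E → ℝ}

section

variable (h : IsLocalScreen V G Φ Ξ U f x₀) (hc : IsUmbilicConnection G Φ Ξ U f x₀ ΓM c) {z : E}
  (hz : z ∈ U)

include h hz

omit [FiniteDimensional ℝ E] [FiniteDimensional ℝ F] in
theorem modelCurvature_n (ν ν' : ℝ) (u v w : E) :
    modelCurvature (toBilin (G (f z))) (Φ (f z) : F →ₗ[ℝ] F) (Ξ (f z)) ν ν' (fderiv ℝ f z u)
      (fderiv ℝ f z v) (n Ξ f x₀ z) (fderiv ℝ f z w) =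
    ν * (θ G Ξ f z u * gM G f z v w - θ G Ξ f z v * gM G f z u w) -
      ν' * (θ G Ξ f z u * G (f z) (Φ (f z) (fderiv ℝ f z v)) (fderiv ℝ f z w) -
        θ G Ξ f z v * G (f z) (Φ (f z) (fderiv ℝ f z u)) (fderiv ℝ f z w)) := by
  have e1 : ∀ v, G (f z) (fderiv ℝ f z v) (n Ξ f x₀ z) = -θ G Ξ f z v := fun v => by
    rw [h.symm hz, h.n_f hz]
  have e2 : ∀ v, G (f z) (Φ (f z) (fderiv ℝ f z v)) (n Ξ f x₀ z) = 0 := fun v => by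
    rw [h.Φ_symm hz, h.symm hz, h.Φn_f hz]
  simp only [modelCurvature, toBilin_apply, ContinuousLinearMap.coe_coe, e1, e2, h.Ξ_n hz,
    ← θ_apply, ← gM_apply]
  ring

include hc

/-- The Codazzi equation determines the derivative of the umbilicity function. -/
theorem fderiv_umbilic {ν ν' : ℝ} (hdim : 2 ≤ Module.finrank ℝ E)
    (hcurv : ∀ X Y Z W, G (f z) (curvature (leviCivita G) (f z) X Y Z) W =
      modelCurvature (toBilin (G (f z))) (Φ (f z) : F →ₗ[ℝ] F) (Ξ (f z)) ν ν' X Y Z W) :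
    ν' = 0 ∧ ∀ v, fderiv ℝ c z v = (ν - c z ^ 2) * θ G Ξ f z v := by
  obtain ⟨J, hJ⟩ := h.exists_J hz
  have hS := h.isScreenAlgebra hz hJ
  -- Two expressions for the curvature applied to `n`: one from the umbilical derivative of `n`, one
  -- from the model tensor.
  have key : ∀ u v w, (fderiv ℝ c z u + c z ^ 2 * θ G Ξ f z u) * gM G f z v w -
      (fderiv ℝ c z v + c z ^ 2 * θ G Ξ f z v) * gM G f z u w =
      ν * (θ G Ξ f z u * gM G f z v w - θ G Ξ f z v * gM G f z u w) -
      ν' * (θ G Ξ f z u * gM G f z (J v) w - θ G Ξ f z v * gM G f z (J u) w) := by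
    intro u v w
    rw [← h.ω_eq hz hJ, ← h.ω_eq hz hJ, ← h.modelCurvature_n hz, ← hcurv, h.curvature_n hc hz,
      ← gM_apply]
    simp only [map_sub, map_smul, sub_apply, smul_apply, hS.g_x₀, smul_eq_mul]
    ring
  have two : ∀ {a b p q : ℝ}, p ≠ 0 → a * p + b * q = 0 → a * q - b * p = 0 → a = 0 ∧ b = 0 := by
    intro a b p q hp h1 h2
    have hpq : p ^ 2 + q ^ 2 ≠ 0 := by positivity
    have ha : a * (p ^ 2 + q ^ 2) = 0 := by linear_combination p * h1 + q * h2
    have hb : b * (p ^ 2 + q ^ 2) = 0 := by linear_combination q * h1 - p * h2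
    exact ⟨(mul_eq_zero.1 ha).resolve_right hpq, (mul_eq_zero.1 hb).resolve_right hpq⟩
  obtain ⟨v, w, hv, hw, hvw⟩ := hS.exists_pair hdim
  -- Take `u = x₀` and `v` in the screen. Together with its version for `J w` this is an invertible
  -- rotation-type system, so both coefficients vanish.
  have k1 : ∀ w, (fderiv ℝ c z (x₀ z) + c z ^ 2 - ν) * gM G f z v w + ν' * gM G f z (J v) w
      = 0 := by
    intro w
    have := key (x₀ z) v w
    rw [hv, hS.θ_x₀, hS.g_x₀] at this
    linear_combination this
  have k2 := k1 (J w)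
  rw [hS.g_J_J, ← hS.J_symm] at k2
  obtain ⟨ha, hb⟩ := two hvw (k1 w) (by linear_combination k2)
  -- For screen directions compare `u` with `J u`: all right-hand terms contain `θ` and disappear.
  have k3 : ∀ u, θ G Ξ f z u = 0 → fderiv ℝ c z u = 0 := by
    intro u hu
    by_cases hall : ∀ w, gM G f z u w = 0
    · have := hS.nondeg u hall
      rw [hu, zero_smul] at this
      rw [this, map_zero]
    · push Not at hall
      obtain ⟨w, hw⟩ := hall
      have r : ∀ w, fderiv ℝ c z u * gM G f z (J u) w - fderiv ℝ c z (J u) * gM G f z u w = 0 := by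
        intro w
        have := key u (J u) w
        rw [hu, hS.θ_J] at this
        linear_combination this
      have r2 := r (J w)
      rw [hS.g_J_J, ← hS.J_symm] at r2
      exact (two hw (a := fderiv ℝ c z u) (b := fderiv ℝ c z (J u)) (q := gM G f z (J u) w)
        (by linear_combination -r2) (by linear_combination r w)).1
  refine ⟨hb, fun v => ?_⟩
  have e := k3 (v - θ G Ξ f z v • x₀ z) (by simp [hS.θ_x₀])
  rw [map_sub, map_smul, smul_eq_mul] at e
  linear_combination e + θ G Ξ f z v * ha

omit hc in
omit [FiniteDimensional ℝ E] [FiniteDimensional ℝ F] in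
-- The model tensor for `ν' = 0`, decomposed in the frame of tangent vectors, `Ξ` and `Φn`. The
-- identity is tested against an arbitrary ambient vector.
theorem curvature_f {ν : ℝ}
    (hcurv : ∀ X Y Z W, G (f z) (curvature (leviCivita G) (f z) X Y Z) W =
      modelCurvature (toBilin (G (f z))) (Φ (f z) : F →ₗ[ℝ] F) (Ξ (f z)) ν 0 X Y Z W)
    {J : E →ₗ[ℝ] E} (hJ : ∀ v, fderiv ℝ f z (J v) =
      Φ (f z) (fderiv ℝ f z v - θ G Ξ f z v • fderiv ℝ f z (x₀ z))) (u v w : E) :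
    curvature (leviCivita G) (f z) (fderiv ℝ f z u) (fderiv ℝ f z v) (fderiv ℝ f z w) =
      fderiv ℝ f z (ν • ((gM G f z v w - θ G Ξ f z v * θ G Ξ f z w) • u - gM G f z (J v) w • J u
        - (gM G f z u w - θ G Ξ f z u * θ G Ξ f z w) • v + gM G f z (J u) w • J v))
      + (-ν * (gM G f z v w * θ G Ξ f z u - gM G f z u w * θ G Ξ f z v)) • Ξ (f z)
      + (-ν * (gM G f z (J v) w * θ G Ξ f z u - gM G f z (J u) w * θ G Ξ f z v)) •
        Φ (f z) (n Ξ f x₀ z) := by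
  refine eq_of_form_eq (b := G (f z)) (fun v hv => h.ambient.nondeg (h.mapsTo z hz) v hv)
    fun W => ?_
  rw [hcurv]
  have e : ∀ u, fderiv ℝ f z (J u) =
      Φ (f z) (fderiv ℝ f z u) - θ G Ξ f z u • Φ (f z) (n Ξ f x₀ z) := fun u => by
    rw [h.Φ_f_eq hz hJ]; abel
  simp only [map_add, map_sub, map_smul, add_apply, sub_apply, smul_apply, smul_eq_mul, e,
    ← h.ω_eq hz hJ]
  simp only [modelCurvature, toBilin_apply, ContinuousLinearMap.coe_coe, ← θ_apply, ← gM_apply]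
  ring

/-- The curvature of the induced connection. -/
theorem curvature_induced {ν : ℝ}
    (hcurv : ∀ X Y Z W, G (f z) (curvature (leviCivita G) (f z) X Y Z) W =
      modelCurvature (toBilin (G (f z))) (Φ (f z) : F →ₗ[ℝ] F) (Ξ (f z)) ν 0 X Y Z W)
    {J : E →ₗ[ℝ] E} (hJ : ∀ v, fderiv ℝ f z (J v) =
      Φ (f z) (fderiv ℝ f z v - θ G Ξ f z v • fderiv ℝ f z (x₀ z))) (u v w : E) :
    curvature ΓM z u v w = screenCurvature (gM G f z) (θ G Ξ f z) (x₀ z) J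
      (ν - c z ^ 2 / 2) 0 (-ν) (-(ν - c z ^ 2)) (ν / 2) 0 u v w := by
  have dn := (h.smooth_n hz).differentiableAt_infty
  have dΞ := (h.smooth_Ξf hz).differentiableAt_infty
  have dc := (hc.smooth_c z hz).differentiableAt_infty
  have dc2 : DifferentiableAt ℝ (fun z => -(c z / 2)) z := by
    simpa only [div_eq_mul_inv] using (dc.mul_const (2 : ℝ)⁻¹).fun_neg
  have h1 : ∀ u, covAlong (leviCivita G) f (fun z => Ξ (f z) - n Ξ f x₀ z) z u =
      fderiv ℝ f z (-(c z • (u - θ G Ξ f z u • x₀ z))) := fun u => by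
    rw [covAlong_sub dΞ dn, h.covAlong_Ξf hz, h.covAlong_n hc hz, zero_sub, map_neg, map_smul]
  have h2 : ∀ u, covAlong (leviCivita G) f (fun z => Φ (f z) (n Ξ f x₀ z)) z u =
      fderiv ℝ f z (c z • J u) := fun u => by
    rw [h.covAlong_Φn hz, h.covAlong_n hc hz, map_smul, map_smul, hJ]
    simp only [map_sub, map_smul]
  obtain ⟨p, q, e⟩ := curvature_gauss (ΓM := ΓM)
    (n₁ := fun z => Ξ (f z) - n Ξ f x₀ z) (n₂ := fun z => Φ (f z) (n Ξ f x₀ z))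
    (β₁ := fun z v w => -(c z / 2) * gM G f z v w)
    (β₂ := fun z v w => -(c z) * G (f z) (Φ (f z) (fderiv ℝ f z v)) (fderiv ℝ f z w))
    h.isOpen hz (h.smooth_f z hz) (h.ambient.smooth_Γ (h.mapsTo z hz))
    (hc.smooth_ΓM z hz).differentiableAt_infty (dΞ.fun_sub dn)
    (h.smooth_Φn hz).differentiableAt_infty
    (fun v w => dc2.fun_mul (h.smooth_gM hz v w).differentiableAt_infty)
    (fun v w => dc.fun_neg.fun_mul (h.smooth_ω hz v w).differentiableAt_infty)
    (fun z hz v w => h.gauss_formula hc hz v w) h1 h2 u v w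
  rw [h.curvature_f hz hcurv hJ, ← sub_eq_zero] at e
  simp only [h.ω_eq hz hJ] at e
  have hn : n Ξ f x₀ z = fderiv ℝ f z (x₀ z) - Ξ (f z) := rfl
  -- The transversal vector is `Ξ - n = 2Ξ - df(x₀)`, so a coefficient `a` of `Ξ` contributes `(a/2)
  -- x₀` to the tangent part. This is the origin of the coefficient `ν/2`.
  have e' : ∀ (A K : E) (a b p q : ℝ) , fderiv ℝ f z A + a • Ξ (f z) + b • Φ (f z) (n Ξ f x₀ z)
      - (fderiv ℝ f z K + p • (Ξ (f z) - n Ξ f x₀ z) + q • Φ (f z) (n Ξ f x₀ z)) = 0 →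
      K = A + (a / 2) • x₀ z := by
    intro A K a b p q h0
    obtain ⟨e1, e2, -⟩ := h.frame_eq_zero hz (v := A - K + p • x₀ z) (a := a - 2 * p) (b := b - q)
      (by
        rw [← h0, map_add, map_sub, map_smul]
        nth_rw 3 [hn]
        module)
    have hp : a / 2 = p := by linarith
    rw [hp, eq_comm, ← sub_eq_zero, ← e1]
    abel
  have e3 := e' _ _ _ _ _ _ e
  rw [← sub_eq_zero] at e3 ⊢
  rw [← e3, screenCurvature]
  module

omit hc in
omit [FiniteDimensional ℝ E] [FiniteDimensional ℝ F] in
theorem gt_eq {gt : E → E →L[ℝ] E →L[ℝ] ℝ}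
    (hgt : ∀ z ∈ U, ∀ v w, gt z v w = G (f z) (fderiv ℝ f z v) (Φ (f z) (fderiv ℝ f z w))
      + θ G Ξ f z v * θ G Ξ f z w)
    {J : E →ₗ[ℝ] E} (hJ : ∀ v, fderiv ℝ f z (J v) =
      Φ (f z) (fderiv ℝ f z v - θ G Ξ f z v • fderiv ℝ f z (x₀ z))) (v w : E) :
    gt z v w = gM G f z (J v) w + θ G Ξ f z v * θ G Ξ f z w := by
  rw [hgt z hz, ← h.Φ_symm hz, h.ω_eq hz hJ]

omit hc in
-- The `θ` term sees the radical direction, and `J` is invertible on the screen, so the metric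
-- induced by the associated metric is nondegenerate although `gM` is not.
theorem gt_nondeg {gt : E → E →L[ℝ] E →L[ℝ] ℝ}
    (hgt : ∀ z ∈ U, ∀ v w, gt z v w = G (f z) (fderiv ℝ f z v) (Φ (f z) (fderiv ℝ f z w))
      + θ G Ξ f z v * θ G Ξ f z w) (v : E) (hv : ∀ w, gt z v w = 0) : v = 0 := by
  obtain ⟨J, hJ⟩ := h.exists_J hz
  have hS := h.isScreenAlgebra hz hJ
  have h0 : θ G Ξ f z v = 0 := by
    have := hv (x₀ z)
    rwa [h.gt_eq hz hgt hJ, hS.θ_x₀, hS.g_x₀', zero_add, mul_one] at this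
  have h1 : J v = 0 := by
    rw [hS.nondeg (J v) fun w => ?_, hS.θ_J, zero_smul]
    have := hv w
    rwa [h.gt_eq hz hgt hJ, h0, zero_mul, add_zero] at this
  have h2 := hS.J_J v
  rw [h1, h0, map_zero, zero_smul, sub_zero] at h2
  exact neg_eq_zero.1 h2.symm

omit hc in
omit [FiniteDimensional ℝ F] in
theorem smooth_gt {gt : E → E →L[ℝ] E →L[ℝ] ℝ}
    (hgt : ∀ z ∈ U, ∀ v w, gt z v w = G (f z) (fderiv ℝ f z v) (Φ (f z) (fderiv ℝ f z w))
      + θ G Ξ f z v * θ G Ξ f z w) : ContDiffAt ℝ ∞ gt z := by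
  refine contDiffAt_form h.isOpen (fun v w z hz => ?_) hz
  have hev : (fun z => gt z v w) =ᶠ[𝓝 z] fun z =>
      G (f z) (Φ (f z) (fderiv ℝ f z v)) (fderiv ℝ f z w) + θ G Ξ f z v * θ G Ξ f z w := by
    filter_upwards [h.isOpen.mem_nhds hz] with z hz
    rw [hgt z hz, h.Φ_symm hz]
  exact ((h.smooth_ω hz v w).add ((h.smooth_θ hz v).mul (h.smooth_θ hz w))).congr_of_eventuallyEq
    hev

/-- The Gauss formula for the Levi-Civita connection of the metric induced by the associated
metric. -/
theorem gauss_formula_assoc {gt : E → E →L[ℝ] E →L[ℝ] ℝ}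
    (hgt : ∀ z ∈ U, ∀ v w, gt z v w = G (f z) (fderiv ℝ f z v) (Φ (f z) (fderiv ℝ f z w))
      + θ G Ξ f z v * θ G Ξ f z w) (v w : E) :
    covAlong (leviCivita G) f (fun z => fderiv ℝ f z w) z v =
      fderiv ℝ f z (leviCivita gt z v w) + (c z * gM G f z v w) • n Ξ f x₀ z
      + (c z * G (f z) (Φ (f z) (fderiv ℝ f z v)) (fderiv ℝ f z w)) •
        (fderiv ℝ f z (x₀ z) - Φ (f z) (n Ξ f x₀ z)) := by
  let b : E →L[ℝ] E →L[ℝ] ℝ := (1 / 2 : ℝ) • gM G f z +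
    (ContinuousLinearMap.precomp ℝ (fderiv ℝ f z)).comp
      (((G (f z)).comp (Φ (f z))).comp (fderiv ℝ f z))
  -- `T` is the tangential part of the ambient derivative after replacing the transversal frame by
  -- `n` and `df(x₀) - Φn`, which are orthogonal to the submanifold for the associated metric. It is
  -- symmetric and metric, hence the Levi-Civita connection of `gt`.
  let T : E →L[ℝ] E →L[ℝ] E := ΓM z - (ContinuousLinearMap.compL ℝ E ℝ E
    (ContinuousLinearMap.toSpanSingleton ℝ (c z • x₀ z))).comp b
  have hTv : ∀ v w, T v w = ΓM z v w - (gM G f z v w / 2 +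
      G (f z) (Φ (f z) (fderiv ℝ f z v)) (fderiv ℝ f z w)) • c z • x₀ z := by
    intro v w
    have : b v w = gM G f z v w / 2 +
      G (f z) (Φ (f z) (fderiv ℝ f z v)) (fderiv ℝ f z w) := by
      simp [b]
      ring
    rw [← this]
    simp [T]
  have hT : ∀ v w, covAlong (leviCivita G) f (fun z => fderiv ℝ f z w) z v =
      fderiv ℝ f z (T v w) + (c z * gM G f z v w) • n Ξ f x₀ z
      + (c z * G (f z) (Φ (f z) (fderiv ℝ f z v)) (fderiv ℝ f z w)) •
        (fderiv ℝ f z (x₀ z) - Φ (f z) (n Ξ f x₀ z)) := by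
    intro v w
    rw [h.gauss_formula hc hz, hTv, map_sub, map_smul, map_smul]
    have hn : Ξ (f z) = fderiv ℝ f z (x₀ z) - n Ξ f x₀ z := by rw [n_eq]; abel
    nth_rw 1 [hn]
    module
  have hsymm : ∀ v w, T v w = T w v := by
    intro v w
    apply h.injective z hz
    have e1 := hT v w
    rw [covAlong_fderiv_comm (h.smooth_f z hz) (h.ambient.Γ_symm (h.mapsTo z hz)), hT w v,
      gM_apply, gM_apply, h.symm hz (fderiv ℝ f z w), h.Φ_symm hz (fderiv ℝ f z w),
      h.symm hz (fderiv ℝ f z w)] at e1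
    exact (add_right_cancel (add_right_cancel e1)).symm
  have heq : leviCivita gt z = T := by
    refine leviCivita_eq (fun v w => ?_) (h.gt_nondeg hz hgt) hsymm fun u v w => ?_
    · rw [hgt z hz, hgt z hz, ← h.Φ_symm hz, h.symm hz, mul_comm]
    · have hd := (h.smooth_gt hz hgt).differentiableAt_infty
      have hf := (h.smooth_f z hz).differentiableAt_infty
      have e1 : fderiv ℝ gt z u v w = fderiv ℝ (fun p => gt p v w) z u := by
        rw [((hd.hasFDerivAt.clm_apply (hasFDerivAt_const v z)).clm_apply
          (hasFDerivAt_const w z)).fderiv]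
        simp
      have hev : (fun p => gt p v w) =ᶠ[𝓝 z] fun z =>
          G (f z) (fderiv ℝ f z v) (Φ (f z) (fderiv ℝ f z w)) + θ G Ξ f z v * θ G Ξ f z w := by
        filter_upwards [h.isOpen.mem_nhds hz] with p hp using hgt p hp v w
      have dD := fun w => (h.smooth_Df hz w).differentiableAt_infty
      have dΦ := (h.smooth_Φf hz).differentiableAt_infty.clm_apply (dD w)
      have dθ := fun w => (h.smooth_θ hz w).differentiableAt_infty
      have d1 := ((h.smooth_Gf hz).differentiableAt_infty.clm_apply (dD v)).clm_apply dΦ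
      have fθ : ∀ w, fderiv ℝ (fun z => θ G Ξ f z w) z u =
          G (f z) (Ξ (f z)) (covAlong (leviCivita G) f (fun z => fderiv ℝ f z w) z u) := by
        intro w
        have := h.ambient.fderiv_G (W := fun z => Ξ (f z)) (h.mapsTo z hz) hf
          (h.smooth_Ξf hz).differentiableAt_infty (dD w) u
        rw [h.covAlong_Ξf hz, map_zero, zero_apply, zero_add] at this
        exact this
      have i1 : ∀ w, G (f z) (n Ξ f x₀ z) (Φ (f z) (fderiv ℝ f z w)) = 0 := fun w => by
        rw [← h.Φ_symm hz, h.Φn_f hz]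
      have i2 : ∀ w, G (f z) (fderiv ℝ f z (x₀ z)) (Φ (f z) (fderiv ℝ f z w)) = 0 := fun w => by
        rw [← h.Φ_symm hz, h.normal z hz]
      have i3 : ∀ w, G (f z) (Φ (f z) (n Ξ f x₀ z)) (Φ (f z) (fderiv ℝ f z w)) =
          θ G Ξ f z w := fun w => by
        rw [h.ambient.G_Φ_Φ (h.mapsTo z hz), h.n_f hz, h.Ξ_n hz]; ring
      have j : ∀ v w, G (f z) (covAlong (leviCivita G) f (fun z => fderiv ℝ f z v) z u)
          (Φ (f z) (fderiv ℝ f z w)) = G (f z) (fderiv ℝ f z (T u v)) (Φ (f z) (fderiv ℝ f z w)) -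
          c z * G (f z) (Φ (f z) (fderiv ℝ f z u)) (fderiv ℝ f z v) * θ G Ξ f z w := by
        intro v w
        rw [hT]
        simp only [map_add, map_sub, map_smul, add_apply, sub_apply, smul_apply, i1, i2, i3,
          smul_eq_mul]
        ring
      have k : ∀ v, G (f z) (Ξ (f z)) (covAlong (leviCivita G) f (fun z => fderiv ℝ f z v) z u) =
          θ G Ξ f z (T u v) + c z * G (f z) (Φ (f z) (fderiv ℝ f z u)) (fderiv ℝ f z v) := by
        intro v
        rw [hT]
        simp only [map_add, map_sub, map_smul, h.Ξ_n hz, h.Ξ_Φ hz, h.normalized z hz,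
          smul_eq_mul, θ_apply]
        ring
      rw [e1, hev.fderiv_eq, fderiv_fun_add d1 ((dθ v).fun_mul (dθ w)), add_apply,
        fderiv_fun_mul (dθ v) (dθ w), add_apply, smul_apply, smul_apply, fθ, fθ,
        h.ambient.fderiv_G (W' := fun z => Φ (f z) (fderiv ℝ f z w)) (h.mapsTo z hz) hf (dD v) dΦ,
        h.ambient.covAlong_Φ (h.mapsTo z hz) hf (dD w), hgt z hz, hgt z hz,
        ← h.Φ_symm hz (fderiv ℝ f z v), h.symm hz (Φ (f z) (fderiv ℝ f z v)),
        ← h.Φ_symm hz (fderiv ℝ f z v), h.symm hz (Φ (f z) (fderiv ℝ f z v)), j, j, k, k]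
      simp only [smul_eq_mul]
      ring
  rw [heq, hT]

/-- The curvature of the Levi-Civita connection of the metric induced by the associated metric. -/
theorem curvature_assoc {gt : E → E →L[ℝ] E →L[ℝ] ℝ}
    (hgt : ∀ z ∈ U, ∀ v w, gt z v w = G (f z) (fderiv ℝ f z v) (Φ (f z) (fderiv ℝ f z w))
      + θ G Ξ f z v * θ G Ξ f z w) {ν : ℝ}
    (hcurv : ∀ X Y Z W, G (f z) (curvature (leviCivita G) (f z) X Y Z) W =
      modelCurvature (toBilin (G (f z))) (Φ (f z) : F →ₗ[ℝ] F) (Ξ (f z)) ν 0 X Y Z W)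
    {J : E →ₗ[ℝ] E} (hJ : ∀ v, fderiv ℝ f z (J v) =
      Φ (f z) (fderiv ℝ f z v - θ G Ξ f z v • fderiv ℝ f z (x₀ z))) (u v w : E) :
    curvature (leviCivita gt) z u v w = screenCurvature (gM G f z) (θ G Ξ f z) (x₀ z) J
      (ν - c z ^ 2) (-c z ^ 2) (-ν) (-(ν - c z ^ 2)) 0 (-ν) u v w := by
  have dn := (h.smooth_n hz).differentiableAt_infty
  have dΦn := (h.smooth_Φn hz).differentiableAt_infty
  have d0 : DifferentiableAt ℝ (fun z => fderiv ℝ f z (x₀ z)) z :=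
    (h.smooth_f z hz).fderiv_infty.differentiableAt_infty.clm_apply
      (h.smooth_x₀ z hz).differentiableAt_infty
  have dc := (hc.smooth_c z hz).differentiableAt_infty
  have h1 : ∀ u, covAlong (leviCivita G) f (n Ξ f x₀) z u =
      fderiv ℝ f z (c z • (u - θ G Ξ f z u • x₀ z)) := fun u => by
    rw [h.covAlong_n hc hz, map_smul]
  have h2 : ∀ u, covAlong (leviCivita G) f
      (fun z => fderiv ℝ f z (x₀ z) - Φ (f z) (n Ξ f x₀ z)) z u =
      fderiv ℝ f z (c z • (u - θ G Ξ f z u • x₀ z) - c z • J u) := fun u => by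
    rw [covAlong_sub d0 dΦn, h.covAlong_fderiv_x₀ hz, h.covAlong_Φn hz, h.covAlong_n hc hz]
    simp only [map_sub, map_smul, hJ]
  obtain ⟨p, q, e⟩ := curvature_gauss (ΓM := leviCivita gt)
    (n₁ := n Ξ f x₀) (n₂ := fun z => fderiv ℝ f z (x₀ z) - Φ (f z) (n Ξ f x₀ z))
    (β₁ := fun z v w => c z * gM G f z v w)
    (β₂ := fun z v w => c z * G (f z) (Φ (f z) (fderiv ℝ f z v)) (fderiv ℝ f z w))
    h.isOpen hz (h.smooth_f z hz) (h.ambient.smooth_Γ (h.mapsTo z hz))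
    (contDiffAt_leviCivita (h.gt_nondeg hz hgt) (h.smooth_gt hz hgt)).differentiableAt_infty
    dn (d0.fun_sub dΦn)
    (fun v w => dc.fun_mul (h.smooth_gM hz v w).differentiableAt_infty)
    (fun v w => dc.fun_mul (h.smooth_ω hz v w).differentiableAt_infty)
    (fun z hz v w => h.gauss_formula_assoc hc hz hgt v w) h1 h2 u v w
  rw [h.curvature_f hz hcurv hJ, ← sub_eq_zero] at e
  simp only [h.ω_eq hz hJ] at e
  -- Both transversal vectors contain `df(x₀)`, so the coefficients of `Ξ` and of `Φn` each
  -- contribute fully to the `x₀`-component.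
  have e' : ∀ (A K : E) (a b p q : ℝ) , fderiv ℝ f z A + a • Ξ (f z) + b • Φ (f z) (n Ξ f x₀ z)
      - (fderiv ℝ f z K + p • n Ξ f x₀ z + q • (fderiv ℝ f z (x₀ z) - Φ (f z) (n Ξ f x₀ z))) = 0 →
      K = A + (a + b) • x₀ z := by
    intro A K a b p q h0
    have hn : p • n Ξ f x₀ z = p • (fderiv ℝ f z (x₀ z) - Ξ (f z)) := rfl
    rw [hn] at h0
    obtain ⟨e1, e2, e3⟩ := h.frame_eq_zero hz (v := A - K - (p + q) • x₀ z) (a := a + p)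
      (b := b + q)
      (by
        rw [← h0, map_sub, map_sub, map_smul]
        module)
    have hpq : a + b = -(p + q) := by linarith
    rw [hpq, eq_comm, ← sub_eq_zero, ← e1]
    module
  have e3 := e' _ _ _ _ _ _ e
  rw [← sub_eq_zero] at e3 ⊢
  rw [← e3, screenCurvature]
  module

end

end IsLocalScreen

end LocalCurvature

/-! ### Smoothness of bundle sections read in charts. -/

section ChartSmooth

variable {D : Type*} [NormedAddCommGroup D] [NormedSpace ℝ D]
  {E : Type*} [NormedAddCommGroup E] [NormedSpace ℝ E]
  {F : Type*} [NormedAddCommGroup F] [NormedSpace ℝ F]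
  {M : Type*} [TopologicalSpace M] [ChartedSpace E M] [IsManifold 𝓘(ℝ, E) ∞ M]
  {N : Type*} [TopologicalSpace N] [ChartedSpace F N] [IsManifold 𝓘(ℝ, F) ∞ N]

theorem contMDiffAt_tangentMap_comp {f : M → N} {s : Set M} (hs : IsOpen s)
    (hf : ContMDiffOn 𝓘(ℝ, E) 𝓘(ℝ, F) ∞ f s) {σ : D → TangentBundle 𝓘(ℝ, E) M} {y : D}
    (hσ : ContMDiffAt 𝓘(ℝ, D) 𝓘(ℝ, E).tangent ∞ σ y) (hy : (σ y).proj ∈ s) :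
    ContMDiffAt 𝓘(ℝ, D) 𝓘(ℝ, F).tangent ∞
      (fun z => tangentMap 𝓘(ℝ, E) 𝓘(ℝ, F) f (σ z)) y := by
  have h1 := hf.contMDiffOn_tangentMapWithin (m := ∞) (by simp) hs.uniqueMDiffOn
  have hopen : IsOpen (π E (TangentSpace 𝓘(ℝ, E) : M → Type _) ⁻¹' s) :=
    hs.preimage (FiberBundle.continuous_proj E _)
  have h2 := (h1.contMDiffAt (hopen.mem_nhds hy)).comp y hσ
  refine h2.congr_of_eventuallyEq ?_
  filter_upwards [hσ.continuousAt.preimage_mem_nhds (hopen.mem_nhds hy)] with z hz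
  exact (tangentMapWithin_eq_tangentMap (hs.uniqueMDiffOn _ hz)
    ((hf.contMDiffAt (hs.mem_nhds hz)).mdifferentiableAt (by simp))).symm

theorem contMDiffAt_const_vector (v : F) (y : F) :
    ContMDiffAt 𝓘(ℝ, F) 𝓘(ℝ, F).tangent ∞ (fun z => (⟨z, v⟩ : TangentBundle 𝓘(ℝ, F) F)) y :=
  contMDiffAt_vectorSpace_iff_contDiffAt.2 contDiffAt_const

theorem contDiffAt_snd {σ : D → TangentBundle 𝓘(ℝ, F) F} {y : D}
    (hσ : ContMDiffAt 𝓘(ℝ, D) 𝓘(ℝ, F).tangent ∞ σ y) :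
    ContDiffAt ℝ ∞ (fun z => ((σ z).2 : F)) y :=
  ((contMDiff_snd_tangentBundle_modelSpace F 𝓘(ℝ, F)).contMDiffAt.comp y hσ).contDiffAt

variable {d : OpenPartialHomeomorph N F} (hd : d ∈ IsManifold.maximalAtlas 𝓘(ℝ, F) ∞ N)

include hd

theorem contMDiffAt_ofChart {y : F} (hy : y ∈ d.target) (v : F) :
    ContMDiffAt 𝓘(ℝ, F) 𝓘(ℝ, F).tangent ∞
      (fun z => (⟨d.symm z, ofChart d z v⟩ : TangentBundle 𝓘(ℝ, F) N)) y :=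
  contMDiffAt_tangentMap_comp d.open_target (contMDiffOn_symm_of_mem_maximalAtlas hd)
    (contMDiffAt_const_vector v y) hy

/-- A smooth vector field along a map is smooth in a chart. -/
theorem contDiffAt_chartVec {σ : D → TangentBundle 𝓘(ℝ, F) N} {y : D}
    (hσ : ContMDiffAt 𝓘(ℝ, D) 𝓘(ℝ, F).tangent ∞ σ y) (hy : (σ y).proj ∈ d.source) :
    ContDiffAt ℝ ∞ (fun z => chartVec d (σ z).proj (σ z).2) y :=
  contDiffAt_snd (contMDiffAt_tangentMap_comp d.open_source
    (contMDiffOn_of_mem_maximalAtlas hd) hσ hy)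

theorem contDiffAt_chartForm [FiniteDimensional ℝ F] {g : FormField F N}
    (hg : ContMDiff 𝓘(ℝ, F) (𝓘(ℝ, F).prod 𝓘(ℝ, F →L[ℝ] F →L[ℝ] ℝ)) ∞ (fun x =>
      TotalSpace.mk' (F →L[ℝ] F →L[ℝ] ℝ)
        (E := fun x : N => TangentSpace 𝓘(ℝ, F) x →L[ℝ] TangentSpace 𝓘(ℝ, F) x →L[ℝ] ℝ) x (g x)))
    {y : F} (hy : y ∈ d.target) : ContDiffAt ℝ ∞ (chartForm d g) y := by
  refine contDiffAt_form d.open_target (fun v w y hy => ?_) hy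
  have hs : ContMDiffAt 𝓘(ℝ, F) 𝓘(ℝ, F) ∞ d.symm y :=
    contMDiffAt_symm_of_mem_maximalAtlas hd hy
  have : ContMDiffAt 𝓘(ℝ, F) (𝓘(ℝ, F).prod 𝓘(ℝ)) ∞
      (fun z => TotalSpace.mk' ℝ (E := Bundle.Trivial N ℝ) (d.symm z)
        (g (d.symm z) (ofChart d z v) (ofChart d z w))) y := by
    apply ContMDiffAt.clm_bundle_apply₂ (F₁ := F) (F₂ := F)
    · exact hg.contMDiffAt.comp y hs
    · exact contMDiffAt_ofChart hd hy v
    · exact contMDiffAt_ofChart hd hy w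
  simp only [contMDiffAt_totalSpace] at this
  exact this.2.contDiffAt

theorem contDiffAt_chartEndo [FiniteDimensional ℝ F]
    {φ : ∀ x : N, TangentSpace 𝓘(ℝ, F) x →L[ℝ] TangentSpace 𝓘(ℝ, F) x}
    (hφ : ContMDiff 𝓘(ℝ, F) (𝓘(ℝ, F).prod 𝓘(ℝ, F →L[ℝ] F)) ∞ (fun x =>
      TotalSpace.mk' (F →L[ℝ] F)
        (E := fun x : N => TangentSpace 𝓘(ℝ, F) x →L[ℝ] TangentSpace 𝓘(ℝ, F) x) x (φ x)))
    {y : F} (hy : y ∈ d.target) : ContDiffAt ℝ ∞ (chartEndo d φ) y := by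
  have h1 : ContDiffOn ℝ ∞ (chartEndo d φ) d.target := by
    rw [contDiffOn_clm_apply]
    intro v y hy
    have hs : ContMDiffAt 𝓘(ℝ, F) 𝓘(ℝ, F) ∞ d.symm y :=
      contMDiffAt_symm_of_mem_maximalAtlas hd hy
    have : ContMDiffAt 𝓘(ℝ, F) (𝓘(ℝ, F).prod 𝓘(ℝ, F)) ∞
        (fun z => (TotalSpace.mk' F (E := fun x : N => TangentSpace 𝓘(ℝ, F) x) (d.symm z)
          (φ (d.symm z) (ofChart d z v)))) y := by
      apply ContMDiffAt.clm_bundle_apply (F₁ := F) (F₂ := F)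
      · exact hφ.contMDiffAt.comp y hs
      · exact contMDiffAt_ofChart hd hy v
    exact (contDiffAt_chartVec hd this (d.map_target hy)).contDiffWithinAt
  exact h1.contDiffAt (d.open_target.mem_nhds hy)

omit [IsManifold 𝓘(ℝ, F) ∞ N] in
theorem mdifferentiable_of_mem_maximalAtlas : d.MDifferentiable 𝓘(ℝ, F) 𝓘(ℝ, F) :=
  ⟨(contMDiffOn_of_mem_maximalAtlas hd).mdifferentiableOn (by simp),
    (contMDiffOn_symm_of_mem_maximalAtlas hd).mdifferentiableOn (by simp)⟩

theorem chartVec_ofChart {y : F} (hy : y ∈ d.target) (v : F) :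
    chartVec d (d.symm y) (ofChart d y v) = v := by
  have := (mdifferentiable_of_mem_maximalAtlas hd).comp_symm_deriv hy
  exact DFunLike.congr_fun this v

theorem ofChart_chartVec {y : F} (hy : y ∈ d.target) (v : TangentSpace 𝓘(ℝ, F) (d.symm y)) :
    ofChart d y (chartVec d (d.symm y) v) = v := by
  have := (mdifferentiable_of_mem_maximalAtlas hd).symm_comp_deriv (d.map_target hy)
  have h2 := DFunLike.congr_fun this v
  rw [d.right_inv hy] at h2
  exact h2

end ChartSmooth

theorem curvature_congr {F : Type*} [NormedAddCommGroup F] [NormedSpace ℝ F]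
    {Γ Γ' : F → F →L[ℝ] F →L[ℝ] F} {y : F} (h : Γ =ᶠ[𝓝 y] Γ') (u v w : F) :
    curvature Γ y u v w = curvature Γ' y u v w := by
  rw [curvature, curvature, h.fderiv_eq, h.eq_of_nhds]

/-! ### From the structure axioms to the coordinate model. -/

namespace AlmostContactBMetric

section Pointwise

variable {F : Type*} [NormedAddCommGroup F] [NormedSpace ℝ F]
  {N : Type*} [TopologicalSpace N] [ChartedSpace F N] [IsManifold 𝓘(ℝ, F) ∞ N]
  (A : AlmostContactBMetric F N)

/-- Since `φ²ξ = 0`, applying `φ²` to `φξ` shows that `φξ` is a multiple of `ξ`; applying `φ` once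
more kills it. -/
theorem φ_ξ (x : N) : A.φ x (A.ξ x) = 0 := by
  have h1 : A.φ x (A.φ x (A.ξ x)) = 0 := by
    rw [A.φ_sq, A.η_ξ, one_smul, neg_add_cancel]
  have h2 := A.φ_sq x (A.φ x (A.ξ x))
  rw [h1, map_zero] at h2
  have h3 : A.φ x (A.ξ x) = A.η x (A.φ x (A.ξ x)) • A.ξ x := by
    have := h2.symm
    rwa [neg_add_eq_zero] at this
  have h4 : A.η x (A.φ x (A.ξ x)) • A.φ x (A.ξ x) = 0 := by
    rw [← map_smul, ← h3, h1]
  rcases smul_eq_zero.1 h4 with h | h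
  · rw [h3, h, zero_smul]
  · exact h

theorem η_eq (x : N) (v : TangentSpace 𝓘(ℝ, F) x) : A.η x v = A.g x (A.ξ x) v := by
  have := A.g_φ_φ x (A.ξ x) v
  rw [A.φ_ξ, A.η_ξ, map_zero, one_mul] at this
  change (0 : ℝ) = _ at this
  linarith

theorem η_φ (x : N) (v : TangentSpace 𝓘(ℝ, F) x) : A.η x (A.φ x v) = 0 := by
  have h1 := A.φ_sq x (A.φ x v)
  rw [A.φ_sq x v, map_add, map_neg, map_smul, A.φ_ξ, smul_zero, add_zero, left_eq_add] at h1
  have h2 := congrArg (A.η x) h1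
  rwa [map_smul, A.η_ξ, smul_eq_mul, mul_one, map_zero] at h2

theorem g_φ_left (x : N) (v w : TangentSpace 𝓘(ℝ, F) x) :
    A.g x (A.φ x v) w = A.g x v (A.φ x w) := by
  have h1 := A.g_φ_φ x (A.φ x v) w
  rw [A.φ_sq, A.η_φ, zero_mul, add_zero, map_add, map_neg, map_smul, add_apply, neg_apply,
    smul_apply, ← A.η_eq, A.η_φ, smul_zero, add_zero] at h1
  linarith

end Pointwise

section Chart

variable {F : Type*} [NormedAddCommGroup F] [NormedSpace ℝ F]
  {N : Type*} [TopologicalSpace N] [ChartedSpace F N] [IsManifold 𝓘(ℝ, F) ∞ N]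
  (A : AlmostContactBMetric F N) {d : OpenPartialHomeomorph N F}

/-- The structure vector field read in a chart. -/
noncomputable def chartξ (d : OpenPartialHomeomorph N F) (y : F) : F :=
  chartVec d (d.symm y) (A.ξ (d.symm y))

variable (hd : d ∈ IsManifold.maximalAtlas 𝓘(ℝ, F) ∞ N)

include hd

theorem chartForm_chartVec (g : FormField F N) {x : N} (hx : x ∈ d.source)
    (a b : TangentSpace 𝓘(ℝ, F) x) :
    chartForm d g (d x) (chartVec d x a) (chartVec d x b) = g x a b := by
  obtain ⟨y, hy, rfl⟩ : ∃ y ∈ d.target, d.symm y = x := ⟨d x, d.map_source hx, d.left_inv hx⟩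
  rw [d.right_inv hy]
  change g (d.symm y) (ofChart d y (chartVec d (d.symm y) a))
    (ofChart d y (chartVec d (d.symm y) b)) = _
  rw [ofChart_chartVec hd hy, ofChart_chartVec hd hy]

theorem chartEndo_chartVec (φ : ∀ x : N, TangentSpace 𝓘(ℝ, F) x →L[ℝ] TangentSpace 𝓘(ℝ, F) x)
    {x : N} (hx : x ∈ d.source) (a : TangentSpace 𝓘(ℝ, F) x) :
    chartEndo d φ (d x) (chartVec d x a) = chartVec d x (φ x a) := by
  obtain ⟨y, hy, rfl⟩ : ∃ y ∈ d.target, d.symm y = x := ⟨d x, d.map_source hx, d.left_inv hx⟩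
  rw [d.right_inv hy]
  change chartVec d (d.symm y) (φ (d.symm y) (ofChart d y (chartVec d (d.symm y) a))) = _
  rw [ofChart_chartVec hd hy]

omit hd in
theorem chartξ_apply {x : N} (hx : x ∈ d.source) : A.chartξ d (d x) = chartVec d x (A.ξ x) := by
  obtain ⟨y, hy, rfl⟩ : ∃ y ∈ d.target, d.symm y = x := ⟨d x, d.map_source hx, d.left_inv hx⟩
  rw [d.right_inv hy]
  rfl

omit hd in
theorem exists_chartVec (hd : d ∈ IsManifold.maximalAtlas 𝓘(ℝ, F) ∞ N) {x : N}
    (hx : x ∈ d.source) (v : F) : ∃ a : TangentSpace 𝓘(ℝ, F) x, chartVec d x a = v := by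
  obtain ⟨y, hy, rfl⟩ : ∃ y ∈ d.target, d.symm y = x := ⟨d x, d.map_source hx, d.left_inv hx⟩
  exact ⟨ofChart d y v, chartVec_ofChart hd hy v⟩

theorem isLocalBMetric [FiniteDimensional ℝ F] (hF0 : A.IsF0) :
    IsLocalBMetric d.target (chartForm d A.g) (chartEndo d A.φ) (A.chartξ d) := by
  have halg : ∀ y ∈ d.target, IsBMetricAlgebra (toBilin (chartForm d A.g y))
      (chartEndo d A.φ y : F →ₗ[ℝ] F) (A.chartξ d y) := by
    intro y hy
    obtain ⟨x, hx, rfl⟩ : ∃ x ∈ d.source, d x = y := ⟨d.symm y, d.map_target hy, d.right_inv hy⟩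
    have hsurj := exists_chartVec hd hx
    have hξ := A.chartξ_apply hx
    have hadd : ∀ a b : TangentSpace 𝓘(ℝ, F) x,
        chartVec d x a + chartVec d x b = chartVec d x (a + b) := fun a b =>
      (map_add (mfderiv 𝓘(ℝ, F) 𝓘(ℝ, F) d x) a b).symm
    have hneg : ∀ a : TangentSpace 𝓘(ℝ, F) x, -chartVec d x a = chartVec d x (-a) := fun a =>
      (map_neg (mfderiv 𝓘(ℝ, F) 𝓘(ℝ, F) d x) a).symm
    have hsmul : ∀ (r : ℝ) (a : TangentSpace 𝓘(ℝ, F) x),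
        r • chartVec d x a = chartVec d x (r • a) := fun r a =>
      (map_smul (mfderiv 𝓘(ℝ, F) 𝓘(ℝ, F) d x) r a).symm
    have hzero : chartVec d x 0 = 0 := map_zero (mfderiv 𝓘(ℝ, F) 𝓘(ℝ, F) d x)
    refine ⟨fun v w => ?_, fun v hv => ?_, fun v => ?_, ?_, fun v w => ?_, ?_⟩
    · obtain ⟨a, rfl⟩ := hsurj v
      obtain ⟨b, rfl⟩ := hsurj w
      rw [toBilin_apply, toBilin_apply, chartForm_chartVec hd _ hx, chartForm_chartVec hd _ hx,
        A.g_symm]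
    · obtain ⟨a, rfl⟩ := hsurj v
      rw [A.g_nondegenerate x a fun b => ?_, hzero]
      have := hv (chartVec d x b)
      rwa [toBilin_apply, chartForm_chartVec hd _ hx] at this
    · obtain ⟨a, rfl⟩ := hsurj v
      rw [ContinuousLinearMap.coe_coe, chartEndo_chartVec hd _ hx, chartEndo_chartVec hd _ hx, hξ,
        toBilin_apply, chartForm_chartVec hd _ hx, ← A.η_eq, A.φ_sq, hneg, hsmul, hadd]
    · rw [hξ, toBilin_apply, chartForm_chartVec hd _ hx, ← A.η_eq, A.η_ξ]
    · obtain ⟨a, rfl⟩ := hsurj v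
      obtain ⟨b, rfl⟩ := hsurj w
      rw [ContinuousLinearMap.coe_coe, chartEndo_chartVec hd _ hx, chartEndo_chartVec hd _ hx,
        toBilin_apply, toBilin_apply, chartForm_chartVec hd _ hx, chartForm_chartVec hd _ hx,
        A.g_φ_left]
    · rw [hξ, ContinuousLinearMap.coe_coe, chartEndo_chartVec hd _ hx, A.φ_ξ, hzero]
  refine ⟨d.open_target, fun y hy => contDiffAt_chartForm hd A.smooth_g hy,
    fun y hy => contDiffAt_chartEndo hd A.smooth_φ hy, fun y hy => ?_, halg, fun y hy u w => ?_⟩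
  · have hs : ContMDiffAt 𝓘(ℝ, F) 𝓘(ℝ, F) ∞ d.symm y :=
      contMDiffAt_symm_of_mem_maximalAtlas hd hy
    exact contDiffAt_chartVec hd (A.smooth_ξ.contMDiffAt.comp y hs) (d.map_target hy)
  · exact (halg y hy).nondeg _ fun v => hF0 d hd y hy u w v

theorem chartForm_assoc {y : F} (hy : y ∈ d.target) (v w : F) :
    chartForm d A.assoc y v w = chartForm d A.g y v (chartEndo d A.φ y w) +
      chartForm d A.g y (A.chartξ d y) v * chartForm d A.g y (A.chartξ d y) w := by
  obtain ⟨x, hx, rfl⟩ : ∃ x ∈ d.source, d x = y := ⟨d.symm y, d.map_target hy, d.right_inv hy⟩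
  obtain ⟨a, rfl⟩ := exists_chartVec hd hx v
  obtain ⟨b, rfl⟩ := exists_chartVec hd hx w
  rw [A.chartξ_apply hx, chartEndo_chartVec hd _ hx]
  simp only [chartForm_chartVec hd _ hx]
  rw [A.assoc_apply, A.η_eq, A.η_eq]

/-- The two metrics share their connection, so the second sectional curvature has numerator
`g(R(u,v)v, φu)`, which is the form used by the algebraic lemma. -/
theorem curvature_eq [FiniteDimensional ℝ F] (hF0 : A.IsF0) {ν ν' : N → ℝ}
    (hν : A.HasTotallyRealCurvatures ν ν') {y : F} (hy : y ∈ d.target) (u v w z : F) :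
    chartForm d A.g y (curvature (leviCivita (chartForm d A.g)) y u v w) z =
      modelCurvature (toBilin (chartForm d A.g y)) (chartEndo d A.φ y : F →ₗ[ℝ] F) (A.chartξ d y)
        (ν (d.symm y)) (ν' (d.symm y)) u v w z := by
  have h := A.isLocalBMetric hd hF0
  refine h.curvature_eq hy (fun u v hne h1 h2 h3 h4 h5 => ?_) u v w z
  have hsec : A.IsTotallyRealSection d y u v := by
    refine ⟨hne, fun a ha b hb => ?_, fun a ha => ?_⟩
    · obtain ⟨a₁, a₂, rfl⟩ := Submodule.mem_span_pair.1 ha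
      obtain ⟨b₁, b₂, rfl⟩ := Submodule.mem_span_pair.1 hb
      have h2' : chartForm d A.g y (chartEndo d A.φ y v) u = 0 := by
        rw [h.Φ_symm hy, h.symm hy, h2]
      simp only [map_add, map_smul, add_apply, smul_apply, h1, h2, h3, h2', smul_zero, add_zero]
    · have e : A.g (d.symm y) (ofChart d y a) (A.ξ (d.symm y)) =
          chartForm d A.g y a (A.chartξ d y) := by
        change _ = A.g (d.symm y) (ofChart d y a) (ofChart d y (chartVec d (d.symm y) _))
        rw [ofChart_chartVec hd hy]
      obtain ⟨a₁, a₂, rfl⟩ := Submodule.mem_span_pair.1 ha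
      rw [e, h.symm hy, map_add, map_smul, map_smul, h4, h5]
      simp
  obtain ⟨e1, e2⟩ := hν d hd y hy u v hsec
  have hev : leviCivita (chartForm d A.assoc) =ᶠ[𝓝 y] leviCivita (chartForm d A.g) := by
    filter_upwards [d.open_target.mem_nhds hy] with y' hy'
    refine h.leviCivita_assoc hy' (fun x hx => A.chartForm_assoc hd hx) ?_
    refine (contDiffAt_form d.open_target (fun v w x hx => ?_) hy').differentiableAt_infty
    have hev : (fun x => chartForm d A.assoc x v w) =ᶠ[𝓝 x] fun y =>
        chartForm d A.g y v (chartEndo d A.φ y w) +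
        chartForm d A.g y (A.chartξ d y) v * chartForm d A.g y (A.chartξ d y) w := by
      filter_upwards [d.open_target.mem_nhds hx] with x' hx' using A.chartForm_assoc hd hx' v w
    have sG := h.smooth_G x hx
    have sξ := sG.clm_apply (h.smooth_Ξ x hx)
    exact (((sG.clm_apply contDiffAt_const).clm_apply ((h.smooth_Φ x hx).clm_apply
      contDiffAt_const)).add ((sξ.clm_apply contDiffAt_const).mul
        (sξ.clm_apply contDiffAt_const))).congr_of_eventuallyEq hev
  rw [sectionalCurvature, div_eq_iff hne] at e1 e2
  refine ⟨e1, ?_⟩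
  rw [A.chartForm_assoc hd hy, h4, mul_zero, add_zero, curvature_congr hev] at e2
  exact e2

end Chart

end AlmostContactBMetric

/-! ### From half lightlike submanifolds to the coordinate model. -/

namespace HalfLightlike

variable {E : Type*} [NormedAddCommGroup E] [NormedSpace ℝ E]
  {F : Type*} [NormedAddCommGroup F] [NormedSpace ℝ F]
  {M : Type*} [TopologicalSpace M] [ChartedSpace E M] [IsManifold 𝓘(ℝ, E) ∞ M]
  {N : Type*} [TopologicalSpace N] [ChartedSpace F N] [IsManifold 𝓘(ℝ, F) ∞ N]

section Pointwise

variable {A : AlmostContactBMetric F N} (H : HalfLightlike E M A.g)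

theorem g_ξ (p : M) (v : TangentSpace 𝓘(ℝ, E) p) :
    A.g (H.ι p) (mfderiv 𝓘(ℝ, E) 𝓘(ℝ, F) H.ι p (H.ξ p))
      (mfderiv 𝓘(ℝ, E) 𝓘(ℝ, F) H.ι p v) = 0 := by
  have : H.ξ p ∈ radical (inducedForm H.ι A.g p) := by
    rw [H.radical_eq]
    exact Submodule.mem_span_singleton_self _
  exact this v

/-- Write the structure vector as `a ξ + b Nl`: evaluating `η̄` on `ξ` gives `b = μ`, and its unit
length gives `2ab = 1`. -/
theorem exists_structure_eq (hA : H.IsAscreen) (p : M) :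
    H.μ p ≠ 0 ∧ A.ξ (H.ι p) = (2 * H.μ p)⁻¹ • mfderiv 𝓘(ℝ, E) 𝓘(ℝ, F) H.ι p (H.ξ p) +
      H.μ p • H.Nl p := by
  obtain ⟨_, ⟨r, hr, rfl⟩, _, hb, hab⟩ := Submodule.mem_sup.1 (hA p)
  obtain ⟨b, rfl⟩ := Submodule.mem_span_singleton.1 hb
  rw [SetLike.mem_coe, H.radical_eq] at hr
  obtain ⟨a, rfl⟩ := Submodule.mem_span_singleton.1 hr
  rw [ContinuousLinearMap.coe_coe, map_smul] at hab
  have e1 : H.μ p = b := by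
    rw [μ, A.η_eq, ← hab, map_add, map_smul, map_smul, add_apply, smul_apply, smul_apply,
      H.g_ξ, H.Nl_ξ]
    simp
  have e2 : 2 * (a * b) = 1 := by
    have h1 : A.g (H.ι p) (A.ξ (H.ι p)) (A.ξ (H.ι p)) = 1 := by rw [← A.η_eq, A.η_ξ]
    rw [← hab] at h1
    simp only [map_add, map_smul, add_apply, smul_apply, H.g_ξ, H.Nl_ξ, H.Nl_Nl,
      A.g_symm _ _ (H.Nl p)] at h1
    simp only [smul_eq_mul] at h1
    linarith
  have hb0 : b ≠ 0 := by rintro rfl; simp at e2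
  refine ⟨e1 ▸ hb0, ?_⟩
  rw [← hab, e1]
  congr 2
  field_simp
  linarith

theorem Nl_eq (hA : H.IsAscreen) (p : M) : H.Nl p = (2 * H.μ p)⁻¹ • ((2 : ℝ) • A.ξ (H.ι p) -
    (H.μ p)⁻¹ • mfderiv 𝓘(ℝ, E) 𝓘(ℝ, F) H.ι p (H.ξ p)) := by
  obtain ⟨h0, h⟩ := H.exists_structure_eq hA p
  rw [h]
  match_scalars <;> field_simp
  ring

theorem exists_L_eq (hR : H.IsRSTHL) (p : M) : ∃ k : ℝ, k ≠ 0 ∧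
    H.L p = k • A.φ (H.ι p) (mfderiv 𝓘(ℝ, E) 𝓘(ℝ, F) H.ι p (H.ξ p)) := by
  have h1 : H.L p ∈ Submodule.span ℝ {H.L p} := Submodule.mem_span_singleton_self _
  rw [← hR p, H.radical_eq] at h1
  obtain ⟨_, ⟨r, hr, rfl⟩, h⟩ := h1
  obtain ⟨k, rfl⟩ := Submodule.mem_span_singleton.1 hr
  rw [ContinuousLinearMap.coe_coe, ContinuousLinearMap.coe_coe, map_smul, map_smul] at h
  refine ⟨k, ?_, h.symm⟩
  rintro rfl
  have := H.L_unit p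
  rw [← h, zero_smul, map_zero] at this
  norm_num at this

theorem g_φ_ξ (hR : H.IsRSTHL) (p : M) (v : TangentSpace 𝓘(ℝ, E) p) :
    A.g (H.ι p) (A.φ (H.ι p) (mfderiv 𝓘(ℝ, E) 𝓘(ℝ, F) H.ι p (H.ξ p)))
      (mfderiv 𝓘(ℝ, E) 𝓘(ℝ, F) H.ι p v) = 0 := by
  obtain ⟨k, hk, h⟩ := H.exists_L_eq hR p
  have h1 := H.L_normal p v
  rw [h, map_smul, smul_apply, smul_eq_mul] at h1
  exact (mul_eq_zero.1 h1).resolve_left hk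

end Pointwise

section Charts

variable {A : AlmostContactBMetric F N} (H : HalfLightlike E M A.g)
  {e : OpenPartialHomeomorph M E} {d : OpenPartialHomeomorph N F}
  (he : e ∈ IsManifold.maximalAtlas 𝓘(ℝ, E) ∞ M) (hd : d ∈ IsManifold.maximalAtlas 𝓘(ℝ, F) ∞ N)

theorem isOpen_chartDomain : IsOpen (H.chartDomain e d) :=
  e.isOpen_inter_preimage_symm (d.open_source.preimage H.smooth_ι.continuous)

/-- The section of the radical normalised by `η̄`, in a chart. -/
noncomputable def normalizedξ (e : OpenPartialHomeomorph M E) (z : E) : E :=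
  (H.μ (e.symm z))⁻¹ • chartVec e (e.symm z) (H.ξ (e.symm z))

include he

omit [IsManifold 𝓘(ℝ, E) ∞ M] in
theorem contMDiffAt_comp_symm {z : E} (hz : z ∈ e.target) :
    ContMDiffAt 𝓘(ℝ, E) 𝓘(ℝ, E) ∞ e.symm z := contMDiffAt_symm_of_mem_maximalAtlas he hz

theorem ofChart_normalizedξ {z : E} (hz : z ∈ e.target) :
    ofChart e z (H.normalizedξ e z) = (H.μ (e.symm z))⁻¹ • H.ξ (e.symm z) := by
  rw [normalizedξ, ← ofChart_chartVec he hz (H.ξ (e.symm z)), chartVec_ofChart he hz]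
  exact map_smul (mfderiv 𝓘(ℝ, E) 𝓘(ℝ, E) e.symm z) _ _

include hd

theorem contDiffAt_chartMap {z : E} (hz : z ∈ H.chartDomain e d) :
    ContDiffAt ℝ ∞ (H.chartMap e d) z := by
  have h1 : ContMDiffAt 𝓘(ℝ, E) 𝓘(ℝ, F) ∞ (fun z => H.ι (e.symm z)) z :=
    H.smooth_ι.contMDiffAt.comp z (contMDiffAt_comp_symm he hz.1)
  have h2 : ContMDiffAt 𝓘(ℝ, F) 𝓘(ℝ, F) ∞ d (H.ι (e.symm z)) :=
    contMDiffAt_of_mem_maximalAtlas hd hz.2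
  exact (h2.comp z h1).contDiffAt

theorem fderiv_chartMap {z : E} (hz : z ∈ H.chartDomain e d) (v : E) :
    fderiv ℝ (H.chartMap e d) z v = chartVec d (H.ι (e.symm z))
      (mfderiv 𝓘(ℝ, E) 𝓘(ℝ, F) H.ι (e.symm z) (ofChart e z v)) := by
  have h1 : MDifferentiableAt 𝓘(ℝ, E) 𝓘(ℝ, E) e.symm z :=
    (contMDiffAt_comp_symm he hz.1).mdifferentiableAt (by simp)
  have h2 : MDifferentiableAt 𝓘(ℝ, E) 𝓘(ℝ, F) H.ι (e.symm z) :=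
    H.smooth_ι.contMDiffAt.mdifferentiableAt (by simp)
  have h3 : MDifferentiableAt 𝓘(ℝ, F) 𝓘(ℝ, F) d (H.ι (e.symm z)) :=
    (contMDiffAt_of_mem_maximalAtlas hd hz.2).mdifferentiableAt (by simp)
  have e1 := mfderiv_comp z h2 h1
  have e2 := mfderiv_comp z h3 (h2.comp z h1)
  have e3 : mfderiv 𝓘(ℝ, E) 𝓘(ℝ, F) (H.chartMap e d) z =
    mfderiv 𝓘(ℝ, E) 𝓘(ℝ, F) (d ∘ H.ι ∘ e.symm) z := rfl
  rw [← mfderiv_eq_fderiv, e3, e2, e1]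
  rfl

theorem gM_chartMap {z : E} (hz : z ∈ H.chartDomain e d) (v w : E) :
    IsLocalScreen.gM (chartForm d A.g) (H.chartMap e d) z v w =
      chartForm e (inducedForm H.ι A.g) z v w := by
  rw [IsLocalScreen.gM_apply, H.fderiv_chartMap he hd hz, H.fderiv_chartMap he hd hz]
  exact AlmostContactBMetric.chartForm_chartVec hd A.g hz.2 _ _

theorem θ_chartMap {z : E} (hz : z ∈ H.chartDomain e d) (v : E) :
    IsLocalScreen.θ (chartForm d A.g) (A.chartξ d) (H.chartMap e d) z v = H.etaBar e z v := by
  rw [IsLocalScreen.θ_apply, H.fderiv_chartMap he hd hz, chartMap, A.chartξ_apply hz.2,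
    AlmostContactBMetric.chartForm_chartVec hd A.g hz.2, etaBar, A.η_eq]

theorem chartForm_assoc {z : E} (hz : z ∈ H.chartDomain e d) (v w : E) :
    chartForm e (inducedForm H.ι A.assoc) z v w =
      chartForm d A.g (H.chartMap e d z) (fderiv ℝ (H.chartMap e d) z v)
        (chartEndo d A.φ (H.chartMap e d z) (fderiv ℝ (H.chartMap e d) z w)) +
      IsLocalScreen.θ (chartForm d A.g) (A.chartξ d) (H.chartMap e d) z v *
        IsLocalScreen.θ (chartForm d A.g) (A.chartξ d) (H.chartMap e d) z w := by
  rw [H.θ_chartMap he hd hz, H.θ_chartMap he hd hz, H.fderiv_chartMap he hd hz,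
    H.fderiv_chartMap he hd hz, chartMap, AlmostContactBMetric.chartEndo_chartVec hd _ hz.2,
    AlmostContactBMetric.chartForm_chartVec hd A.g hz.2]
  rfl

theorem fderiv_normalizedξ {z : E} (hz : z ∈ H.chartDomain e d) :
    fderiv ℝ (H.chartMap e d) z (H.normalizedξ e z) = (H.μ (e.symm z))⁻¹ •
      chartVec d (H.ι (e.symm z)) (mfderiv 𝓘(ℝ, E) 𝓘(ℝ, F) H.ι (e.symm z) (H.ξ (e.symm z))) := by
  rw [H.fderiv_chartMap he hd hz, H.ofChart_normalizedξ he hz.1, map_smul]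
  exact map_smul (mfderiv 𝓘(ℝ, F) 𝓘(ℝ, F) d _) _ _

theorem injective_fderiv_chartMap {z : E} (hz : z ∈ H.chartDomain e d) :
    Function.Injective (fderiv ℝ (H.chartMap e d) z) := by
  rw [injective_iff_map_eq_zero]
  intro v hv
  rw [H.fderiv_chartMap he hd hz] at hv
  have h2 : mfderiv 𝓘(ℝ, E) 𝓘(ℝ, F) H.ι (e.symm z) (ofChart e z v) = 0 := by
    refine A.g_nondegenerate _ _ fun w => ?_
    rw [← AlmostContactBMetric.chartForm_chartVec hd A.g hz.2, hv, map_zero, zero_apply]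
  have h3 : ofChart e z v = 0 := H.immersion _ (by rw [h2, map_zero])
  rw [← chartVec_ofChart he hz.1 v, h3]
  exact map_zero (mfderiv 𝓘(ℝ, E) 𝓘(ℝ, E) e _)

end Charts

end HalfLightlike

namespace HalfLightlike

variable {E : Type*} [NormedAddCommGroup E] [NormedSpace ℝ E] [FiniteDimensional ℝ E]
  {F : Type*} [NormedAddCommGroup F] [NormedSpace ℝ F] [FiniteDimensional ℝ F]
  {M : Type*} [TopologicalSpace M] [ChartedSpace E M] [IsManifold 𝓘(ℝ, E) ∞ M]
  {N : Type*} [TopologicalSpace N] [ChartedSpace F N] [IsManifold 𝓘(ℝ, F) ∞ N]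
  {A : AlmostContactBMetric F N} (H : HalfLightlike E M A.g)
  {e : OpenPartialHomeomorph M E} {d : OpenPartialHomeomorph N F}

open IsLocalScreen

omit [FiniteDimensional ℝ E] [FiniteDimensional ℝ F] in
theorem contDiffAt_chartVec_ξ (he : e ∈ IsManifold.maximalAtlas 𝓘(ℝ, E) ∞ M) {z : E}
    (hz : z ∈ e.target) :
    ContDiffAt ℝ ∞ (fun z => chartVec e (e.symm z) (H.ξ (e.symm z))) z :=
  contDiffAt_chartVec he (H.smooth_ξ.contMDiffAt.comp z (contMDiffAt_comp_symm he hz))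
    (e.map_target hz)

variable (he : e ∈ IsManifold.maximalAtlas 𝓘(ℝ, E) ∞ M)
  (hd : d ∈ IsManifold.maximalAtlas 𝓘(ℝ, F) ∞ N) (hF0 : A.IsF0) (hA : H.IsAscreen)

include he hd

include hF0 in
theorem contDiffAt_μ {z : E} (hz : z ∈ H.chartDomain e d) :
    ContDiffAt ℝ ∞ (fun z => H.μ (e.symm z)) z := by
  have hL := A.isLocalBMetric hd hF0
  have hf := H.contDiffAt_chartMap he hd hz
  have hfz : H.chartMap e d z ∈ d.target := d.map_source hz.2
  have hev : (fun z => H.μ (e.symm z)) =ᶠ[𝓝 z] fun z => chartForm d A.g (H.chartMap e d z)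
      (A.chartξ d (H.chartMap e d z)) (fderiv ℝ (H.chartMap e d) z
        (chartVec e (e.symm z) (H.ξ (e.symm z)))) := by
    filter_upwards [H.isOpen_chartDomain.mem_nhds hz] with z hz
    rw [H.fderiv_chartMap he hd hz, ofChart_chartVec he hz.1, chartMap, A.chartξ_apply hz.2,
      AlmostContactBMetric.chartForm_chartVec hd A.g hz.2, ← A.η_eq]
    rfl
  exact ((((hL.smooth_G _ hfz).comp z hf).clm_apply ((hL.smooth_Ξ _ hfz).comp z hf)).clm_apply
    (hf.fderiv_infty.clm_apply (H.contDiffAt_chartVec_ξ he hz.1))).congr_of_eventuallyEq hev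

omit [FiniteDimensional ℝ E] [FiniteDimensional ℝ F] in
theorem normal_normalizedξ (hR : H.IsRSTHL) {z : E} (hz : z ∈ H.chartDomain e d) (w : E) :
    chartForm d A.g (H.chartMap e d z) (chartEndo d A.φ (H.chartMap e d z)
      (fderiv ℝ (H.chartMap e d) z (H.normalizedξ e z))) (fderiv ℝ (H.chartMap e d) z w) = 0 := by
  rw [H.fderiv_normalizedξ he hd hz, map_smul, map_smul, smul_apply, H.fderiv_chartMap he hd hz,
    chartMap, AlmostContactBMetric.chartEndo_chartVec hd _ hz.2,
    AlmostContactBMetric.chartForm_chartVec hd A.g hz.2, H.g_φ_ξ hR, smul_zero]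

include hF0 hA

theorem isLocalScreen (hR : H.IsRSTHL) :
    IsLocalScreen d.target (chartForm d A.g) (chartEndo d A.φ) (A.chartξ d) (H.chartDomain e d)
      (H.chartMap e d) (H.normalizedξ e) where
  ambient := A.isLocalBMetric hd hF0
  isOpen := H.isOpen_chartDomain
  mapsTo z hz := d.map_source hz.2
  smooth_f z hz := H.contDiffAt_chartMap he hd hz
  smooth_x₀ z hz := ((H.contDiffAt_μ he hd hF0 hz).inv (H.exists_structure_eq hA _).1).smul
    (H.contDiffAt_chartVec_ξ he hz.1)
  injective z hz := H.injective_fderiv_chartMap he hd hz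
  codim := H.codim
  radical z hz w := by
    rw [H.fderiv_normalizedξ he hd hz, map_smul, smul_apply, H.fderiv_chartMap he hd hz,
      chartMap, AlmostContactBMetric.chartForm_chartVec hd A.g hz.2, H.g_ξ, smul_zero]
  normal z hz w := H.normal_normalizedξ he hd hR hz w
  normalized z hz := by
    rw [H.fderiv_normalizedξ he hd hz, map_smul, chartMap, A.chartξ_apply hz.2,
      AlmostContactBMetric.chartForm_chartVec hd A.g hz.2, ← A.η_eq]
    exact inv_mul_cancel₀ (H.exists_structure_eq hA _).1

omit hF0 in
omit [FiniteDimensional ℝ E] [FiniteDimensional ℝ F] in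
theorem chartVec_Nl {z : E} (hz : z ∈ H.chartDomain e d) :
    chartVec d (H.ι (e.symm z)) (H.Nl (e.symm z)) = (2 * H.μ (e.symm z))⁻¹ •
      (A.chartξ d (H.chartMap e d z) - n (A.chartξ d) (H.chartMap e d) (H.normalizedξ e) z) := by
  have hlin : ∀ (r s t : ℝ) (a b : TangentSpace 𝓘(ℝ, F) (H.ι (e.symm z))),
      chartVec d (H.ι (e.symm z)) (r • (s • a - t • b)) =
        r • (s • chartVec d (H.ι (e.symm z)) a - t • chartVec d (H.ι (e.symm z)) b) := by
    intro r s t a b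
    simp only [chartVec, map_smul, map_sub]
    rfl
  rw [H.Nl_eq hA, hlin, n_eq, H.fderiv_normalizedξ he hd hz, chartMap, A.chartξ_apply hz.2,
    two_smul]
  congr 1
  abel

theorem exists_chartVec_L (hR : H.IsRSTHL) {z : E} (hz : z ∈ H.chartDomain e d) :
    ∃ k : ℝ, k ≠ 0 ∧ chartVec d (H.ι (e.symm z)) (H.L (e.symm z)) =
      k • chartEndo d A.φ (H.chartMap e d z)
        (n (A.chartξ d) (H.chartMap e d) (H.normalizedξ e) z) := by
  have hμ := (H.exists_structure_eq hA (e.symm z)).1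
  obtain ⟨k, hk, hL⟩ := H.exists_L_eq hR (e.symm z)
  refine ⟨k * H.μ (e.symm z), mul_ne_zero hk hμ, ?_⟩
  rw [(H.isLocalScreen he hd hF0 hA hR).Φn_eq hz, H.fderiv_normalizedξ he hd hz, map_smul,
    smul_smul, mul_assoc, mul_inv_cancel₀ hμ, mul_one, chartMap,
    AlmostContactBMetric.chartEndo_chartVec hd _ hz.2, hL]
  exact map_smul (mfderiv 𝓘(ℝ, F) 𝓘(ℝ, F) d _) _ _

omit he hd hF0 hA in
omit [FiniteDimensional ℝ E] [FiniteDimensional ℝ F] in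
theorem gaussFrame_apply (z v : E) (a b : ℝ) : H.gaussFrame e d z (v, a, b) =
    fderiv ℝ (H.chartMap e d) z v + (a • chartVec d (H.ι (e.symm z)) (H.Nl (e.symm z)) +
      b • chartVec d (H.ι (e.symm z)) (H.L (e.symm z))) := rfl

/-- `Nl` has a nonzero `ξ̄`-coefficient modulo tangent vectors and `L` is a nonzero multiple of
`φn`, so independence follows from `frame_eq_zero`. Invertibility ensures that `inverse` is a true
inverse and not its default value `0`. -/
theorem exists_gaussFrame_equiv (hR : H.IsRSTHL) {z : E} (hz : z ∈ H.chartDomain e d) :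
    ∃ T : (E × ℝ × ℝ) ≃L[ℝ] F, (T : (E × ℝ × ℝ) →L[ℝ] F) = H.gaussFrame e d z := by
  have h := H.isLocalScreen he hd hF0 hA hR
  have hμ := (H.exists_structure_eq hA (e.symm z)).1
  obtain ⟨k, hk, hL⟩ := H.exists_chartVec_L he hd hF0 hA hR hz
  have hinj : Function.Injective (H.gaussFrame e d z) := by
    rw [injective_iff_map_eq_zero]
    rintro ⟨v, a, b⟩ h0
    rw [gaussFrame_apply, hL, H.chartVec_Nl he hd hA hz] at h0
    have h1 : fderiv ℝ (H.chartMap e d) z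
        (v - (a * (2 * H.μ (e.symm z))⁻¹) • H.normalizedξ e z) +
        (2 * (a * (2 * H.μ (e.symm z))⁻¹)) • A.chartξ d (H.chartMap e d z) +
        (b * k) • chartEndo d A.φ (H.chartMap e d z)
          (n (A.chartξ d) (H.chartMap e d) (H.normalizedξ e) z) = 0 := by
      rw [← h0, map_sub, map_smul, fderiv_x₀ (Ξ := A.chartξ d)]
      module
    obtain ⟨hv, ha, hb⟩ := h.frame_eq_zero hz h1
    have ha : a = 0 := by simpa [hμ] using ha
    have hb : b = 0 := by simpa [hk] using hb
    rw [ha, zero_mul, zero_smul, sub_zero] at hv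
    rw [hv, ha, hb]
    rfl
  have hdim : Module.finrank ℝ (E × ℝ × ℝ) = Module.finrank ℝ F := by
    rw [H.codim]; simp
  refine ⟨(LinearEquiv.ofInjectiveOfFinrankEq (H.gaussFrame e d z : (E × ℝ × ℝ) →ₗ[ℝ] F) hinj
    hdim).toContinuousLinearEquiv, ?_⟩
  ext v <;> rfl

omit [FiniteDimensional ℝ F] hF0 hA in
theorem contDiffAt_gaussFrame {z : E} (hz : z ∈ H.chartDomain e d) :
    ContDiffAt ℝ ∞ (H.gaussFrame e d) z := by
  have h1 : ContDiffOn ℝ ∞ (H.gaussFrame e d) (H.chartDomain e d) := by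
    rw [contDiffOn_clm_apply]
    rintro ⟨v, a, b⟩ z hz
    have hs := contMDiffAt_comp_symm he hz.1
    have s1 : ContDiffAt ℝ ∞ (fun z => chartVec d (H.ι (e.symm z)) (H.Nl (e.symm z))) z :=
      contDiffAt_chartVec hd (H.smooth_Nl.contMDiffAt.comp z hs) hz.2
    have s2 : ContDiffAt ℝ ∞ (fun z => chartVec d (H.ι (e.symm z)) (H.L (e.symm z))) z :=
      contDiffAt_chartVec hd (H.smooth_L.contMDiffAt.comp z hs) hz.2
    have s3 := (H.contDiffAt_chartMap he hd hz).fderiv_infty.clm_apply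
      (contDiffAt_const (c := v))
    exact (s3.add ((contDiffAt_const.smul s1).add (contDiffAt_const.smul s2))).contDiffWithinAt
  exact h1.contDiffAt (H.isOpen_chartDomain.mem_nhds hz)

omit [FiniteDimensional ℝ E] [FiniteDimensional ℝ F] hF0 hA in
theorem ambientDeriv_apply {z : E} (hz : z ∈ H.chartDomain e d) (v w : E) :
    H.ambientDeriv e d z v w = covAlong (leviCivita (chartForm d A.g)) (H.chartMap e d)
      (fun z => fderiv ℝ (H.chartMap e d) z w) z v := by
  rw [covAlong_fderiv_const (H.contDiffAt_chartMap he hd hz)]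
  rfl

theorem contDiffAt_inducedConnection (hR : H.IsRSTHL) {z : E} (hz : z ∈ H.chartDomain e d) :
    ContDiffAt ℝ ∞ (H.inducedConnection e d) z := by
  refine contDiffAt_form H.isOpen_chartDomain (fun v w z hz => ?_) hz
  have h := H.isLocalScreen he hd hF0 hA hR
  obtain ⟨T, hT⟩ := H.exists_gaussFrame_equiv he hd hF0 hA hR hz
  have s1 : ContDiffAt ℝ ∞ (fun z => (H.gaussFrame e d z).inverse) z := by
    have s0 : ContDiffAt ℝ ∞ ContinuousLinearMap.inverse (H.gaussFrame e d z) := by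
      rw [← hT]
      exact contDiffAt_map_inverse T
    exact s0.comp z (H.contDiffAt_gaussFrame he hd hz)
  have s2 : ContDiffAt ℝ ∞ (fun z => H.ambientDeriv e d z v w) z := by
    have hev : (fun z => H.ambientDeriv e d z v w) =ᶠ[𝓝 z] fun z =>
        covAlong (leviCivita (chartForm d A.g)) (H.chartMap e d)
          (fun z => fderiv ℝ (H.chartMap e d) z w) z v := by
      filter_upwards [H.isOpen_chartDomain.mem_nhds hz] with z hz
      exact H.ambientDeriv_apply he hd hz v w
    exact (contDiffAt_covAlong (h.ambient.smooth_Γ (h.mapsTo z hz)) (h.smooth_f z hz)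
      (h.smooth_Df hz w) v).congr_of_eventuallyEq hev
  exact (s1.clm_apply s2).fst

omit hF0 in
theorem etaM_eq {z : E} (hz : z ∈ H.chartDomain e d) (u : E) :
    H.etaM e z u = (2 * H.μ (e.symm z))⁻¹ * chartForm d A.g (H.chartMap e d z)
      (A.chartξ d (H.chartMap e d z) - n (A.chartξ d) (H.chartMap e d) (H.normalizedξ e) z)
      (fderiv ℝ (H.chartMap e d) z u) := by
  rw [etaM, ← AlmostContactBMetric.chartForm_chartVec hd A.g hz.2, ← H.fderiv_chartMap he hd hz,
    H.chartVec_Nl he hd hA hz, map_smul]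
  rfl

theorem screenProj_eq (hR : H.IsRSTHL) {z : E} (hz : z ∈ H.chartDomain e d) (w : E) :
    H.screenProj e z w =
      w - θ (chartForm d A.g) (A.chartξ d) (H.chartMap e d) z w • H.normalizedξ e z := by
  have h := H.isLocalScreen he hd hF0 hA hR
  rw [screenProj, H.etaM_eq he hd hA hz, map_sub, sub_apply, h.n_f hz, normalizedξ, smul_smul,
    ← θ_apply]
  congr 2
  rw [sub_neg_eq_add, ← two_mul, mul_inv]
  ring

/-- The factor `2μ` comes from `Nl = (ξ̄ - n)/(2μ)`: the coordinate model pairs with `ξ̄ - n`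
instead of `Nl`. -/
theorem isUmbilicConnection (hR : H.IsRSTHL) {γ : M → ℝ} (hγ : H.IsScreenTotallyUmbilical γ) :
    IsUmbilicConnection (chartForm d A.g) (chartEndo d A.φ) (A.chartξ d) (H.chartDomain e d)
      (H.chartMap e d) (H.normalizedξ e) (H.inducedConnection e d)
      (fun z => 2 * H.μ (e.symm z) * γ (e.symm z)) where
  smooth_ΓM z hz := H.contDiffAt_inducedConnection he hd hF0 hA hR hz
  smooth_c z hz := (contDiffAt_const.mul (H.contDiffAt_μ he hd hF0 hz)).mul
    (hγ.1.contMDiffAt.comp z (contMDiffAt_comp_symm he hz.1)).contDiffAt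
  gauss z hz v w := by
    obtain ⟨T, hT⟩ := H.exists_gaussFrame_equiv he hd hF0 hA hR hz
    obtain ⟨k, hk, hL⟩ := H.exists_chartVec_L he hd hF0 hA hR hz
    have e1 : H.gaussFrame e d z ((H.gaussFrame e d z).inverse (H.ambientDeriv e d z v w)) =
        H.ambientDeriv e d z v w := by
      rw [← hT, ContinuousLinearMap.inverse_equiv]
      exact T.apply_symm_apply _
    set q := (H.gaussFrame e d z).inverse (H.ambientDeriv e d z v w) with hq
    have e2 : H.inducedConnection e d z v w = q.1 := rfl
    have e3 : q = (q.1, q.2.1, q.2.2) := rfl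
    rw [e3, gaussFrame_apply, hL, H.chartVec_Nl he hd hA hz] at e1
    refine ⟨q.2.1 * (2 * H.μ (e.symm z))⁻¹, q.2.2 * k, ?_⟩
    rw [← H.ambientDeriv_apply he hd hz, ← e1, e2, smul_smul, smul_smul, add_assoc]
  umbilic z hz v w := by
    have hμ := (H.exists_structure_eq hA (e.symm z)).1
    have h1 := hγ.2 e he d hd z hz v w
    have hev : (fun z => H.screenProj e z w) =ᶠ[𝓝 z] fun z =>
        w - θ (chartForm d A.g) (A.chartξ d) (H.chartMap e d) z w • H.normalizedξ e z := by
      filter_upwards [H.isOpen_chartDomain.mem_nhds hz] with z hz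
      exact H.screenProj_eq he hd hF0 hA hR hz w
    rw [screenForm, hev.fderiv_eq, H.screenProj_eq he hd hF0 hA hR hz, H.etaM_eq he hd hA hz,
      ← H.gM_chartMap he hd hz, inv_mul_eq_iff_eq_mul₀ (mul_ne_zero two_ne_zero hμ)] at h1
    rw [h1]
    ring

end HalfLightlike

/-! ### The equivalences on the manifold. -/

namespace HalfLightlike

open IsLocalScreen

variable {E : Type*} [NormedAddCommGroup E] [NormedSpace ℝ E] [FiniteDimensional ℝ E]
  {F : Type*} [NormedAddCommGroup F] [NormedSpace ℝ F] [FiniteDimensional ℝ F]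
  {M : Type*} [TopologicalSpace M] [ChartedSpace E M] [IsManifold 𝓘(ℝ, E) ∞ M]
  {N : Type*} [TopologicalSpace N] [ChartedSpace F N] [IsManifold 𝓘(ℝ, F) ∞ N]
  {A : AlmostContactBMetric F N} (H : HalfLightlike E M A.g) (hF0 : A.IsF0) {ν ν' : N → ℝ}
  (hν : A.HasTotallyRealCurvatures ν ν') (hR : H.IsRSTHL) (hA : H.IsAscreen) {γ : M → ℝ}
  (hγ : H.IsScreenTotallyUmbilical γ) (hE : 2 ≤ Module.finrank ℝ E)

section Local

variable {e : OpenPartialHomeomorph M E} {d : OpenPartialHomeomorph N F}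
  (he : e ∈ IsManifold.maximalAtlas 𝓘(ℝ, E) ∞ M) (hd : d ∈ IsManifold.maximalAtlas 𝓘(ℝ, F) ∞ N)
  {z : E} (hz : z ∈ H.chartDomain e d)

include hF0 hν hd hz

omit [FiniteDimensional ℝ E] in
theorem curvature_chartMap (X Y Z W : F) :
    chartForm d A.g (H.chartMap e d z)
      (curvature (leviCivita (chartForm d A.g)) (H.chartMap e d z) X Y Z) W =
    modelCurvature (toBilin (chartForm d A.g (H.chartMap e d z)))
      (chartEndo d A.φ (H.chartMap e d z) : F →ₗ[ℝ] F) (A.chartξ d (H.chartMap e d z))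
      (ν (H.ι (e.symm z))) (ν' (H.ι (e.symm z))) X Y Z W := by
  have h := A.curvature_eq hd hF0 hν (d.map_source hz.2) X Y Z W
  rw [d.left_inv hz.2] at h
  exact h

include hR hA hγ hE he

theorem fderiv_umbilicity (v : E) :
    fderiv ℝ (fun z => 2 * H.μ (e.symm z) * γ (e.symm z)) z v =
      (ν (H.ι (e.symm z)) - (2 * H.μ (e.symm z) * γ (e.symm z)) ^ 2) * H.etaBar e z v := by
  rw [← H.θ_chartMap he hd hz]
  exact (IsLocalScreen.fderiv_umbilic (H.isLocalScreen he hd hF0 hA hR)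
    (H.isUmbilicConnection he hd hF0 hA hR hγ) hz hE
    (H.curvature_chartMap hF0 hν hd hz)).2 v

omit hν hE in
theorem differentiableAt_umbilicity :
    DifferentiableAt ℝ (fun z => 2 * H.μ (e.symm z) * γ (e.symm z)) z :=
  ((H.isUmbilicConnection he hd hF0 hA hR hγ).smooth_c z hz).differentiableAt_infty

theorem exists_screenAlgebra : ∃ (θ : E →L[ℝ] ℝ) (J : E →ₗ[ℝ] E),
    IsScreenAlgebra (chartForm e (inducedForm H.ι A.g) z) θ (H.normalizedξ e z) J ∧
    (∀ v, θ v = H.etaBar e z v) ∧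
    (∀ u v w, curvature (H.inducedConnection e d) z u v w =
      screenCurvature (chartForm e (inducedForm H.ι A.g) z) θ (H.normalizedξ e z) J
        (ν (H.ι (e.symm z)) - (2 * H.μ (e.symm z) * γ (e.symm z)) ^ 2 / 2) 0
        (-ν (H.ι (e.symm z)))
        (-(ν (H.ι (e.symm z)) - (2 * H.μ (e.symm z) * γ (e.symm z)) ^ 2))
        (ν (H.ι (e.symm z)) / 2) 0 u v w) ∧
    (∀ u v w, curvature (leviCivita (chartForm e (inducedForm H.ι A.assoc))) z u v w =
      screenCurvature (chartForm e (inducedForm H.ι A.g) z) θ (H.normalizedξ e z) J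
        (ν (H.ι (e.symm z)) - (2 * H.μ (e.symm z) * γ (e.symm z)) ^ 2)
        (-(2 * H.μ (e.symm z) * γ (e.symm z)) ^ 2) (-ν (H.ι (e.symm z)))
        (-(ν (H.ι (e.symm z)) - (2 * H.μ (e.symm z) * γ (e.symm z)) ^ 2)) 0
        (-ν (H.ι (e.symm z))) u v w) ∧
    ∀ v w, chartForm e (inducedForm H.ι A.assoc) z v w =
      chartForm e (inducedForm H.ι A.g) z (J v) w + θ v * θ w := by
  have h := H.isLocalScreen he hd hF0 hA hR
  have hc := H.isUmbilicConnection he hd hF0 hA hR hγ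
  have hcurv := H.curvature_chartMap hF0 hν hd hz
  rw [(h.fderiv_umbilic hc hz hE hcurv).1] at hcurv
  have hg : chartForm e (inducedForm H.ι A.g) z = gM (chartForm d A.g) (H.chartMap e d) z := by
    ext v w
    exact (H.gM_chartMap he hd hz v w).symm
  have hgt := fun z (hz : z ∈ H.chartDomain e d) => H.chartForm_assoc he hd hz
  obtain ⟨J, hJ⟩ := h.exists_J hz
  rw [hg]
  exact ⟨_, J, h.isScreenAlgebra hz hJ, H.θ_chartMap he hd hz,
    h.curvature_induced hc hz hcurv hJ, h.curvature_assoc hc hz hgt hcurv hJ,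
    h.gt_eq hz hgt hJ⟩

end Local

omit [FiniteDimensional ℝ E] [FiniteDimensional ℝ F] in
theorem mem_chartDomain_chartAt (p : M) :
    chartAt E p p ∈ H.chartDomain (chartAt E p) (chartAt F (H.ι p)) := by
  refine ⟨mem_chart_target E p, ?_⟩
  rw [(chartAt E p).left_inv (mem_chart_source E p)]
  exact mem_chart_source F _

include hF0 hν hR hA hγ hE

theorem isRicciSemiSymmetric_iff {m : ℝ} (hm : (Module.finrank ℝ E : ℝ) = m + 1) (hm3 : m ≠ 3)
    (hν0 : ∀ p, ν (H.ι p) ≠ 0) :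
    H.IsRicciSemiSymmetric ↔ ∀ p, ν (H.ι p) = (2 * H.μ p * γ p) ^ 2 := by
  constructor
  · intro h p
    have hz := H.mem_chartDomain_chartAt p
    have he := IsManifold.chart_mem_maximalAtlas (I := 𝓘(ℝ, E)) (n := ∞) p
    have hd := IsManifold.chart_mem_maximalAtlas (I := 𝓘(ℝ, F)) (n := ∞) (H.ι p)
    obtain ⟨θ, J, hS, -, hRc, -⟩ := H.exists_screenAlgebra hF0 hν hR hA hγ hE he hd hz
    have := (hS.curvatureDotRicci_eq_zero_iff hE hRc hm hm3 (hν0 _)).1 (h _ he _ hd _ hz)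
    rwa [(chartAt E p).left_inv (mem_chart_source E p)] at this
  · intro h e he d hd z hz
    obtain ⟨θ, J, hS, -, hRc, -⟩ := H.exists_screenAlgebra hF0 hν hR hA hγ hE he hd hz
    exact (hS.curvatureDotRicci_eq_zero_iff hE hRc hm hm3 (hν0 _)).2 (h _)

theorem isRicciSemiSymmetric_assoc_iff {m : ℝ} (hm : (Module.finrank ℝ E : ℝ) = m + 1)
    (hm1 : 1 < m) (hν0 : ∀ p, ν (H.ι p) ≠ 0) :
    BMetricGeometry.IsRicciSemiSymmetric (inducedForm H.ι A.assoc : FormField E M) ↔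
      ∀ p, ν (H.ι p) = (2 * H.μ p * γ p) ^ 2 := by
  constructor
  · intro h p
    have hz := H.mem_chartDomain_chartAt p
    have he := IsManifold.chart_mem_maximalAtlas (I := 𝓘(ℝ, E)) (n := ∞) p
    have hd := IsManifold.chart_mem_maximalAtlas (I := 𝓘(ℝ, F)) (n := ∞) (H.ι p)
    obtain ⟨θ, J, hS, -, -, hRc, -⟩ := H.exists_screenAlgebra hF0 hν hR hA hγ hE he hd hz
    have := (hS.assoc_curvatureDotRicci_eq_zero_iff hE hRc hm hm1 (hν0 _)).1 (h _ he _ hz.1)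
    rwa [(chartAt E p).left_inv (mem_chart_source E p)] at this
  · intro h e he z hz
    have hd := IsManifold.chart_mem_maximalAtlas (I := 𝓘(ℝ, F)) (n := ∞) (H.ι (e.symm z))
    obtain ⟨θ, J, hS, -, -, hRc, -⟩ := H.exists_screenAlgebra hF0 hν hR hA hγ hE he hd
      ⟨hz, mem_chart_source F _⟩
    exact (hS.assoc_curvatureDotRicci_eq_zero_iff hE hRc hm hm1 (hν0 _)).2 (h _)

theorem eq_sq_of_isEinstein {m : ℝ} (hm : (Module.finrank ℝ E : ℝ) = m + 1) (hm1 : 1 < m)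
    (h : IsEinstein (inducedForm H.ι A.assoc : FormField E M)) (p : M) :
    ν (H.ι p) = (2 * H.μ p * γ p) ^ 2 := by
  obtain ⟨k, hk⟩ := h
  have hz := H.mem_chartDomain_chartAt p
  have he := IsManifold.chart_mem_maximalAtlas (I := 𝓘(ℝ, E)) (n := ∞) p
  have hd := IsManifold.chart_mem_maximalAtlas (I := 𝓘(ℝ, F)) (n := ∞) (H.ι p)
  obtain ⟨θ, J, hS, -, -, hRc, hgt⟩ := H.exists_screenAlgebra hF0 hν hR hA hγ hE he hd hz
  have := hS.eq_sq_of_einstein hE hRc hm hm1 fun v w => by rw [hk _ he _ hz.1, hgt]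
  rwa [(chartAt E p).left_inv (mem_chart_source E p)] at this

/-- Pointwise the Ricci tensor always has the `η̄`-Einstein form, so the information lies in the
constancy of the coefficients. They make `ν` and, because `m ≠ 3`, also `c²` constant; the
derivative formula for `c` along `x₀` then gives the claim. -/
theorem eq_sq_of_isEtaEinstein {m : ℝ} (hm : (Module.finrank ℝ E : ℝ) = m + 1) (hm1 : 1 < m)
    (hm3 : m ≠ 3) (h : H.IsEtaEinstein) (p : M) : ν (H.ι p) = (2 * H.μ p * γ p) ^ 2 := by
  obtain ⟨k, l, hkl⟩ := h
  have hz₀ := H.mem_chartDomain_chartAt p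
  have he := IsManifold.chart_mem_maximalAtlas (I := 𝓘(ℝ, E)) (n := ∞) p
  have hd := IsManifold.chart_mem_maximalAtlas (I := 𝓘(ℝ, F)) (n := ∞) (H.ι p)
  set e := chartAt E p
  set c : E → ℝ := fun z => 2 * H.μ (e.symm z) * γ (e.symm z) with hc
  have hconst : ∀ z ∈ H.chartDomain e (chartAt F (H.ι p)),
      (3 - m) * c z ^ 2 = 2 * k - (2 * m - 3) * (-l / m) := by
    intro z hz
    obtain ⟨θ, J, hS, hθ, hRc, -⟩ := H.exists_screenAlgebra hF0 hν hR hA hγ hE he hd hz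
    have hRic := hS.ricci_eq hRc hm
    have h1 := hkl _ he _ hd z hz (H.normalizedξ e z) (H.normalizedξ e z)
    rw [hRic, ← hθ, hS.g_x₀, hS.θ_x₀] at h1
    obtain ⟨v, w, hv, hw, hvw⟩ := hS.exists_pair hE
    have h2 := hkl _ he _ hd z hz v w
    rw [hRic, ← hθ, ← hθ, hv, hw] at h2
    have h3 : ν (H.ι (e.symm z)) = -l / m := by
      field_simp
      linarith
    have h4 := mul_right_cancel₀ hvw (by linear_combination h2 :
      ((m - 1) * (ν (H.ι (e.symm z)) - c z ^ 2 / 2) + ν (H.ι (e.symm z)) / 2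
        - (ν (H.ι (e.symm z)) - c z ^ 2)) * chartForm e (inducedForm H.ι A.g) z v w = k * _)
    rw [h3] at h4
    linarith
  have hm3' : 3 - m ≠ 0 := sub_ne_zero.2 hm3.symm
  have hsq : ∀ z ∈ H.chartDomain e (chartAt F (H.ι p)), c z ^ 2 = c (e p) ^ 2 := fun z hz =>
    mul_left_cancel₀ hm3' ((hconst z hz).trans (hconst _ hz₀).symm)
  obtain ⟨θ, J, hS, hθ, -⟩ := H.exists_screenAlgebra hF0 hν hR hA hγ hE he hd hz₀
  have hdc := H.fderiv_umbilicity hF0 hν hR hA hγ hE he hd hz₀ (H.normalizedξ e (e p))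
  have hdiff := H.differentiableAt_umbilicity hF0 hR hA hγ he hd hz₀
  rw [← hθ, hS.θ_x₀, mul_one] at hdc
  -- Only `c²` is known to be constant: either `c` vanishes nearby, or `2c dc = 0` with `c ≠ 0`.
  have hzero : fderiv ℝ c (e p) (H.normalizedξ e (e p)) = 0 := by
    by_cases h0 : c (e p) = 0
    · have hev : c =ᶠ[𝓝 (e p)] fun _ => 0 := by
        filter_upwards [H.isOpen_chartDomain.mem_nhds hz₀] with z hz
        have := hsq z hz
        rw [h0] at this
        exact pow_eq_zero_iff two_ne_zero |>.1 (by simpa using this)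
      rw [hev.fderiv_eq]
      simp
    · have hev : (fun z => c z ^ 2) =ᶠ[𝓝 (e p)] fun _ => c (e p) ^ 2 := by
        filter_upwards [H.isOpen_chartDomain.mem_nhds hz₀] with z hz using hsq z hz
      have h1 := DFunLike.congr_fun (hev.fderiv_eq (𝕜 := ℝ)) (H.normalizedξ e (e p))
      rw [(hdiff.hasFDerivAt.pow 2).fderiv] at h1
      have h2 : (H.μ (e.symm (e p)) = 0 ∨ γ (e.symm (e p)) = 0) ∨
          fderiv ℝ c (e p) (H.normalizedξ e (e p)) = 0 := by simpa using h1
      exact h2.resolve_left (by simpa [hc] using h0)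
  rw [hzero] at hdc
  have := (sub_eq_zero.1 hdc.symm)
  rwa [e.left_inv (mem_chart_source E p)] at this

/-- When `ν = c²` the formula `dc = (ν - c²) η̄` gives `dc = 0`, so `c` is locally constant;
connectedness makes the Einstein coefficients global constants. -/
theorem exists_umbilicity_eq [ConnectedSpace M]
    (h : ∀ p, ν (H.ι p) = (2 * H.μ p * γ p) ^ 2) : ∃ r : ℝ, ∀ p, 2 * H.μ p * γ p = r := by
  have hloc : IsLocallyConstant fun p => 2 * H.μ p * γ p := by
    rw [IsLocallyConstant.iff_eventually_eq]
    intro p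
    have hz₀ := H.mem_chartDomain_chartAt p
    have he := IsManifold.chart_mem_maximalAtlas (I := 𝓘(ℝ, E)) (n := ∞) p
    have hd := IsManifold.chart_mem_maximalAtlas (I := 𝓘(ℝ, F)) (n := ∞) (H.ι p)
    obtain ⟨r, hr, hball⟩ := Metric.isOpen_iff.1 H.isOpen_chartDomain _ hz₀
    have hev := ((chartAt E p).continuousAt (mem_chart_source E p)).preimage_mem_nhds
      (Metric.ball_mem_nhds _ hr)
    filter_upwards [hev, chart_source_mem_nhds E p] with q hq hqs
    have := Metric.isOpen_ball.is_const_of_fderiv_eq_zero (𝕜 := ℝ)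
      (f := fun z => 2 * H.μ ((chartAt E p).symm z) * γ ((chartAt E p).symm z))
      (convex_ball (chartAt E p p) r).isPreconnected
      (fun z hz => (H.differentiableAt_umbilicity hF0 hR hA hγ he hd
        (hball hz)).differentiableWithinAt)
      (fun z hz => by
        ext v
        rw [H.fderiv_umbilicity hF0 hν hR hA hγ hE he hd (hball hz), h, sub_self, zero_mul]
        rfl) hq (Metric.mem_ball_self hr)
    simpa only [(chartAt E p).left_inv hqs, (chartAt E p).left_inv (mem_chart_source E p)]
      using this
  obtain ⟨p₀⟩ := (inferInstance : Nonempty M)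
  exact ⟨_, fun p => hloc.apply_eq_of_preconnectedSpace p p₀⟩

theorem isEtaEinstein_of_eq_sq [ConnectedSpace M] {m : ℝ}
    (hm : (Module.finrank ℝ E : ℝ) = m + 1)
    (h : ∀ p, ν (H.ι p) = (2 * H.μ p * γ p) ^ 2) : H.IsEtaEinstein := by
  obtain ⟨r, hr⟩ := H.exists_umbilicity_eq hF0 hν hR hA hγ hE h
  refine ⟨m * r ^ 2 / 2, -(m * r ^ 2), fun e he d hd z hz v w => ?_⟩
  obtain ⟨θ, J, hS, hθ, hRc, -⟩ := H.exists_screenAlgebra hF0 hν hR hA hγ hE he hd hz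
  rw [hS.ricci_eq hRc hm, ← hθ, ← hθ, h, hr]
  ring

theorem isEinstein_of_eq_sq [ConnectedSpace M] {m : ℝ} (hm : (Module.finrank ℝ E : ℝ) = m + 1)
    (h : ∀ p, ν (H.ι p) = (2 * H.μ p * γ p) ^ 2) :
    IsEinstein (inducedForm H.ι A.assoc : FormField E M) := by
  obtain ⟨r, hr⟩ := H.exists_umbilicity_eq hF0 hν hR hA hγ hE h
  refine ⟨-(m * r ^ 2), fun e he z hz v w => ?_⟩
  have hd := IsManifold.chart_mem_maximalAtlas (I := 𝓘(ℝ, F)) (n := ∞) (H.ι (e.symm z))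
  obtain ⟨θ, J, hS, -, -, hRc, hgt⟩ := H.exists_screenAlgebra hF0 hν hR hA hγ hE he hd
    ⟨hz, mem_chart_source F _⟩
  rw [hS.assoc_ricci_eq hRc hm (h _), hgt, h, hr]

end HalfLightlike

end BMetricGeometry

/-! ### The main theorem. -/

open BMetricGeometry in
theorem theorem4p6
    {F : Type*} [NormedAddCommGroup F] [NormedSpace ℝ F]
    {N : Type*} [TopologicalSpace N] [ChartedSpace F N] [IsManifold 𝓘(ℝ, F) ∞ N]
    {E : Type*} [NormedAddCommGroup E] [NormedSpace ℝ E]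
    {M : Type*} [TopologicalSpace M] [ChartedSpace E M] [IsManifold 𝓘(ℝ, E) ∞ M]
    [ConnectedSpace M]
    (n : ℕ) (hn : 2 ≤ n) (hdim : Module.finrank ℝ F = 2 * n + 1)
    (A : AlmostContactBMetric F N) (hF0 : A.IsF0)
    (ν ν' : N → ℝ) (hν : A.HasTotallyRealCurvatures ν ν')
    (H : HalfLightlike E M A.g) (hR : H.IsRSTHL) (hA : H.IsAscreen)
    (γ : M → ℝ) (hγ : H.IsScreenTotallyUmbilical γ)
    (hν0 : ∀ p, ν (H.ι p) ≠ 0) :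
    List.TFAE [
      H.IsRicciSemiSymmetric,
      IsRicciSemiSymmetric (inducedForm H.ι A.assoc : FormField E M),
      H.IsEtaEinstein,
      IsEinstein (inducedForm H.ι A.assoc : FormField E M),
      ∀ p, ν (H.ι p) = 4 * H.μ p ^ 2 * γ p ^ 2] := by
  have hcodim := H.codim
  have : FiniteDimensional ℝ F := Module.finite_of_finrank_pos (by omega)
  have : FiniteDimensional ℝ E := Module.finite_of_finrank_pos (by omega)
  have hE : 2 ≤ Module.finrank ℝ E := by omega
  -- The screen has rank `m = 2n - 2`, since `dim M = 2n - 1` and the radical is a line.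
  have hm : (Module.finrank ℝ E : ℝ) = (2 * n - 2) + 1 := by
    have : (Module.finrank ℝ E : ℝ) + 2 = 2 * n + 1 := by exact_mod_cast hcodim.symm.trans hdim
    linarith
  have hn' : (2 : ℝ) ≤ n := by exact_mod_cast hn
  have hm1 : (1 : ℝ) < 2 * n - 2 := by linarith
  -- Parity excludes the rank at which `c²` drops out of the Ricci tensor of the induced connection.
  have hm3 : (2 : ℝ) * n - 2 ≠ 3 := by
    intro h
    have h5 : (2 * n : ℝ) = 5 := by linarith
    have : 2 * n = 5 := by exact_mod_cast h5
    omega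
  have hsq : (∀ p, ν (H.ι p) = 4 * H.μ p ^ 2 * γ p ^ 2) ↔
      ∀ p, ν (H.ι p) = (2 * H.μ p * γ p) ^ 2 :=
    forall_congr' fun p => by rw [mul_pow, mul_pow]; norm_num
  rw [hsq]
  tfae_have 1 ↔ 5 := H.isRicciSemiSymmetric_iff hF0 hν hR hA hγ hE hm hm3 hν0
  tfae_have 2 ↔ 5 := H.isRicciSemiSymmetric_assoc_iff hF0 hν hR hA hγ hE hm hm1 hν0
  tfae_have 3 → 5 := H.eq_sq_of_isEtaEinstein hF0 hν hR hA hγ hE hm hm1 hm3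
  tfae_have 5 → 3 := H.isEtaEinstein_of_eq_sq hF0 hν hR hA hγ hE hm
  tfae_have 4 → 5 := H.eq_sq_of_isEinstein hF0 hν hR hA hγ hE hm hm1
  tfae_have 5 → 4 := H.isEinstein_of_eq_sq hF0 hν hR hA hγ hE hm
  tfae_finish
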